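/- A \emph{long virtual knot diagram} $D$ is a smooth immersion $f:\mathbb{R}\to\mathbb{R}^2$ with $f(t)=(t,0)$ outside a large circle, all of whose intersection points are transverse double points, each marked as virtual or as classical (with a choice of over- and underpass). A \emph{long virtual knot} is a class of such diagrams modulo planar isotopy and the generalized Reidemeister moves (the classical moves, their purely virtual versions, and the mixed move in which a strand having only virtual crossings passes a classical crossing). Cut $D$ at both passages of every virtual crossing and at the underpass of every classical crossing; the pieces are the \emph{arcs}. A \emph{long arc} is a maximal chain of arcs following each other through virtual crossings, where the initial and the final long arc are united through infinity into one long arc. Exactly one long arc $\gamma^v$ emanates from each classical crossing $v$. Let $\deg a=0$ for the first arc of a long arc $\gamma^v$, and let $\deg$ increase (decrease) by $1$ each time $\gamma^v$ traverses a virtual crossing from the left to the right (from the right to the left) of the transversal branch; passing through infinity on the united long arc does not change $\deg$. Let $T=\mathbb{Z}[p,p^{-1},q,q^{-1}]/((p-1)(p-q),(q-1)(p-q))$. For a classical crossing $v$ and an arc $a$ put $$[v:a]=\varepsilon_1+\varepsilon_2\,(t^{\operatorname{sgn}v}-1)-\varepsilon_3\,t^{\operatorname{sgn}v}\in T,$$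 where $\operatorname{sgn}v=\pm1$ is the local writhe of $v$; $t=p$ if the first passage through $v$ is the overpass and $t=q$ otherwise; and $\varepsilon_1,\varepsilon_2,\varepsilon_3\in\{0,1\}$ equal $1$ precisely when $a$ emanates from $v$, passes over $v$, comes into $v$, respectively. For the classical crossings $v_1,\dots,v_n$ of $D$ and their long arcs $\gamma^j=\gamma^{v_j}$ let $$\zeta(D)=\det(A_{ij})_{i,j=1}^n\in T[s,s^{-1}],\qquad A_{ij}=\sum_{a\subset\gamma^j}[v_i:a]\,s^{\deg a}$$ (with $\zeta(D)=1$ if $n=0$), and let $\deg_s\zeta(D)$ be the largest exponent of $s$ with non-zero coefficient in $\zeta(D)$ ($-\infty$ if $\zeta(D)=0$). Let $D$ be a long virtual knot diagram and let $k$ be the number of its virtual crossings. If $\deg_s\zeta(D)=k$, then every diagram of the same long virtual knot has at least $k$ virtual crossings; that is, $D$ has the minimal number of virtual crossings among all diagrams of its long virtual knot. -/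

import Mathlib

open scoped ContDiff Manifold

noncomputable section

/-! ## The plane -/

/-- The oriented Euclidean plane. -/
abbrev Plane : Type := EuclideanSpace ℝ (Fin 2)

/-- The determinant of the pair `(v, w)`; it is positive iff `w` points to the left of `v`. -/
def Plane.cross (v w : Plane) : ℝ := v 0 * w 1 - v 1 * w 0

/-- An orientation preserving smooth diffeomorphism of the plane. -/
def OrientationPreserving (h : Plane ≃ₘ[ℝ] Plane) : Prop :=
  ∀ x : Plane, 0 < (fderiv ℝ (fun y : Plane => h y) x).det

/-- A smooth orientation preserving change of parameter. -/
def IsReparam (θ : ℝ → ℝ) : Prop :=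
  ContDiff ℝ ∞ θ ∧ ∀ t : ℝ, 0 < deriv θ t

/-! ## Long virtual knot diagrams -/

/-- The structure at an intersection point: classical and the first passage (in the order of the
parameter) is the overpass; classical and the first passage is the underpass; virtual. -/
inductive CrossingKind : Type
  | earlyOver
  | earlyUnder
  | virtual

/-- The intersection points of a curve, each given by its two parameter values `c.1 < c.2`. -/
abbrev DoublePoint (f : ℝ → Plane) : Type :=
  {c : ℝ × ℝ // c.1 < c.2 ∧ f c.1 = f c.2}

/-- A long virtual knot diagram: a smooth immersion of the line into the plane, standard at
infinity, all of whose intersection points are transverse double points, each of them endowed with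
a classical or virtual crossing structure. -/
structure LongVirtualDiagram where
  curve : ℝ → Plane
  smooth : ContDiff ℝ ∞ curve
  immersion : ∀ t : ℝ, deriv curve t ≠ 0
  standard : ∃ R : ℝ, ∀ t : ℝ, R ≤ |t| → curve t = !₂[t, 0]
  double : ∀ a b c : ℝ, curve a = curve b → curve b = curve c → a = b ∨ b = c ∨ a = c
  transverse : ∀ a b : ℝ, a ≠ b → curve a = curve b →
    Plane.cross (deriv curve a) (deriv curve b) ≠ 0
  kind : DoublePoint curve → CrossingKind

namespace LongVirtualDiagram

variable (D : LongVirtualDiagram)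

/-- The crossings of a diagram. -/
abbrev Crossing : Type := DoublePoint D.curve

/-- The classical crossings of a diagram. -/
abbrev ClassicalCrossing : Type := {c : D.Crossing // D.kind c ≠ CrossingKind.virtual}

/-- The virtual crossings of a diagram. -/
abbrev VirtualCrossing : Type := {c : D.Crossing // D.kind c = CrossingKind.virtual}

/-! ### There are finitely many crossings -/

lemma crossing_bounded : ∃ R : ℝ, ∀ a b : ℝ, a ≠ b → D.curve a = D.curve b → |a| ≤ R := by
  obtain ⟨R, hR⟩ := D.standard
  obtain ⟨M, hM⟩ := (isCompact_Icc (a := -R) (b := R)).exists_bound_of_continuousOn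
    (f := D.curve) D.smooth.continuous.continuousOn
  refine ⟨max R M, fun a b hab h => ?_⟩
  by_contra hc
  push Not at hc
  have h1 : R ≤ |a| := ((le_max_left _ _).trans_lt hc).le
  have ha := hR a h1
  by_cases hb : R ≤ |b|
  · rw [ha, hR b hb] at h
    have h0 := congrArg (fun v : Plane => v 0) h
    simp at h0
    exact hab h0
  · push Not at hb
    have h2 := hM b ⟨(abs_lt.1 hb).1.le, (abs_lt.1 hb).2.le⟩
    rw [← h, ha, EuclideanSpace.norm_eq] at h2
    simp [Real.sqrt_sq_eq_abs] at h2
    exact absurd ((le_max_right R M).trans_lt hc) (not_lt.2 h2)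

lemma locally_injective (a : ℝ) :
    ∀ᶠ q : ℝ × ℝ in nhds (a, a), q.1 ≠ q.2 → D.curve q.1 ≠ D.curve q.2 := by
  have hs : HasStrictDerivAt D.curve (deriv D.curve a) a :=
    D.smooth.contDiffAt.hasStrictDerivAt (by simp)
  have ho := hs.hasStrictFDerivAt.isLittleO
  have hpos : 0 < ‖deriv D.curve a‖ := norm_pos_iff.2 (D.immersion a)
  filter_upwards [ho.def (half_pos hpos)] with q hq hne heq
  have hd : 0 < ‖q.1 - q.2‖ := norm_pos_iff.2 (sub_ne_zero.2 hne)
  simp only [heq, sub_self, zero_sub, norm_neg] at hq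
  rw [ContinuousLinearMap.toSpanSingleton_apply, norm_smul] at hq
  nlinarith

lemma isolated (a b : ℝ) (hab : a ≠ b) (h : D.curve a = D.curve b) :
    ∀ᶠ q : ℝ × ℝ in nhdsWithin (a, b) {(a, b)}ᶜ, D.curve q.1 - D.curve q.2 ≠ 0 := by
  have hda : HasDerivAt D.curve (deriv D.curve a) a :=
    (D.smooth.differentiable (by simp) a).hasDerivAt
  have hdb : HasDerivAt D.curve (deriv D.curve b) b :=
    (D.smooth.differentiable (by simp) b).hasDerivAt
  have h1 : HasFDerivAt (fun q : ℝ × ℝ => D.curve q.1)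
      ((ContinuousLinearMap.toSpanSingleton ℝ (deriv D.curve a)).comp
        (ContinuousLinearMap.fst ℝ ℝ ℝ)) (a, b) :=
    HasFDerivAt.comp (a, b) (f := Prod.fst) hda.hasFDerivAt hasFDerivAt_fst
  have h2 : HasFDerivAt (fun q : ℝ × ℝ => D.curve q.2)
      ((ContinuousLinearMap.toSpanSingleton ℝ (deriv D.curve b)).comp
        (ContinuousLinearMap.snd ℝ ℝ ℝ)) (a, b) :=
    HasFDerivAt.comp (a, b) (f := Prod.snd) hdb.hasFDerivAt hasFDerivAt_snd
  refine (h1.sub h2).eventually_ne ?_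
  suffices hi : Function.Injective
      ((ContinuousLinearMap.toSpanSingleton ℝ (deriv D.curve a)).comp
        (ContinuousLinearMap.fst ℝ ℝ ℝ) -
      (ContinuousLinearMap.toSpanSingleton ℝ (deriv D.curve b)).comp
        (ContinuousLinearMap.snd ℝ ℝ ℝ)) by
    obtain ⟨K, -, hK⟩ := (LinearMap.injective_iff_antilipschitz (ContinuousLinearMap.toLinearMap
      ((ContinuousLinearMap.toSpanSingleton ℝ (deriv D.curve a)).comp
        (ContinuousLinearMap.fst ℝ ℝ ℝ) -
      (ContinuousLinearMap.toSpanSingleton ℝ (deriv D.curve b)).comp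
        (ContinuousLinearMap.snd ℝ ℝ ℝ)))).1 hi
    exact ⟨K, hK⟩
  have ht := D.transverse a b hab h
  rw [injective_iff_map_eq_zero]
  rintro ⟨x, y⟩ hxy
  have e0 := congrArg (fun v : Plane => v 0) hxy
  have e1 := congrArg (fun v : Plane => v 1) hxy
  simp [ContinuousLinearMap.toSpanSingleton_apply] at e0 e1
  unfold Plane.cross at ht
  have hx : x * (deriv D.curve a 0 * deriv D.curve b 1 - deriv D.curve a 1 * deriv D.curve b 0) = 0 := by
    linear_combination (deriv D.curve b 1) * e0 - (deriv D.curve b 0) * e1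
  have hy : y * (deriv D.curve a 0 * deriv D.curve b 1 - deriv D.curve a 1 * deriv D.curve b 0) = 0 := by
    linear_combination (deriv D.curve a 1) * e0 - (deriv D.curve a 0) * e1
  have := (mul_eq_zero.1 hx).resolve_right ht
  have := (mul_eq_zero.1 hy).resolve_right ht
  simp_all

instance finite_crossing : Finite D.Crossing := by
  change Finite {c : ℝ × ℝ | c.1 < c.2 ∧ D.curve c.1 = D.curve c.2}
  rw [Set.finite_coe_iff]
  by_contra hinf
  obtain ⟨R, hR⟩ := D.crossing_bounded
  obtain ⟨⟨a, b⟩, -, hacc⟩ := Set.Infinite.exists_accPt_of_subset_isCompact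
    (K := Set.Icc (-R) R ×ˢ Set.Icc (-R) R) hinf (isCompact_Icc.prod isCompact_Icc) (by
      rintro ⟨x, y⟩ ⟨hlt, he⟩
      exact ⟨abs_le.1 (hR x y hlt.ne he), abs_le.1 (hR y x hlt.ne' he.symm)⟩)
  rw [accPt_iff_frequently_nhdsNE] at hacc
  by_cases hc : D.curve a = D.curve b
  · by_cases hab : a = b
    · subst hab
      obtain ⟨q, hq, hq'⟩ :=
        (hacc.and_eventually ((D.locally_injective a).filter_mono nhdsWithin_le_nhds)).exists
      exact hq' hq.1.ne hq.2
    · obtain ⟨q, hq, hq'⟩ := (hacc.and_eventually (D.isolated a b hab hc)).exists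
      exact hq' (sub_eq_zero.2 hq.2)
  · have hcont : Continuous fun q : ℝ × ℝ => D.curve q.1 - D.curve q.2 :=
      (D.smooth.continuous.comp continuous_fst).sub (D.smooth.continuous.comp continuous_snd)
    have := hcont.continuousAt.eventually_ne (x := (a, b)) (sub_ne_zero.2 hc)
    obtain ⟨q, hq, hq'⟩ := (hacc.and_eventually (this.filter_mono nhdsWithin_le_nhds)).exists
    exact hq' (sub_eq_zero.2 hq.2)

instance fintypeClassicalCrossing : Fintype D.ClassicalCrossing := Fintype.ofFinite _

instance decidableEqClassicalCrossing : DecidableEq D.ClassicalCrossing := Classical.decEq _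

instance fintypeVirtualCrossing : Fintype D.VirtualCrossing := Fintype.ofFinite _

/-- The number of virtual crossings of a diagram. -/
def numVirtual : ℕ := Fintype.card D.VirtualCrossing

/-! ## Generalized Reidemeister moves -/

/-- Planar isotopy together with reparametrization of the line: a diffeomorphism of the plane that
is the identity near infinity (hence isotopic to the identity) carries one diagram to the other and
respects the crossing structures. -/
def Isotopic (D D' : LongVirtualDiagram) : Prop :=
  ∃ (h : Plane ≃ₘ[ℝ] Plane) (φ : ℝ → ℝ),
    OrientationPreserving h ∧ (∃ R : ℝ, ∀ x : Plane, R ≤ ‖x‖ → h x = x) ∧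
    IsReparam φ ∧ Function.Bijective φ ∧
    (∀ t : ℝ, D'.curve t = h (D.curve (φ t))) ∧
    ∀ (c : D.Crossing) (c' : D'.Crossing),
      c.1.1 = φ c'.1.1 → c.1.2 = φ c'.1.2 → D'.kind c' = D.kind c

/-- The chart `h` maps the part of the curve `f` in the disc `{x | ‖h x‖ ≤ r}` to the part of the
picture consisting of the oriented strands `M i` in the round disc of radius `r`.
The strand number `i` is run through by `f` during the time interval `[a i, b i]`. -/
def LooksLike {m : ℕ} (f : ℝ → Plane) (h : Plane ≃ₘ[ℝ] Plane) (r : ℝ) (a b : Fin m → ℝ)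
    (M : Fin m → ℝ → Plane) : Prop :=
  (∀ t : ℝ, ‖h (f t)‖ ≤ r ↔ ∃ i, t ∈ Set.Icc (a i) (b i)) ∧
  ∀ i, ∃ θ : ℝ → ℝ, IsReparam θ ∧ (∀ t ∈ Set.Icc (a i) (b i), h (f t) = M i (θ t)) ∧
    ∀ u : ℝ, ‖M i u‖ ≤ r → ∃ t ∈ Set.Icc (a i) (b i), θ t = u

/-- `D` and `D'` coincide outside a disc; inside the disc `D` looks like the picture `M` and `D'`
looks like the picture `M'`, and the strands with the same number have the same ends. -/
def Replaces {m : ℕ} (D D' : LongVirtualDiagram) (r : ℝ) (a b : Fin m → ℝ)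
    (M M' : Fin m → ℝ → Plane) : Prop :=
  0 < r ∧ (∀ i, a i < b i) ∧
  (∀ i j, i ≠ j → Disjoint (Set.Icc (a i) (b i)) (Set.Icc (a j) (b j))) ∧
  (∃ h h' : Plane ≃ₘ[ℝ] Plane, OrientationPreserving h ∧ OrientationPreserving h' ∧
    (∀ x : Plane, ‖h x‖ ≤ r ↔ ‖h' x‖ ≤ r) ∧
    LooksLike D.curve h r a b M ∧ LooksLike D'.curve h' r a b M') ∧
  (∀ t : ℝ, (∀ i, t ∉ Set.Icc (a i) (b i)) → D.curve t = D'.curve t) ∧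
  ∀ (c : D.Crossing) (c' : D'.Crossing), c.1 = c'.1 →
    (∀ i, c.1.1 ∉ Set.Icc (a i) (b i)) → D.kind c = D'.kind c'

/-- Every crossing of `D` whose first passage is on the strand `[a i, b i]` and whose second
passage is on the strand `[a j, b j]` has the crossing structure `P i j`. -/
def HasPattern {m : ℕ} (D : LongVirtualDiagram) (a b : Fin m → ℝ)
    (P : Fin m → Fin m → CrossingKind) : Prop :=
  ∀ (c : D.Crossing) (i j : Fin m), c.1.1 ∈ Set.Icc (a i) (b i) → c.1.2 ∈ Set.Icc (a j) (b j) →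
    D.kind c = P i j

/-- The crossing structure of strand `i` with the later strand `j` when all crossings are classical
and the strands lie at the given heights. -/
def layered {m : ℕ} (height : Fin m → ℕ) (i j : Fin m) : CrossingKind :=
  if height j < height i then CrossingKind.earlyOver else CrossingKind.earlyUnder

/-- The first Reidemeister move, classical or virtual: a strand without crossings is replaced by a
strand with one curl (of any of the two turning directions, with any crossing structure). -/
def Move1 (D D' : LongVirtualDiagram) : Prop :=
  ∃ (a b : Fin 1 → ℝ) (τ : ℝ), (τ = 1 ∨ τ = -1) ∧
    Replaces D D' 2 a b (fun _ t => !₂[t, 0]) (fun _ t => !₂[t ^ 3 - t, τ * t ^ 2])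

/-- The second Reidemeister move, classical or virtual: two disjoint strands, with any directions,
are replaced by two strands which form a bigon. Both new crossings are virtual, or both are
classical and the same strand is the upper one at both of them. -/
def Move2 (D D' : LongVirtualDiagram) : Prop :=
  ∃ (a b : Fin 2 → ℝ) (σ τ : ℝ), (σ = 1 ∨ σ = -1) ∧ (τ = 1 ∨ τ = -1) ∧
    Replaces D D' 2 a b
      ![fun t => !₂[t, 0], fun t => !₂[σ * t, τ]]
      ![fun t => !₂[t, 0], fun t => !₂[σ * t, τ * (t ^ 2 - 1)]] ∧
    (D'.HasPattern a b (fun _ _ => CrossingKind.virtual) ∨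
      ∃ height : Fin 2 → ℕ, Function.Injective height ∧ D'.HasPattern a b (layered height))

/-- The third Reidemeister move, classical, virtual or mixed: a triangle formed by three straight
strands `t ↦ p i + t • d i` is replaced by the opposite triangle, every pair of strands keeping its
crossing structure. Either all three crossings are classical and the strands lie at three different
heights, or some strand has only virtual crossings with the two other strands (whose own crossing
is arbitrary). -/
def Move3 (D D' : LongVirtualDiagram) : Prop :=
  ∃ (a b : Fin 3 → ℝ) (r : ℝ) (p d : Fin 3 → Plane) (P : Fin 3 → Fin 3 → CrossingKind),
    (∀ i j, i ≠ j → Plane.cross (d i) (d j) ≠ 0) ∧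
    (∀ i j, i ≠ j → ∃ s t : ℝ, p i + s • d i = p j + t • d j ∧ ‖p i + s • d i‖ < r) ∧
    Replaces D D' r a b (fun i t => p i + t • d i) (fun i t => -p i + t • d i) ∧
    D.HasPattern a b P ∧ D'.HasPattern a b P ∧
    ((∃ height : Fin 3 → ℕ, Function.Injective height ∧ P = layered height) ∨
      ∃ k, ∀ i, i ≠ k → P i k = CrossingKind.virtual ∧ P k i = CrossingKind.virtual)

/-- One planar isotopy or one generalized Reidemeister move. The forbidden moves are not included.
-/
def Step (D D' : LongVirtualDiagram) : Prop :=
  Isotopic D D' ∨ Move1 D D' ∨ Move2 D D' ∨ Move3 D D'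

end LongVirtualDiagram

/-- Long virtual knots: diagrams modulo the equivalence relation generated by planar isotopy and
generalized Reidemeister moves. -/
def LongVirtualKnot : Type := Quot LongVirtualDiagram.Step

namespace LongVirtualDiagram

variable (D : LongVirtualDiagram)

/-- The long virtual knot represented by a diagram. -/
def knot : LongVirtualKnot := Quot.mk _ D

/-! ## Arcs and long arcs -/

open Classical in
/-- The time at which a classical crossing is passed over. -/
def overTime (v : D.ClassicalCrossing) : ℝ :=
  if D.kind v.1 = CrossingKind.earlyOver then v.1.1.1 else v.1.1.2

open Classical in
/-- The time at which a classical crossing is passed under. -/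
def underTime (v : D.ClassicalCrossing) : ℝ :=
  if D.kind v.1 = CrossingKind.earlyOver then v.1.1.2 else v.1.1.1

/-- The local writhe number of a classical crossing. -/
def writhe (v : D.ClassicalCrossing) : ℤ :=
  (SignType.sign (Plane.cross (deriv D.curve (D.overTime v)) (deriv D.curve (D.underTime v))) : ℤ)

/-- The diagram is cut at both passages of each virtual crossing and at the underpass of each
classical crossing. -/
def IsCut (t : ℝ) : Prop :=
  (∃ c : D.VirtualCrossing, t = c.1.1.1 ∨ t = c.1.1.2) ∨ ∃ v : D.ClassicalCrossing, t = D.underTime v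

/-- The times at which the diagram is cut. -/
abbrev Cut : Type := {t : ℝ // D.IsCut t}

instance finite_cut : Finite D.Cut := by
  have h : {t : ℝ | D.IsCut t} ⊆ Set.range (fun c : D.VirtualCrossing => c.1.1.1) ∪
      Set.range (fun c : D.VirtualCrossing => c.1.1.2) ∪ Set.range D.underTime := by
    rintro t (⟨c, rfl | rfl⟩ | ⟨v, rfl⟩)
    · exact Or.inl (Or.inl ⟨c, rfl⟩)
    · exact Or.inl (Or.inr ⟨c, rfl⟩)
    · exact Or.inr ⟨v, rfl⟩
  exact (((Set.finite_range _).union (Set.finite_range _)).union (Set.finite_range _)).subset h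

instance fintypeCut : Fintype D.Cut := Fintype.ofFinite _

/-- The arcs of the diagram. An arc is the open interval of times between two consecutive cuts, and
it is represented by the cut where it starts, or by `⊥` if it comes from infinity. -/
abbrev Arc : Type := WithBot D.Cut

variable {D}

/-- The time at which an arc starts. -/
def Arc.start (a : D.Arc) : WithBot ℝ := WithBot.map Subtype.val a

/-- The arc `a` passes over the classical crossing `v`. -/
def Arc.PassesOver (a : D.Arc) (v : D.ClassicalCrossing) : Prop :=
  a.start < (D.overTime v : WithBot ℝ) ∧
    ∀ t : ℝ, D.IsCut t → a.start < (t : WithBot ℝ) → D.overTime v < t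

/-- The arc `a` comes into the classical crossing `v` (from below). -/
def Arc.ComesInto (a : D.Arc) (v : D.ClassicalCrossing) : Prop :=
  a.start < (D.underTime v : WithBot ℝ) ∧
    ∀ t : ℝ, D.IsCut t → a.start < (t : WithBot ℝ) → D.underTime v ≤ t

/-- The arc `a` emanates from the classical crossing `v`. -/
def Arc.EmanatesFrom (a : D.Arc) (v : D.ClassicalCrossing) : Prop :=
  a.start = (D.underTime v : WithBot ℝ)

/-- The arc `a` is contained in the long arc that emanates from the classical crossing `v`. The
long arc emanating from the last underpass runs to infinity and is continued by the initial long
arc, which comes from minus infinity. -/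
def Arc.OnLongArc (a : D.Arc) (v : D.ClassicalCrossing) : Prop :=
  ((D.underTime v : WithBot ℝ) ≤ a.start ∧
    ∀ w : D.ClassicalCrossing, D.underTime v < D.underTime w → a.start < (D.underTime w : WithBot ℝ)) ∨
  ((∀ w : D.ClassicalCrossing, a.start < (D.underTime w : WithBot ℝ)) ∧
    ∀ w : D.ClassicalCrossing, D.underTime w ≤ D.underTime v)

/-- On the way along the long arc that emanates from `v`, the time `t` comes before the arc `a`. -/
def Arc.Before (a : D.Arc) (v : D.ClassicalCrossing) (t : ℝ) : Prop :=
  ((D.underTime v : WithBot ℝ) ≤ a.start ∧ D.underTime v < t ∧ (t : WithBot ℝ) ≤ a.start) ∨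
  (a.start < (D.underTime v : WithBot ℝ) ∧ (D.underTime v < t ∨ (t : WithBot ℝ) ≤ a.start))

variable (D) in
/-- The jump of the degree at the passage at time `t` through the intersection point with the
transversal branch at time `t'`: it is `1` if the curve crosses this branch from its left to its
right, and `-1` if from its right to its left. -/
def jump (t t' : ℝ) : ℤ :=
  (SignType.sign (Plane.cross (deriv D.curve t) (deriv D.curve t')) : ℤ)

open Classical in
/-- The degree of an arc `a` of the long arc that emanates from `v`: it is `0` for the first arc of
the long arc and changes by `jump` at each passage through a virtual crossing. -/
def Arc.deg (a : D.Arc) (v : D.ClassicalCrossing) : ℤ :=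
  ∑ c : D.VirtualCrossing,
    ((if a.Before v c.1.1.1 then D.jump c.1.1.1 c.1.1.2 else 0) +
      (if a.Before v c.1.1.2 then D.jump c.1.1.2 c.1.1.1 else 0))

end LongVirtualDiagram

/-! ## The zeta polynomial -/

/-- The ring `ℤ[p, p⁻¹, q, q⁻¹]`. -/
abbrev LaurentPQ : Type := LaurentPolynomial (LaurentPolynomial ℤ)

/-- The power `p ^ n` in `ℤ[p, p⁻¹, q, q⁻¹]`. -/
def LaurentPQ.p (n : ℤ) : LaurentPQ := LaurentPolynomial.C (LaurentPolynomial.T n)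

/-- The power `q ^ n` in `ℤ[p, p⁻¹, q, q⁻¹]`. -/
def LaurentPQ.q (n : ℤ) : LaurentPQ := LaurentPolynomial.T n

/-- The ideal generated by `(p - 1) (p - q)` and `(q - 1) (p - q)`. -/
def zetaIdeal : Ideal LaurentPQ :=
  Ideal.span {(LaurentPQ.p 1 - 1) * (LaurentPQ.p 1 - LaurentPQ.q 1),
    (LaurentPQ.q 1 - 1) * (LaurentPQ.p 1 - LaurentPQ.q 1)}

/-- The ring `ℤ[p, p⁻¹, q, q⁻¹] / ((p - 1) (p - q), (q - 1) (p - q))`. -/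
def ZetaRing : Type := LaurentPQ ⧸ zetaIdeal

instance : CommRing ZetaRing := inferInstanceAs (CommRing (LaurentPQ ⧸ zetaIdeal))

/-- The projection of `ℤ[p, p⁻¹, q, q⁻¹]` onto its quotient. -/
def ZetaRing.mk : LaurentPQ →+* ZetaRing := Ideal.Quotient.mk zetaIdeal

namespace LongVirtualDiagram

variable (D : LongVirtualDiagram)

open Classical in
/-- The element `t ^ (sgn v)`, where `t = p` if `v` is an early overcrossing and `t = q` if `v` is
an early undercrossing. -/
def weight (v : D.ClassicalCrossing) : ZetaRing :=
  ZetaRing.mk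
    (if D.kind v.1 = CrossingKind.earlyOver then LaurentPQ.p (D.writhe v)
      else LaurentPQ.q (D.writhe v))

open Classical in
/-- The incidence coefficient `[v : a]`. -/
def incidence (v : D.ClassicalCrossing) (a : D.Arc) : ZetaRing :=
  (if a.EmanatesFrom v then 1 else 0) + (if a.PassesOver v then D.weight v - 1 else 0) +
    (if a.ComesInto v then -D.weight v else 0)

open Classical in
/-- The matrix `A(D)`. Its rows are indexed by the classical crossings, its columns by the long
arcs, each of them represented by the classical crossing it emanates from. -/
def zetaMatrix : Matrix D.ClassicalCrossing D.ClassicalCrossing (LaurentPolynomial ZetaRing) :=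
  Matrix.of fun v w => ∑ a : D.Arc with a.OnLongArc w,
    LaurentPolynomial.C (D.incidence v a) * LaurentPolynomial.T (a.deg w)

/-- The zeta polynomial of a long virtual knot diagram, an element of `T[s, s⁻¹]` with
`T = ZetaRing`. -/
def zeta : LaurentPolynomial ZetaRing := D.zetaMatrix.det

end LongVirtualDiagram

end

/-! Two facts give the theorem. The degree of the zeta polynomial in `s` is at most the number of
virtual crossings, and, apart from a degenerate case, this degree depends only on the long virtual
knot. If the degree equals the number of virtual crossings for one diagram, no equivalent diagram
can have fewer.

The bound (`degree_zeta_le`): at each virtual crossing the degree goes up at one passage and down at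
the other. The exponents in the column of a long arc are at most the number of "up" passages on it.
Every "up" passage lies on exactly one long arc, so by the Leibniz formula the column bounds add up
to the number of virtual crossings.

Invariance: let the height of a time be the sum of the jumps at earlier virtual passages. The two
jumps at a crossing cancel, so the height is consistent through infinity and `deg` is a difference
of heights (`IsArcBefore.deg_eq`). Conjugation by a diagonal matrix then leaves one exponent per
classical crossing, height at the overpass minus height at the underpass. The matrix now acts on
functions on the set of long arcs, that is, on step functions breaking at underpasses. With the
value at minus infinity and the jumps at underpasses as unknowns, and one more row for the sum of
the jumps, it becomes `pairMatrix` (`det_eq_det_pairMatrix`). This matrix sees only the order of the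
passages, the weights and the exponents. Its determinant `crossingDet` equals zeta as soon as there
is a classical crossing; otherwise it is 0 while zeta is 1.

Under the moves: isotopies, and moves whose new or moved crossings are virtual, keep these data. A
classical curl splits off a unit, which does not affect the degree (`det_pairMatrix_of_curl`). In a
classical bigon the total jump along the lower strand vanishes (`Matrix.det_eq_of_bigon`). In a
classical triangle the equation for the total jump along the lowest strand changes by a multiple of
the row of the crossing of the two upper strands (`Matrix.det_eq_of_triangle`). This needs exactly
the relations that define the ring `T`; the signs and orders that occur are controlled by the side
of the third line on which two lines meet (`meetingParam_sub_mul`). -/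

set_option linter.unusedSimpArgs false
set_option linter.unusedSectionVars false

/-! ## Determinants -/

section Determinants

variable {n R : Type*} [Fintype n] [DecidableEq n] [CommRing R]

/-- If a column is a unit vector, then the row of its non-zero entry does not matter. -/
lemma Matrix.det_eq_of_col_eq_single (M N : Matrix n n R) (c : n)
    (hM : ∀ i, M i c = (Pi.single c 1 : n → R) i) (hN : ∀ i, N i c = (Pi.single c 1 : n → R) i)
    (h : ∀ i, i ≠ c → M i = N i) : M.det = N.det := by
  -- Expanding row `c` as a sum leaves, besides `N.det`, a determinant whose column `c` is zero.
  have h1 : M = N.updateRow c (N c + (M c - N c)) := by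
    ext i j
    by_cases hi : i = c
    · subst hi; simp
    · simp [Matrix.updateRow_ne hi, h i hi]
  rw [h1, Matrix.det_updateRow_add, Matrix.updateRow_eq_self, add_eq_left]
  refine Matrix.det_eq_zero_of_column_eq_zero c fun i => ?_
  by_cases hi : i = c
  · subst hi; simp [hM, hN]
  · simp [Matrix.updateRow_ne hi, hN, hi]

/-- Adding a multiple of row `c` to row `b`, and subtracting column `b` from column `c`. -/
def Matrix.mixRowCol (M : Matrix n n R) (b c : n) (k : R) : Matrix n n R :=
  (M.updateRow b (M b + k • M c)).updateCol c
    (fun i => (M.updateRow b (M b + k • M c)) i c + (-1 : R) • (M.updateRow b (M b + k • M c)) i b)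

/-- The column operation is a substitution after which the index `b` stands for the sum of the
unknowns `b` and `c`. For two crossings on the same lower strand this sum is the total jump along
the strand, the only quantity that the rest of the diagram sees. -/
lemma Matrix.det_mixRowCol (M : Matrix n n R) {b c : n} (hbc : b ≠ c) (k : R) :
    (M.mixRowCol b c k).det = M.det := by
  rw [Matrix.mixRowCol, Matrix.det_updateCol_add_smul_self _ hbc.symm,
    Matrix.det_updateRow_add_smul_self _ hbc]

lemma Matrix.mixRowCol_apply (M : Matrix n n R) (b c : n) (k : R) (i j : n) :
    M.mixRowCol b c k i j = M i j + (if i = b then k * M c j else 0)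
      - (if j = c then M i b + (if i = b then k * M c b else 0) else 0) := by
  unfold Matrix.mixRowCol
  by_cases hi : i = b <;> by_cases hj : j = c <;>
    simp [hi, hj, Matrix.updateRow_apply] <;> ring

/-- The linear algebra behind the third Reidemeister move. -/
lemma Matrix.det_eq_of_triangle (M N : Matrix n n R) {a b c : n} (hab : a ≠ b) (hac : a ≠ c)
    (hbc : b ≠ c) (U m l : n → R) (hU : U b = U c) (hm : m b = m c) (hl : l b = l c)
    (Wa Wb Wc Sa Sc κ : R)
    (hκ : κ = 0 ∧ (Wc - 1) * (Wb - Wa) = 0 ∨ κ = 1 ∧ (Wc - 1) * (Wa * Wb - 1) = 0)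
    (hMa : ∀ x, M a x = (Pi.single a 1 : n → R) x + (Wa - 1) * (Sa * U x - m x))
    (hMb : ∀ x, M b x = (Pi.single b 1 : n → R) x +
      (Wb - 1) * (Sa * Sc * U x - (l x + (Pi.single c 1 : n → R) x)))
    (hMc : ∀ x, M c x = (Pi.single c 1 : n → R) x +
      (Wc - 1) * (Sc * (m x + κ * (Pi.single a 1 : n → R) x) - l x))
    (hNb : ∀ x, N b x = (Pi.single b 1 : n → R) x + (Wb - 1) * (Sa * Sc * U x - l x))
    (hNc : ∀ x, N c x = (Pi.single c 1 : n → R) x +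
      (Wc - 1) * (Sc * (m x + (1 - κ) * (Pi.single a 1 : n → R) x) -
        (l x + (Pi.single b 1 : n → R) x)))
    (hMN : ∀ v, v ≠ b → v ≠ c → M v = N v)
    (hM : ∀ v, v ≠ b → v ≠ c → M v b = M v c) : M.det = N.det := by
  -- Times `Sc`, the left side is the combined row of the lower strand for `N` minus the one for
  -- `M`. The relation in `hκ` is what makes it a multiple of row `a`. The value `κ = 1` means that
  -- in `M` the middle strand has already passed under `a` when it passes over `c`.
  obtain ⟨k, hk⟩ : ∃ k : R, ∀ x,
      (1 - κ) * (Pi.single a 1 : n → R) x * (Wc - 1) + (-Wb * κ) * (Pi.single a 1 : n → R) x *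
        (Wc - 1) + (Wc - 1) * (Wb - 1) * (Sa * U x - m x) =
      k * ((Pi.single a 1 : n → R) x + (Wa - 1) * (Sa * U x - m x)) := by
    rcases hκ with ⟨rfl, h⟩ | ⟨rfl, h⟩
    · exact ⟨Wc - 1, fun x => by linear_combination (Sa * U x - m x) * h⟩
    · exact ⟨-Wb * (Wc - 1), fun x => by linear_combination (Sa * U x - m x) * h⟩
  set X := M.mixRowCol b c Wb with hX
  -- In `N` the lower strand meets `b` before `c`, so the roles are exchanged; the swap brings the
  -- total jump back to the index `b`.
  set Y := (N.mixRowCol c b Wc).submatrix (Equiv.swap b c) (Equiv.swap b c) with hY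
  have hXd : X.det = M.det := Matrix.det_mixRowCol M hbc _
  have hYd : Y.det = N.det := by
    rw [hY, Matrix.det_submatrix_equiv_self, Matrix.det_mixRowCol N hbc.symm]
  set Z := X.updateRow b (X b + (Sc * k) • X a) with hZ
  have hZd : Z.det = X.det := Matrix.det_updateRow_add_smul_self X hab.symm _
  have hZne : ∀ i, i ≠ b → Z i = X i := fun i hi => by rw [hZ, Matrix.updateRow_ne hi]
  have hNab : N a b = N a c := by rw [← hMN a hab hac]; exact hM a hab hac
  have hXv : ∀ v, v ≠ b → v ≠ c → ∀ x, X v x = if x = c then 0 else M v x := by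
    intro v hvb hvc x
    rw [hX, Matrix.mixRowCol_apply]
    by_cases hx : x = c
    · subst hx; simp [hvb, hM v hvb hvc]
    · simp [hvb, hx]
  rw [← hYd, ← hXd, ← hZd]
  -- After the substitution the unknown `c` occurs only in row `c`, with coefficient 1, so the rows
  -- `c`, which still differ, are irrelevant.
  refine Matrix.det_eq_of_col_eq_single _ _ c ?_ ?_ ?_
  · intro i
    by_cases hib : i = b
    · subst hib
      rw [hZ, Matrix.updateRow_self]
      simp only [Pi.add_apply, Pi.smul_apply, smul_eq_mul]
      rw [hXv a hab hac, hX, Matrix.mixRowCol_apply]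
      simp [hMb, hMc, hbc, hbc.symm, hab, hac, hab.symm, hac.symm, hU, hm, hl]
      ring
    · rw [hZne i hib]
      by_cases hic : i = c
      · subst hic
        rw [hX, Matrix.mixRowCol_apply]
        simp [hMc, hbc, hbc.symm, hab, hac, hab.symm, hac.symm, hU, hm, hl]
      · rw [hXv i hib hic]; simp [hic]
  · intro i
    rw [hY, Matrix.submatrix_apply, Equiv.swap_apply_right, Matrix.mixRowCol_apply]
    by_cases hib : i = b
    · subst hib
      simp [hNb, hNc, hbc, hbc.symm, hab, hac, hab.symm, hac.symm, hU, hm, hl]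
      ring
    · by_cases hic : i = c
      · subst hic
        simp [hNb, hbc, hbc.symm, hab, hac, hab.symm, hac.symm, hU, hm, hl]
      · rw [Equiv.swap_apply_of_ne_of_ne hib hic, ← hMN i hib hic]
        simp [hic, hM i hib hic]
  · intro i hic
    ext x
    rw [hY, Matrix.submatrix_apply, Matrix.mixRowCol_apply]
    by_cases hib : i = b
    · subst hib
      rw [hZ, Matrix.updateRow_self]
      simp only [Pi.add_apply, Pi.smul_apply, smul_eq_mul]
      rw [hXv a hab hac, hX, Matrix.mixRowCol_apply, Equiv.swap_apply_left, hMa]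
      have hkx := hk x
      by_cases hxb : x = i
      · subst hxb
        simp [hMb, hMc, hNb, hNc, hbc, hbc.symm, hab, hac, hab.symm, hac.symm, hU, hm, hl] at hkx ⊢
        linear_combination (-Sc) * hkx
      · by_cases hxc : x = c
        · subst hxc
          simp [hMb, hMc, hNb, hNc, hbc, hbc.symm, hab, hac, hab.symm, hac.symm, hU, hm, hl]
            at hkx ⊢
          ring
        · rw [Equiv.swap_apply_of_ne_of_ne hxb hxc]
          simp [hMb, hMc, hNb, hNc, hxb, hxc] at hkx ⊢
          linear_combination (-Sc) * hkx
    · rw [hZne i hib, hXv i hib hic, Equiv.swap_apply_of_ne_of_ne hib hic, ← hMN i hib hic]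
      by_cases hxb : x = b
      · subst hxb; simp [hbc, hbc.symm, hic, hM i hib hic]
      · by_cases hxc : x = c
        · subst hxc; simp [hic, hM i hib hic]
        · simp [Equiv.swap_apply_of_ne_of_ne hxb hxc, hxb, hxc, hic]

/-- Rows which are multiples of the unit vectors can be split off. -/
lemma Matrix.det_eq_prod_mul_det_submatrix {m : Type*} [Fintype m] [DecidableEq m]
    (M : Matrix m m R) (ι : n → m) (hι : Function.Injective ι) (w : m → R)
    (h : ∀ i, i ∉ Set.range ι → ∀ j, M i j = if i = j then w i else 0) :
    M.det = (M.submatrix ι ι).det * ∏ i : {i : m // ¬ i ∈ Set.range ι}, w i := by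
  classical
  rw [Matrix.twoBlockTriangular_det M (fun i => i ∈ Set.range ι)]
  · congr 1
    · let e : n ≃ {i : m // i ∈ Set.range ι} := Equiv.ofInjective ι hι
      have := Matrix.det_submatrix_equiv_self e (M.toSquareBlockProp fun i => i ∈ Set.range ι)
      have e1 : ((M.toSquareBlockProp fun i => i ∈ Set.range ι).submatrix e e) =
        M.submatrix ι ι := rfl
      rw [e1] at this
      convert this.symm
    · rw [← Matrix.det_diagonal]
      congr 1
      ext i j
      rw [Matrix.toSquareBlockProp_def, Matrix.of_apply, h i i.2, Matrix.diagonal_apply]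
      simp [Subtype.ext_iff]
  · intro i hi j hj
    rw [h i hi, if_neg]
    rintro rfl
    exact hi hj

/-- The linear algebra behind the second Reidemeister move. -/
lemma Matrix.det_eq_of_bigon {m : Type*} [Fintype m] [DecidableEq m]
    (M : Matrix m m R) (N : Matrix n n R) (ι : n → m) (hι : Function.Injective ι) {c d : m}
    (hcd : c ≠ d) (hc : c ∉ Set.range ι) (hd : d ∉ Set.range ι)
    (hr : ∀ i, i ∉ Set.range ι → i = c ∨ i = d)
    (L : m → R) (hL : L c = L d) (Wc Wd : R) (hW : Wc * Wd = 1)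
    (hMc : ∀ x, M c x = (Pi.single c 1 : m → R) x + (Wc - 1) * L x)
    (hMd : ∀ x, M d x = (Pi.single d 1 : m → R) x +
      (Wd - 1) * (L x - (Pi.single c 1 : m → R) x))
    (hM : ∀ v, v ≠ c → v ≠ d → M v c = M v d)
    (hN : ∀ i j, N i j = M (ι i) (ι j)) : M.det = N.det := by
  -- In the combined row the multiples of `L` cancel by `Wc * Wd = 1`. What remains says that the
  -- total jump through both crossings is zero.
  set X := M.mixRowCol d c Wd with hX
  -- The unknown `c` survives only in its own row, which may therefore be replaced by a unit row.
  set Y := X.updateRow c (Pi.single c 1) with hY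
  have hXd : X.det = M.det := Matrix.det_mixRowCol M hcd.symm _
  have hXv : ∀ v, v ≠ c → v ≠ d → ∀ x, X v x = if x = c then 0 else M v x := by
    intro v hvc hvd x
    rw [hX, Matrix.mixRowCol_apply]
    by_cases hx : x = c
    · subst hx; simp [hvd, hM v hvc hvd]
    · simp [hvd, hx]
  have hXd' : ∀ x, X d x = (Pi.single d 1 : m → R) x := by
    intro x
    rw [hX, Matrix.mixRowCol_apply]
    by_cases hx : x = c
    · subst hx
      simp [hMc, hMd, hcd, hcd.symm, hL]
      linear_combination L d * hW - L d * hW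
    · simp [hMc, hMd, hcd, hcd.symm, hx]
      linear_combination L x * hW
  have hYc : ∀ i, i ≠ c → Y i = X i := fun i hi => by rw [hY, Matrix.updateRow_ne hi]
  have hXcol : ∀ i, i ≠ c → X i c = 0 := by
    intro i hi
    by_cases hid : i = d
    · subst hid; rw [hXd']; simp [hcd]
    · simp [hXv i hi hid]
  have hYd : Y.det = X.det := by
    refine Matrix.det_eq_of_col_eq_single _ _ c ?_ ?_ hYc
    · intro i
      by_cases hi : i = c
      · subst hi; simp [hY]
      · rw [hYc i hi, hXcol i hi]; simp [hi]
    · intro i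
      by_cases hi : i = c
      · subst hi
        rw [hX, Matrix.mixRowCol_apply]
        simp [hMc, hcd, hL]
      · rw [hXcol i hi]; simp [hi]
  rw [← hXd, ← hYd, Matrix.det_eq_prod_mul_det_submatrix Y ι hι (fun _ => 1)]
  · rw [Finset.prod_const_one, mul_one]
    congr 1
    ext i j
    have h1 : ι i ≠ c := fun h => hc ⟨i, h⟩
    have h2 : ι i ≠ d := fun h => hd ⟨i, h⟩
    have h3 : ι j ≠ c := fun h => hc ⟨j, h⟩
    rw [Matrix.submatrix_apply, hYc _ h1, hXv _ h1 h2, if_neg h3, hN]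
  · intro i hi j
    rcases hr i hi with rfl | rfl
    · simp [hY, Pi.single_apply, eq_comm]
    · rw [hYc _ hcd.symm, hXd', Pi.single_apply]; simp [eq_comm]

end Determinants

/-! ## The matrix of a system of passages -/

section PairMatrix

variable {V V' R : Type*} [CommRing R]

/-- The linear form on `Option V → R` which expresses the value at the time `t` of a step function
by its value at `-∞` and its jumps at the times `u v`. -/
noncomputable def stepForm (u : V → ℝ) (t : ℝ) : Option V → R
  | none => 1
  | some w => if u w < t then 1 else 0

@[simp] lemma stepForm_none (u : V → ℝ) (t : ℝ) : (stepForm u t none : R) = 1 := rfl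

lemma stepForm_some (u : V → ℝ) (t : ℝ) (w : V) :
    (stepForm u t (some w) : R) = if u w < t then 1 else 0 := rfl

/-- The square matrix of a finite system of crossings with the times of underpass `u` and of
overpass `o`, in the basis formed by the value at infinity and the jumps at underpasses. -/
noncomputable def pairMatrix [DecidableEq V] (u o : V → ℝ) (W S : V → R) :
    Matrix (Option V) (Option V) R :=
  Matrix.of fun x => match x with
    | none => fun y => y.elim 0 (fun _ => -1)
    | some v => fun y => (Pi.single (some v) 1 : Option V → R) y +
        (W v - 1) * (S v * stepForm u (o v) y - stepForm u (u v) y)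

variable [DecidableEq V] [DecidableEq V']

/-- A zeta row reads "value after the underpass, plus `(W - 1) * S` times the value at the overpass,
minus `W` times the value before the underpass". Writing the first value as the third plus the jump
at `v` gives this form. -/
lemma pairMatrix_some (u o : V → ℝ) (W S : V → R) (v : V) (y : Option V) :
    pairMatrix u o W S (some v) y = (Pi.single (some v) 1 : Option V → R) y +
      (W v - 1) * (S v * stepForm u (o v) y - stepForm u (u v) y) := rfl

/-- The closing condition at infinity: the jumps of a step function on the circle add up to zero. -/
lemma pairMatrix_none (u o : V → ℝ) (W S : V → R) (y : Option V) :
    pairMatrix u o W S none y = y.elim 0 (fun _ => -1) := rfl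

variable [Fintype V] [Fintype V']

lemma det_pairMatrix_congr (σ : V ≃ V') (u o : V → ℝ) (u' o' : V' → ℝ) (W S : V → R)
    (W' S' : V' → R) (hu : ∀ v w, u' (σ w) < u' (σ v) ↔ u w < u v)
    (ho : ∀ v w, u' (σ w) < o' (σ v) ↔ u w < o v) (hW : ∀ v, W' (σ v) = W v)
    (hS : ∀ v, S' (σ v) = S v) :
    (pairMatrix u' o' W' S').det = (pairMatrix u o W S).det := by
  rw [← Matrix.det_submatrix_equiv_self (Equiv.optionCongr σ)]
  congr 1
  ext x y
  rcases x with _ | v <;> rcases y with _ | w <;>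
    simp [pairMatrix_some, pairMatrix_none, stepForm_some, hu, ho, hW, hS, Pi.single_apply]

lemma det_pairMatrix_of_isEmpty [IsEmpty V] (u o : V → ℝ) (W S : V → R) :
    (pairMatrix u o W S).det = 0 := by
  refine Matrix.det_eq_zero_of_row_eq_zero none fun y => ?_
  rcases y with _ | w
  · rfl
  · exact isEmptyElim w

/-- A crossing whose two passages follow each other immediately. -/
lemma det_pairMatrix_of_curl (ι : V → V') (hι : Function.Injective ι) (c : V')
    (hr : ∀ v', v' ∉ Set.range ι ↔ v' = c) (u o : V → ℝ) (u' o' : V' → ℝ) (W S : V → R)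
    (W' S' : V' → R) (hu : ∀ v, u' (ι v) = u v) (ho : ∀ v, o' (ι v) = o v)
    (hW : ∀ v, W' (ι v) = W v) (hS : ∀ v, S' (ι v) = S v) (hc : S' c = 1)
    (hadj : ∀ w, u w < o' c ↔ u w < u' c) :
    (pairMatrix u' o' W' S').det =
      (pairMatrix u o W S).det * (if u' c < o' c then W' c else 1) := by
  have hrow : ∀ i, i ∉ Set.range (Option.map ι) → i = some c := by
    intro i hi
    rcases i with _ | v
    · exact absurd ⟨none, rfl⟩ hi
    · congr 1
      rw [← hr]
      rintro ⟨w, rfl⟩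
      exact hi ⟨some w, rfl⟩
  have hc' : some c ∉ Set.range (Option.map ι) := by
    rintro ⟨_ | w, hw⟩
    · simp at hw
    · exact (hr c).2 rfl ⟨w, by simpa using hw⟩
  -- By `hadj` the step forms at the two passages of `c` can differ only in the entry `c`. The row
  -- of `c` is thus a multiple of a unit vector, with factor `W' c` if the underpass comes first and
  -- 1 otherwise.
  rw [Matrix.det_eq_prod_mul_det_submatrix (pairMatrix u' o' W' S') (Option.map ι)
    (Option.map_injective hι) (fun _ => if u' c < o' c then W' c else 1)]
  · congr 1
    · congr 1
      ext x y
      rcases x with _ | v <;> rcases y with _ | w <;>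
        simp [pairMatrix_some, pairMatrix_none, stepForm_some, hu, ho, hW, hS, Pi.single_apply,
          hι.eq_iff]
    · rw [Finset.prod_const, Finset.card_univ]
      have : Fintype.card {i // i ∉ Set.range (Option.map ι)} = 1 :=
        Fintype.card_eq_one_iff.2 ⟨⟨some c, hc'⟩, fun y => Subtype.ext (hrow _ y.2)⟩
      rw [this, pow_one]
  · intro i hi j
    rw [hrow i hi, pairMatrix_some, hc]
    rcases j with _ | w
    · simp
    · by_cases hw : w = c
      · subst hw
        simp [stepForm_some]
        split_ifs <;> simp
      · obtain ⟨v, rfl⟩ : w ∈ Set.range ι := by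
          by_contra h
          exact hw ((hr w).1 h)
        simp [stepForm_some, hu, hadj, hw, Ne.symm hw]

/-- Two crossings of the same two strands which follow each other immediately on both. -/
lemma det_pairMatrix_of_bigon (ι : V → V') (hι : Function.Injective ι) (c d : V') (hcd : c ≠ d)
    (hr : ∀ v', v' ∉ Set.range ι ↔ v' = c ∨ v' = d) (u o : V → ℝ) (u' o' : V' → ℝ)
    (W S : V → R) (W' S' : V' → R) (hu : ∀ v, u' (ι v) = u v) (ho : ∀ v, o' (ι v) = o v)
    (hW : ∀ v, W' (ι v) = W v) (hS : ∀ v, S' (ι v) = S v) (hScd : S' c = S' d)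
    (hWcd : W' c * W' d = 1) (huc : u' c < u' d)
    (hou : ∀ w, u w < o' c ↔ u w < o' d) (huu : ∀ w, u w < u' c ↔ u w < u' d)
    (huv : ∀ v, u' c < u v ↔ u' d < u v) (hov : ∀ v, u' c < o v ↔ u' d < o v)
    (h1 : u' c < o' c ↔ u' d < o' c) (h2 : u' c < o' c ↔ u' c < o' d)
    (h3 : u' d < o' c ↔ u' d < o' d) :
    (pairMatrix u' o' W' S').det = (pairMatrix u o W S).det := by
  have hrow : ∀ i, i ∉ Set.range (Option.map ι) → i = some c ∨ i = some d := by
    intro i hi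
    rcases i with _ | v
    · exact absurd ⟨none, rfl⟩ hi
    · rw [Option.some_inj, Option.some_inj, ← hr]
      rintro ⟨w, rfl⟩
      exact hi ⟨some w, rfl⟩
  have hrow' : ∀ x, x = c ∨ x = d → some x ∉ Set.range (Option.map ι) := by
    rintro x hx ⟨_ | w, hw⟩
    · simp at hw
    · exact (hr x).2 hx ⟨w, by simpa using hw⟩
  refine Matrix.det_eq_of_bigon (pairMatrix u' o' W' S') (pairMatrix u o W S) (Option.map ι)
    (Option.map_injective hι) (c := some c) (d := some d) (by simpa using hcd)
    (hrow' c (Or.inl rfl)) (hrow' d (Or.inr rfl)) hrow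
    (fun y => S' c * stepForm u' (o' c) y - stepForm u' (u' c) y) ?_ (W' c) (W' d) hWcd
    (fun y => pairMatrix_some _ _ _ _ _ _) ?_ ?_ ?_
  · simp [stepForm_some, h1, huc.not_gt]
  · intro x
    rw [pairMatrix_some, ← hScd]
    congr 2
    -- No underpass separates the two overpasses on the upper strand.
    have ho' : ∀ y, (stepForm u' (o' d) y : R) = stepForm u' (o' c) y := by
      rintro (_ | w)
      · rfl
      · by_cases hw : w ∈ Set.range ι
        · obtain ⟨v, rfl⟩ := hw
          simp [stepForm_some, hu, hou]
        · rcases (hr w).1 hw with rfl | rfl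
          · simp [stepForm_some, h2]
          · simp [stepForm_some, h3]
    -- Between the two underpasses the lower strand gains only the jump at `c`.
    have hu' : ∀ y, (stepForm u' (u' d) y : R) =
        stepForm u' (u' c) y + (Pi.single (some c) 1 : Option V' → R) y := by
      rintro (_ | w)
      · simp
      · by_cases hw : w ∈ Set.range ι
        · have hwc : w ≠ c := fun h => (hr w).2 (Or.inl h) hw
          obtain ⟨v, rfl⟩ := hw
          simp [stepForm_some, hu, huu, hwc]
        · rcases (hr w).1 hw with rfl | rfl
          · simp [stepForm_some, huc]
          · simp [stepForm_some, huc.not_gt, hcd.symm]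
    rw [ho', hu']
    ring
  · rintro (_ | v) hvc hvd
    · rfl
    · obtain ⟨w, rfl⟩ : v ∈ Set.range ι := by
        by_contra h
        rcases (hr v).1 h with rfl | rfl
        · exact hvc rfl
        · exact hvd rfl
      have e1 : c ≠ ι w := fun h => hvc (by rw [h])
      have e2 : d ≠ ι w := fun h => hvd (by rw [h])
      simp [pairMatrix_some, stepForm_some, hu, ho, huv, hov, e1, e2]
  · intro x y
    rcases x with _ | v <;> rcases y with _ | w <;>
      simp [pairMatrix_some, pairMatrix_none, stepForm_some, hu, ho, hW, hS, Pi.single_apply,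
        hι.eq_iff]

/-- Three strands at different heights: `a` is the crossing of the upper and the middle one, `b`
is the crossing of the upper and the lower one, `c` is the crossing of the middle and the lower
one. -/
lemma det_pairMatrix_of_triangle (u o u' o' : V → ℝ) (W S : V → R) {a b c : V} (hab : a ≠ b)
    (hac : a ≠ c) (hbc : b ≠ c) (hS : S b = S a * S c)
    (huu : ∀ w v, ¬ (w = b ∧ v = c) → ¬ (w = c ∧ v = b) → (u' w < u' v ↔ u w < u v))
    (huo : ∀ w v, ¬ (w = a ∧ v = c) → (u' w < o' v ↔ u w < o v))
    (hcb : u c < u b) (hbc' : u' b < u' c) (hflip : u' a < o' c ↔ ¬ u a < o c)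
    (hbcu : ∀ v, v ≠ b → v ≠ c → (u b < u v ↔ u c < u v))
    (hbco : ∀ v, (u b < o v ↔ u c < o v))
    (hubc : ∀ w, w ≠ b → w ≠ c → (u w < u b ↔ u w < u c))
    (hoab : ∀ w, (u w < o a ↔ u w < o b)) (hua : ∀ w, w ≠ a → (u w < o c ↔ u w < u a))
    (hW0 : ¬ u a < o c → (W c - 1) * (W b - W a) = 0)
    (hW1 : u a < o c → (W c - 1) * (W a * W b - 1) = 0) :
    (pairMatrix u o W S).det = (pairMatrix u' o' W S).det := by
  -- The three forms are the values on the upper strand, on the middle strand just before `a`, and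
  -- on the lower strand just before `c`, its first crossing because of `hcb`.
  refine Matrix.det_eq_of_triangle (a := some a) (b := some b) (c := some c) _ _
    (by simpa using hab) (by simpa using hac) (by simpa using hbc)
    (stepForm u (o a)) (stepForm u (u a)) (stepForm u (u c)) ?_ ?_ ?_ (W a) (W b) (W c) (S a) (S c)
    (if u a < o c then 1 else 0) ?_ ?_ ?_ ?_ ?_ ?_ ?_ ?_
  · simp [stepForm_some, hbco]
  · simp [stepForm_some, hbcu a hab hac]
  · simp [stepForm_some, hcb.not_gt]
  · by_cases h : u a < o c
    · exact Or.inr ⟨if_pos h, hW1 h⟩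
    · exact Or.inl ⟨if_neg h, hW0 h⟩
  · intro x; rw [pairMatrix_some]
  · intro x
    rw [pairMatrix_some, hS]
    congr 3
    · rcases x with _ | w <;> simp [stepForm_some, hoab]
    · rcases x with _ | w
      · simp
      · by_cases hwb : w = b
        · subst hwb; simp [stepForm_some, hcb.not_gt, hbc]
        · by_cases hwc : w = c
          · subst hwc; simp [stepForm_some, hcb]
          · simp [stepForm_some, hubc w hwb hwc, hwc]
  · intro x
    rw [pairMatrix_some]
    congr 4
    rcases x with _ | w
    · simp
    · by_cases hwa : w = a
      · subst hwa; simp [stepForm_some]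
      · simp [stepForm_some, hua w hwa, hwa]
  · intro x
    rw [pairMatrix_some, hS]
    congr 3
    · rcases x with _ | w
      · simp
      · simp [stepForm_some, huo w b (by simp [hbc]), hoab]
    · rcases x with _ | w
      · simp
      · by_cases hwb : w = b
        · subst hwb; simp [stepForm_some, hcb.not_gt]
        · by_cases hwc : w = c
          · subst hwc; simp [stepForm_some, hbc'.not_gt]
          · simp [stepForm_some, huu w b (by simp [hwb]) (by simp [hwc]), hubc w hwb hwc]
  · intro x
    rw [pairMatrix_some]
    congr 3
    · congr 1
      rcases x with _ | w
      · simp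
      · by_cases hwa : w = a
        · subst hwa
          by_cases h : u w < o c <;> simp [stepForm_some, hflip, h]
        · simp [stepForm_some, huo w c (by simp [hwa]), hua w hwa, hwa]
    · rcases x with _ | w
      · simp
      · by_cases hwb : w = b
        · subst hwb; simp [stepForm_some, hcb.not_gt, hbc']
        · simp [stepForm_some, huu w c (by simp [hwb]) (by simp [hbc.symm]), hwb]
  · rintro (_ | v) hvb hvc
    · rfl
    · have e1 : v ≠ b := fun h => hvb (by rw [h])
      have e2 : v ≠ c := fun h => hvc (by rw [h])
      ext y
      rcases y with _ | w
      · simp [pairMatrix_some]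
      · simp [pairMatrix_some, stepForm_some, huu w v (by simp [e2]) (by simp [e1]),
          huo w v (by simp [e2])]
  · rintro (_ | v) hvb hvc
    · rfl
    · have e1 : v ≠ b := fun h => hvb (by rw [h])
      have e2 : v ≠ c := fun h => hvc (by rw [h])
      simp [pairMatrix_some, stepForm_some, hbcu v e1 e2, hbco, e1.symm, e2.symm]

end PairMatrix

/-! ## The determinant in terms of cyclic predecessors -/

section CyclicPredecessor

variable {V R : Type*} [CommRing R]

/-- `w` is the last element with `u w < t`, or, if there is no such element, the last element. -/
def IsCyclicPred (u : V → ℝ) (t : ℝ) (w : V) : Prop :=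
  (u w < t ∧ ∀ w', u w < u w' → t ≤ u w') ∨ ((∀ w', t ≤ u w') ∧ ∀ w', u w' ≤ u w)

lemma IsCyclicPred.unique {u : V → ℝ} (hu : Function.Injective u) {t : ℝ} {w w' : V}
    (h : IsCyclicPred u t w) (h' : IsCyclicPred u t w') : w = w' := by
  apply hu
  rcases h with ⟨h1, h2⟩ | ⟨h1, h2⟩ <;> rcases h' with ⟨h3, h4⟩ | ⟨h3, h4⟩
  · refine le_antisymm ?_ ?_
    · by_contra hc
      exact absurd (h4 w (not_le.1 hc)) (not_le.2 h1)
    · by_contra hc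
      exact absurd (h2 w' (not_le.1 hc)) (not_le.2 h3)
  · exact absurd (h3 w) (not_le.2 h1)
  · exact absurd (h1 w') (not_le.2 h3)
  · exact le_antisymm (h4 w) (h2 w')

lemma IsCyclicPred.exists [Finite V] [Nonempty V] (u : V → ℝ) (t : ℝ) :
    ∃ w, IsCyclicPred u t w := by
  by_cases h : ∃ w, u w < t
  · obtain ⟨w, hw, hmax⟩ := Set.exists_max_image {w | u w < t} u (Set.toFinite _) h
    refine ⟨w, Or.inl ⟨hw, fun w' hw' => ?_⟩⟩
    by_contra hc
    exact absurd (hmax w' (not_le.1 hc)) (not_le.2 hw')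
  · push Not at h
    obtain ⟨w, hw⟩ := Finite.exists_max u
    exact ⟨w, Or.inr ⟨h, hw⟩⟩

/-- The value at a time preceding all underpasses is carried by the long arc of the last underpass.
Summing jumps up to that underpass counts every jump although none has happened yet; the last
summand is this error. -/
lemma IsCyclicPred.indicator {u : V → ℝ} {t : ℝ} {w' : V} (h : IsCyclicPred u t w')
    (w : V) [Decidable (∀ x, t ≤ u x)] :
    (if u w ≤ u w' then 1 else 0 : R) =
      (if u w < t then 1 else 0) + (if ∀ x, t ≤ u x then 1 else 0) := by
  rcases h with ⟨h1, h2⟩ | ⟨h1, h2⟩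
  · have h3 : ¬ ∀ x, t ≤ u x := fun h => absurd (h w') (not_le.2 h1)
    have h4 : u w ≤ u w' ↔ u w < t := by
      refine ⟨fun h => h.trans_lt h1, fun h => ?_⟩
      by_contra hc
      exact absurd (h2 w (not_le.1 hc)) (not_le.2 h)
    simp [h3, h4]
  · simp [h1, h2, (h1 w).not_gt]

variable [Fintype V] [DecidableEq V]

open Classical in
lemma sum_isCyclicPred_mul [Nonempty V] {u : V → ℝ} (hu : Function.Injective u) (t : ℝ) (w : V) :
    ∑ w', (if IsCyclicPred u t w' then 1 else 0 : R) * (if u w ≤ u w' then 1 else 0) =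
      (if u w < t then 1 else 0) + (if ∀ x, t ≤ u x then 1 else 0) := by
  obtain ⟨w0, h0⟩ := IsCyclicPred.exists u t
  rw [Finset.sum_eq_single w0]
  · rw [if_pos h0, one_mul, h0.indicator]
  · intro b _ hb
    rw [if_neg (fun h => hb (h.unique hu h0)), zero_mul]
  · simp

open Classical in
lemma sum_isCyclicPred [Nonempty V] {u : V → ℝ} (hu : Function.Injective u) (t : ℝ) :
    ∑ w', (if IsCyclicPred u t w' then 1 else 0 : R) = 1 := by
  obtain ⟨w0, h0⟩ := IsCyclicPred.exists u t
  rw [Finset.sum_eq_single w0]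
  · rw [if_pos h0]
  · intro b _ hb
    rw [if_neg (fun h => hb (h.unique hu h0))]
  · simp

/-- The change of basis between values and jumps of a step function on the circle. -/
noncomputable def jumpMatrix (u : V → ℝ) : Matrix (Option V) (Option V) R :=
  Matrix.of fun x y => match x, y with
    | some v, some w => if u w ≤ u v then 1 else 0
    | some _, none => 1
    | none, some _ => -1
    | none, none => 0

lemma det_jumpMatrix [Nonempty V] {u : V → ℝ} (hu : Function.Injective u) :
    (jumpMatrix u : Matrix (Option V) (Option V) R).det = 1 := by
  obtain ⟨l, hl⟩ := Finite.exists_max u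
  -- The row of the last underpass `l` consists of ones; adding it to the row `none` gives a unit
  -- row. The remaining block is unitriangular in the order of the underpasses.
  rw [← Matrix.det_updateRow_add_smul_self _ (i := none) (j := some l) (by simp) (1 : R),
    Matrix.det_eq_prod_mul_det_submatrix _ (some : V → Option V) (Option.some_injective V)
      (fun _ => 1)]
  · rw [Finset.prod_const_one, mul_one]
    let _ : LinearOrder V := LinearOrder.lift' u hu
    rw [Matrix.det_of_isLowerTriangular]
    · refine Finset.prod_eq_one fun v _ => ?_
      simp [jumpMatrix, Matrix.updateRow_apply]
    · intro v w hvw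
      have h : u v < u w := hvw
      simp [jumpMatrix, Matrix.updateRow_apply, h]
  · intro i hi y
    rcases i with _ | v
    · rcases y with _ | w
      · simp [jumpMatrix]
      · simp [jumpMatrix, hl]
    · exact absurd ⟨v, rfl⟩ hi

-- The matrix is bordered by a unit row, which keeps the determinant, and then multiplied by
-- `jumpMatrix`, of determinant 1, to pass from values on long arcs to jumps.
open Classical in
lemma det_eq_det_pairMatrix_of_unscaled [Nonempty V] {u : V → ℝ} (hu : Function.Injective u)
    (o : V → ℝ) (W S : V → R) :
    (Matrix.of fun v w => (if v = w then 1 else 0) +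
      (W v - 1) * S v * (if IsCyclicPred u (o v) w then 1 else 0) -
        W v * (if IsCyclicPred u (u v) w then 1 else 0) : Matrix V V R).det =
      (pairMatrix u o W S).det := by
  set A : Matrix V V R := Matrix.of fun v w => (if v = w then 1 else 0) +
      (W v - 1) * S v * (if IsCyclicPred u (o v) w then 1 else 0) -
        W v * (if IsCyclicPred u (u v) w then 1 else 0) with hA
  -- The added column does not affect the determinant. It collects the passages preceding all
  -- underpasses; multiplied by the entries `-1` in the row `none` of `jumpMatrix`, it removes the
  -- error term of `IsCyclicPred.indicator`.
  let E : Matrix (Option V) (Option V) R := Matrix.of fun x y => match x, y with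
    | some v, some w => A v w
    | some v, none => (W v - 1) * S v * (if ∀ x, o v ≤ u x then 1 else 0) -
        W v * (if ∀ x, u v ≤ u x then 1 else 0)
    | none, some _ => 0
    | none, none => 1
  have hE : E.det = A.det := by
    rw [Matrix.det_eq_prod_mul_det_submatrix E (some : V → Option V) (Option.some_injective V)
      (fun _ => 1)]
    · rw [Finset.prod_const_one, mul_one]
      rfl
    · intro i hi y
      rcases i with _ | v
      · rcases y with _ | w
        · simp [E]
        · simp [E]
      · exact absurd ⟨v, rfl⟩ hi
  have hmul : pairMatrix u o W S = E * jumpMatrix u := by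
    ext x y
    rw [Matrix.mul_apply, Fintype.sum_option]
    rcases x with _ | v
    · rcases y with _ | w <;> simp [E, jumpMatrix, pairMatrix_none]
    · have hdist : ∀ f : V → R, ∑ w', E (some v) (some w') * f w' =
          f v + (W v - 1) * S v * (∑ w', (if IsCyclicPred u (o v) w' then 1 else 0) * f w') -
            W v * (∑ w', (if IsCyclicPred u (u v) w' then 1 else 0) * f w') := by
        intro f
        simp only [E, hA, Matrix.of_apply, sub_mul, add_mul, Finset.sum_sub_distrib,
          Finset.sum_add_distrib, Finset.mul_sum, mul_assoc]
        simp
      rcases y with _ | w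
      · have h1 := hdist (fun _ => 1)
        simp only [mul_one, sum_isCyclicPred hu] at h1
        have h2 : ∀ w', (jumpMatrix u : Matrix (Option V) (Option V) R) (some w') none = 1 :=
          fun _ => rfl
        simp only [h2, mul_one, h1, pairMatrix_some]
        simp [jumpMatrix]
        ring
      · have h1 := hdist (fun w' => if u w ≤ u w' then 1 else 0)
        simp only [sum_isCyclicPred_mul hu] at h1
        have h2 : ∀ w', (jumpMatrix u : Matrix (Option V) (Option V) R) (some w') (some w) =
          if u w ≤ u w' then 1 else 0 := fun _ => rfl
        have h3 : (jumpMatrix u : Matrix (Option V) (Option V) R) none (some w) = -1 := rfl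
        have h4 : E (some v) none = (W v - 1) * S v * (if ∀ x, o v ≤ u x then 1 else 0) -
          W v * (if ∀ x, u v ≤ u x then 1 else 0) := rfl
        rw [h3, h4]
        simp only [h2, h1, pairMatrix_some, stepForm_some]
        have h5 : (if u w ≤ u v then 1 else 0 : R) =
            (Pi.single (some v) 1 : Option V → R) (some w) + if u w < u v then 1 else 0 := by
          by_cases hvw : w = v
          · subst hvw; simp
          · have : u w ≠ u v := fun h => hvw (hu h)
            simp [hvw, le_iff_lt_or_eq, this]
        rw [h5]
        ring
  rw [← hE, hmul, Matrix.det_mul, det_jumpMatrix hu, mul_one]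

-- All exponents are differences of the potential `J`, so conjugation by the diagonal matrix with
-- entries `T (J (u v))` removes everything except `J (o v) - J (u v)`, which belongs to the
-- crossing alone.
open Classical in
lemma det_eq_det_pairMatrix [Nonempty V] {u : V → ℝ} (hu : Function.Injective u) (o : V → ℝ)
    (W : V → R) (T : ℤ → R) (hT0 : T 0 = 1) (hT : ∀ a b, T (a + b) = T a * T b) (J : ℝ → ℤ)
    (A : Matrix V V R) (hA : ∀ v w, A v w = (if v = w then 1 else 0) +
      (W v - 1) * (if IsCyclicPred u (o v) w then T (J (o v) - J (u w)) else 0) -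
        W v * (if IsCyclicPred u (u v) w then T (J (u v) - J (u w)) else 0)) :
    A.det = (pairMatrix u o W (fun v => T (J (o v) - J (u v)))).det := by
  rw [← det_eq_det_pairMatrix_of_unscaled hu]
  set B := (Matrix.of fun v w => (if v = w then 1 else 0) +
      (W v - 1) * T (J (o v) - J (u v)) * (if IsCyclicPred u (o v) w then 1 else 0) -
        W v * (if IsCyclicPred u (u v) w then 1 else 0) : Matrix V V R)
  have hAB : A = Matrix.diagonal (fun v => T (J (u v))) * B *
      Matrix.diagonal (fun v => T (-J (u v))) := by
    ext v w
    rw [Matrix.mul_diagonal, Matrix.diagonal_mul, hA]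
    simp only [B, Matrix.of_apply]
    have e1 : T (J (o v) - J (u w)) = T (J (u v)) * T (J (o v) - J (u v)) * T (-J (u w)) := by
      rw [← hT, ← hT]; congr 1; ring
    have e2 : T (J (u v) - J (u w)) = T (J (u v)) * T (-J (u w)) := by
      rw [← hT]; congr 1
    have e3 : T (J (u v)) * T (-J (u v)) = 1 := by rw [← hT, add_neg_cancel, hT0]
    by_cases hvw : v = w
    · subst hvw
      rw [mul_right_comm, e3, one_mul, sub_self, hT0]
      simp only [if_pos rfl]
      split_ifs <;> ring
    · rw [e1, e2]
      simp only [if_neg hvw]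
      split_ifs <;> ring
  rw [hAB, Matrix.det_mul, Matrix.det_mul, Matrix.det_diagonal, Matrix.det_diagonal, mul_right_comm,
    ← Finset.prod_mul_distrib, Finset.prod_eq_one, one_mul]
  intro v _
  rw [← hT, add_neg_cancel, hT0]

end CyclicPredecessor

/-! ## The degree of a determinant of Laurent polynomials -/

section Degree

open LaurentPolynomial

variable {R : Type*}

lemma LaurentPolynomial.degree_le_iff [Semiring R] (f : R[T;T⁻¹]) (d : ℤ) :
    f.degree ≤ d ↔ ∀ n, d < n → f.coeff n = 0 := by
  unfold LaurentPolynomial.degree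
  rw [Finset.max_le_iff]
  refine ⟨fun h n hn => ?_, fun h n hn => ?_⟩
  · by_contra hc
    exact absurd (WithBot.coe_le_coe.1 (h n (Finsupp.mem_support_iff.2 hc))) (not_le.2 hn)
  · refine WithBot.coe_le_coe.2 ?_
    by_contra hc
    exact Finsupp.mem_support_iff.1 hn (h n (not_le.1 hc))

lemma LaurentPolynomial.degree_add_le_of_le [Semiring R] {f g : R[T;T⁻¹]} {d : ℤ}
    (hf : f.degree ≤ d) (hg : g.degree ≤ d) : (f + g).degree ≤ d := by
  rw [degree_le_iff] at *
  intro n hn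
  rw [AddMonoidAlgebra.coeff_add, Finsupp.add_apply, hf n hn, hg n hn, add_zero]

lemma LaurentPolynomial.degree_sum_le_of_le [Semiring R] {ι : Type*} (s : Finset ι)
    (f : ι → R[T;T⁻¹]) {d : ℤ} (hf : ∀ i ∈ s, (f i).degree ≤ d) : (∑ i ∈ s, f i).degree ≤ d :=
  Finset.sum_induction _ (fun g : R[T;T⁻¹] => g.degree ≤ d)
    (fun _ _ => degree_add_le_of_le) (by simp) hf

lemma LaurentPolynomial.degree_mul_le_of_le [Semiring R] {f g : R[T;T⁻¹]} {a b : ℤ}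
    (hf : f.degree ≤ a) (hg : g.degree ≤ b) : (f * g).degree ≤ ((a + b : ℤ) : WithBot ℤ) := by
  rw [degree_le_iff] at *
  intro n hn
  rw [AddMonoidAlgebra.coeff_mul]
  refine Finset.sum_eq_zero fun i hi => Finset.sum_eq_zero fun j hj => ?_
  refine if_neg ?_
  rintro rfl
  have hi' : i ≤ a := by
    by_contra hc
    exact Finsupp.mem_support_iff.1 hi (hf i (not_le.1 hc))
  have hj' : j ≤ b := by
    by_contra hc
    exact Finsupp.mem_support_iff.1 hj (hg j (not_le.1 hc))
  omega

lemma LaurentPolynomial.degree_prod_le_of_le [CommSemiring R] {ι : Type*} (s : Finset ι)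
    (f : ι → R[T;T⁻¹]) (d : ι → ℤ) (hf : ∀ i ∈ s, (f i).degree ≤ d i) :
    (∏ i ∈ s, f i).degree ≤ ((∑ i ∈ s, d i : ℤ) : WithBot ℤ) := by
  classical
  induction s using Finset.induction_on with
  | empty => simpa using degree_C_le (1 : R)
  | insert a s ha ih =>
    rw [Finset.prod_insert ha, Finset.sum_insert ha]
    exact degree_mul_le_of_le (hf a (by simp)) (ih fun i hi => hf i (by simp [hi]))

lemma LaurentPolynomial.degree_det_le [CommRing R] {n : Type*} [Fintype n] [DecidableEq n]
    (M : Matrix n n R[T;T⁻¹]) (d : n → ℤ) (hM : ∀ i j, (M i j).degree ≤ d j) :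
    M.det.degree ≤ ((∑ j, d j : ℤ) : WithBot ℤ) := by
  rw [Matrix.det_apply']
  refine degree_sum_le_of_le _ _ fun σ _ => ?_
  have h1 : (((Equiv.Perm.sign σ : ℤˣ) : ℤ) : R[T;T⁻¹]).degree ≤ ((0 : ℤ) : WithBot ℤ) := by
    rw [← map_intCast (C : R →+* R[T;T⁻¹])]
    exact degree_C_le _
  have h2 := degree_mul_le_of_le h1
    (degree_prod_le_of_le Finset.univ (fun i => M (σ i) i) d fun i _ => hM _ _)
  rwa [zero_add] at h2

/-- Over a ring with zero divisors degrees need not add. Neither multiplication by a unit nor by its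
inverse can raise the degree, which suffices. -/
lemma LaurentPolynomial.degree_C_mul_of_isUnit [Semiring R] {a : R} (ha : IsUnit a)
    (f : R[T;T⁻¹]) : (C a * f).degree = f.degree := by
  obtain ⟨a, rfl⟩ := ha
  have key : ∀ (b : Rˣ) (g : R[T;T⁻¹]), (C (b : R) * g).degree ≤ g.degree := by
    intro b g
    induction hd : g.degree with
    | bot => rw [degree_eq_bot_iff] at hd; simp [hd]
    | coe d =>
      have := degree_mul_le_of_le (a := 0) (b := d) (degree_C_le (b : R)) hd.le
      rwa [zero_add] at this
  refine le_antisymm (key a f) ?_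
  have := key a⁻¹ (C (a : R) * f)
  rwa [← mul_assoc, ← map_mul, Units.inv_mul, map_one, one_mul] at this

end Degree

namespace LongVirtualDiagram

variable (D : LongVirtualDiagram)

/-! ## Passages are pairwise distinct -/

lemma Crossing.eq_of_fst_eq {D : LongVirtualDiagram} {c c' : D.Crossing} (h : c.1.1 = c'.1.1) :
    c = c' := by
  obtain ⟨⟨x, y⟩, h1, h2⟩ := c
  obtain ⟨⟨x', y'⟩, h3, h4⟩ := c'
  dsimp only at *
  subst h
  rcases D.double y x y' h2.symm h4 with h | h | h
  · exact absurd h h1.ne'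
  · exact absurd h h3.ne
  · subst h; rfl

lemma Crossing.eq_of_snd_eq {D : LongVirtualDiagram} {c c' : D.Crossing} (h : c.1.2 = c'.1.2) :
    c = c' := by
  obtain ⟨⟨x, y⟩, h1, h2⟩ := c
  obtain ⟨⟨x', y'⟩, h3, h4⟩ := c'
  dsimp only at *
  subst h
  rcases D.double x y x' h2 h4.symm with h | h | h
  · exact absurd h h1.ne
  · exact absurd h h3.ne'
  · subst h; rfl

lemma Crossing.fst_ne_snd {D : LongVirtualDiagram} (c c' : D.Crossing) : c.1.1 ≠ c'.1.2 := by
  obtain ⟨⟨x, y⟩, h1, h2⟩ := c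
  obtain ⟨⟨x', y'⟩, h3, h4⟩ := c'
  dsimp only at *
  intro h
  subst h
  rcases D.double x' x y h4 h2 with h | h | h
  · exact h3.ne h
  · exact h1.ne h
  · exact (h3.trans h1).ne h

lemma underTime_eq_or (v : D.ClassicalCrossing) :
    (D.overTime v = v.1.1.1 ∧ D.underTime v = v.1.1.2) ∨
      (D.overTime v = v.1.1.2 ∧ D.underTime v = v.1.1.1) := by
  unfold overTime underTime
  by_cases h : D.kind v.1 = CrossingKind.earlyOver <;> simp [h]

lemma underTime_injective : Function.Injective D.underTime := by
  intro v w h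
  apply Subtype.ext
  rcases D.underTime_eq_or v with ⟨-, h1⟩ | ⟨-, h1⟩ <;>
    rcases D.underTime_eq_or w with ⟨-, h2⟩ | ⟨-, h2⟩ <;> rw [h1, h2] at h
  · exact Crossing.eq_of_snd_eq h
  · exact absurd h.symm (Crossing.fst_ne_snd _ _)
  · exact absurd h (Crossing.fst_ne_snd _ _)
  · exact Crossing.eq_of_fst_eq h

lemma virtual_ne_underTime (c : D.VirtualCrossing) (v : D.ClassicalCrossing) :
    c.1.1.1 ≠ D.underTime v ∧ c.1.1.2 ≠ D.underTime v := by
  have hne : c.1 ≠ v.1 := fun h => v.2 (h ▸ c.2)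
  rcases D.underTime_eq_or v with ⟨-, h1⟩ | ⟨-, h1⟩ <;> rw [h1]
  · exact ⟨Crossing.fst_ne_snd _ _, fun h => hne (Crossing.eq_of_snd_eq h)⟩
  · exact ⟨fun h => hne (Crossing.eq_of_fst_eq h), (Crossing.fst_ne_snd _ _).symm⟩

lemma not_isCut_overTime (v : D.ClassicalCrossing) : ¬ D.IsCut (D.overTime v) := by
  rintro (⟨c, hc⟩ | ⟨w, hw⟩)
  · have hne : v.1 ≠ c.1 := fun h => v.2 (h ▸ c.2)
    rcases D.underTime_eq_or v with ⟨h1, -⟩ | ⟨h1, -⟩ <;> rw [h1] at hc <;> rcases hc with hc | hc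
    · exact hne (Crossing.eq_of_fst_eq hc)
    · exact Crossing.fst_ne_snd _ _ hc
    · exact Crossing.fst_ne_snd _ _ hc.symm
    · exact hne (Crossing.eq_of_snd_eq hc)
  · rcases D.underTime_eq_or v with ⟨h1, h1'⟩ | ⟨h1, h1'⟩ <;>
      rcases D.underTime_eq_or w with ⟨h2, h2'⟩ | ⟨h2, h2'⟩ <;> rw [h1, h2'] at hw
    · exact Crossing.fst_ne_snd _ _ hw
    · have : v = w := Subtype.ext (Crossing.eq_of_fst_eq hw)
      subst this
      exact v.1.2.1.ne (h1.symm.trans h2)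
    · have : v = w := Subtype.ext (Crossing.eq_of_snd_eq hw)
      subst this
      exact v.1.2.1.ne (h2.symm.trans h1)
    · exact Crossing.fst_ne_snd _ _ hw.symm

/-! ## The height function -/

/-- Consequently the jumps over the whole line add up to zero, and the height does not change
through infinity. -/
lemma jump_swap (t t' : ℝ) : D.jump t' t = - D.jump t t' := by
  unfold jump
  have : Plane.cross (deriv D.curve t') (deriv D.curve t) =
      - Plane.cross (deriv D.curve t) (deriv D.curve t') := by
    unfold Plane.cross; ring
  rw [this, Left.sign_neg]
  simp

/-- The sum of the jumps at the virtual passages before the time `t`. -/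
noncomputable def height (t : ℝ) : ℤ :=
  ∑ c : D.VirtualCrossing,
    ((if c.1.1.1 < t then D.jump c.1.1.1 c.1.1.2 else 0) +
      (if c.1.1.2 < t then D.jump c.1.1.2 c.1.1.1 else 0))

/-- `a` is the arc which contains the times immediately before `t`. -/
def IsArcBefore (a : D.Arc) (t : ℝ) : Prop :=
  a.start < (t : WithBot ℝ) ∧ ∀ t' : ℝ, D.IsCut t' → a.start < (t' : WithBot ℝ) → t ≤ t'

variable {D}

lemma IsArcBefore.start_lt_iff {a : D.Arc} {t : ℝ} (h : D.IsArcBefore a t) {t' : ℝ}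
    (ht' : D.IsCut t') : a.start < (t' : WithBot ℝ) ↔ t ≤ t' :=
  ⟨h.2 t' ht', fun h' => h.1.trans_le (WithBot.coe_le_coe.2 h')⟩

lemma IsArcBefore.le_start_iff {a : D.Arc} {t : ℝ} (h : D.IsArcBefore a t) {t' : ℝ}
    (ht' : D.IsCut t') : (t' : WithBot ℝ) ≤ a.start ↔ t' < t := by
  rw [← not_lt, h.start_lt_iff ht', not_le]

lemma Arc.start_injective : Function.Injective (Arc.start : D.Arc → WithBot ℝ) :=
  WithBot.map_injective Subtype.val_injective

lemma IsArcBefore.unique {a a' : D.Arc} {t : ℝ} (h : D.IsArcBefore a t)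
    (h' : D.IsArcBefore a' t) : a = a' := by
  have key : ∀ {a a' : D.Arc}, D.IsArcBefore a t → D.IsArcBefore a' t → a.start ≤ a'.start := by
    intro a a' h h'
    rcases a with _ | c
    · exact bot_le
    · have := h.1
      change ((c.1 : ℝ) : WithBot ℝ) < t at this
      exact (h'.le_start_iff c.2).2 (WithBot.coe_lt_coe.1 this)
  exact Arc.start_injective (le_antisymm (key h h') (key h' h))

lemma IsArcBefore.exists (t : ℝ) : ∃ a : D.Arc, D.IsArcBefore a t := by
  by_cases h : ∃ c : D.Cut, c.1 < t
  · obtain ⟨c, hc, hmax⟩ := Set.exists_max_image {c : D.Cut | c.1 < t} Subtype.val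
      (Set.toFinite _) h
    refine ⟨(c : WithBot D.Cut), WithBot.coe_lt_coe.2 hc, fun t' ht' hlt => ?_⟩
    by_contra hn
    exact absurd (hmax ⟨t', ht'⟩ (not_le.1 hn)) (not_le.2 (WithBot.coe_lt_coe.1 hlt))
  · push Not at h
    exact ⟨⊥, WithBot.bot_lt_coe _, fun t' ht' _ => h ⟨t', ht'⟩⟩

lemma IsArcBefore.onLongArc_iff {a : D.Arc} {t : ℝ} (h : D.IsArcBefore a t)
    (w : D.ClassicalCrossing) : a.OnLongArc w ↔ IsCyclicPred D.underTime t w := by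
  unfold Arc.OnLongArc IsCyclicPred
  have hc : ∀ w, D.IsCut (D.underTime w) := fun w => Or.inr ⟨w, rfl⟩
  simp only [h.start_lt_iff (hc _), h.le_start_iff (hc _)]

/-- The virtual passages between the beginning of a long arc and the time `t`. -/
lemma IsArcBefore.before_iff {a : D.Arc} {t : ℝ} (h : D.IsArcBefore a t)
    (w : D.ClassicalCrossing) {t' : ℝ} (ht' : D.IsCut t') :
    a.Before w t' ↔ (D.underTime w < t ∧ D.underTime w < t' ∧ t' < t) ∨
      (t ≤ D.underTime w ∧ (D.underTime w < t' ∨ t' < t)) := by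
  unfold Arc.Before
  have hc : ∀ w, D.IsCut (D.underTime w) := fun w => Or.inr ⟨w, rfl⟩
  simp only [h.start_lt_iff (hc _), h.le_start_iff (hc _), h.le_start_iff ht']

/-- On a long arc not passing through infinity the degree simply accumulates jumps. On the one
through infinity the accumulated sum differs from the difference of heights by the total of all
jumps, which is zero. -/
lemma IsArcBefore.deg_eq {a : D.Arc} {t : ℝ} (h : D.IsArcBefore a t) (w : D.ClassicalCrossing) :
    a.deg w = D.height t - D.height (D.underTime w) := by
  classical
  unfold Arc.deg height
  rw [← Finset.sum_sub_distrib]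
  refine Finset.sum_congr rfl fun c _ => ?_
  have h1 : D.IsCut c.1.1.1 := Or.inl ⟨c, Or.inl rfl⟩
  have h2 : D.IsCut c.1.1.2 := Or.inl ⟨c, Or.inr rfl⟩
  simp only [h.before_iff w h1, h.before_iff w h2]
  rw [D.jump_swap c.1.1.1 c.1.1.2]
  obtain ⟨n1, n2⟩ := D.virtual_ne_underTime c w
  generalize D.jump c.1.1.1 c.1.1.2 = j
  generalize c.1.1.1 = x at *
  generalize c.1.1.2 = y at *
  generalize D.underTime w = z at *
  -- The last summand appears once with `j` and once with `-j`, and so cancels.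
  have e : ∀ (x : ℝ) (k : ℤ), x ≠ z →
      (if (z < t ∧ z < x ∧ x < t) ∨ (t ≤ z ∧ (z < x ∨ x < t)) then k else 0) =
      (if x < t then k else 0) - (if x < z then k else 0) + (if t ≤ z then k else 0) := by
    intro x k hx
    by_cases h1 : t ≤ z
    · by_cases h2 : x < t
      · simp [h1, h2, h1.not_gt, h2.trans_le h1]
      · rcases lt_or_gt_of_ne hx with h3 | h3
        · simp [h1, h2, h1.not_gt, h3, h3.not_gt]
        · simp [h1, h2, h1.not_gt, h3, h3.not_gt]
    · push Not at h1
      rcases lt_or_gt_of_ne hx with h3 | h3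
      · simp [h1, h1.not_ge, h3, h3.not_gt, h3.trans h1]
      · simp [h1, h1.not_ge, h3, h3.not_gt]
  rw [e x j n1, e y (-j) n2]
  split_ifs <;> ring

/-- The long arc on which the positive passage through a virtual crossing lies bounds the
degree. -/
lemma IsArcBefore.isCyclicPred_of_before {a : D.Arc} {t : ℝ} (h : D.IsArcBefore a t)
    {w : D.ClassicalCrossing} (hw : IsCyclicPred D.underTime t w) {t' : ℝ} (ht' : D.IsCut t')
    (hb : a.Before w t') : IsCyclicPred D.underTime t' w := by
  rw [h.before_iff w ht'] at hb
  rcases hw with ⟨h1, h2⟩ | ⟨h1, h2⟩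
  · rcases hb with ⟨-, h3, h4⟩ | ⟨h3, -⟩
    · exact Or.inl ⟨h3, fun w' hw' => h4.le.trans (h2 w' hw')⟩
    · exact absurd h1 h3.not_gt
  · rcases hb with ⟨h3, -⟩ | ⟨-, h3 | h3⟩
    · exact absurd h3 (h1 w).not_gt
    · exact Or.inl ⟨h3, fun w' hw' => absurd hw' (h2 w').not_gt⟩
    · exact Or.inr ⟨fun w' => h3.le.trans (h1 w'), h2⟩

lemma emanating_onLongArc_iff (v w : D.ClassicalCrossing) {a : D.Arc} (h : a.EmanatesFrom v) :
    a.OnLongArc w ↔ v = w := by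
  unfold Arc.OnLongArc
  rw [h]
  simp only [WithBot.coe_le_coe, WithBot.coe_lt_coe]
  constructor
  · rintro (⟨h1, h2⟩ | ⟨h1, -⟩)
    · by_contra hne
      have : D.underTime w ≠ D.underTime v := fun h => hne (D.underTime_injective h.symm)
      exact absurd (h2 v (lt_of_le_of_ne h1 this)) (lt_irrefl _)
    · exact absurd (h1 v) (lt_irrefl _)
  · rintro rfl
    exact Or.inl ⟨le_rfl, fun _ h => h⟩

lemma emanating_deg (v : D.ClassicalCrossing) {a : D.Arc} (h : a.EmanatesFrom v) :
    a.deg v = 0 := by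
  classical
  have hb : ∀ t, ¬ a.Before v t := by
    intro t
    unfold Arc.Before
    rw [h]
    rintro (⟨-, h1, h2⟩ | ⟨h1, -⟩)
    · exact absurd (WithBot.coe_le_coe.1 h2) h1.not_ge
    · exact lt_irrefl _ h1
  simp [Arc.deg, hb]

lemma exists_emanating (v : D.ClassicalCrossing) : ∃ a : D.Arc, a.EmanatesFrom v :=
  ⟨((⟨D.underTime v, Or.inr ⟨v, rfl⟩⟩ : D.Cut) : WithBot D.Cut), rfl⟩

lemma emanating_unique {v : D.ClassicalCrossing} {a a' : D.Arc} (h : a.EmanatesFrom v)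
    (h' : a'.EmanatesFrom v) : a = a' :=
  Arc.start_injective (h.trans h'.symm)

lemma comesInto_iff (a : D.Arc) (v : D.ClassicalCrossing) :
    a.ComesInto v ↔ D.IsArcBefore a (D.underTime v) := Iff.rfl

/-- Strict and weak inequality agree here because an overpass is never a cut. -/
lemma passesOver_iff (a : D.Arc) (v : D.ClassicalCrossing) :
    a.PassesOver v ↔ D.IsArcBefore a (D.overTime v) := by
  unfold Arc.PassesOver IsArcBefore
  refine and_congr_right fun _ => forall₃_congr fun t ht _ => ?_
  refine ⟨le_of_lt, fun h => lt_of_le_of_ne h ?_⟩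
  rintro rfl
  exact D.not_isCut_overTime v ht

variable (D)

-- In row `v` only three arcs count: the one emanating from `v`, the one passing over `v` and the
-- one coming into `v`. The first has degree 0 and lies on the long arc of `v` alone; the other two
-- are the arcs just before the over- and the underpass.
open Classical in
open LaurentPolynomial in
lemma zetaMatrix_apply (v w : D.ClassicalCrossing) :
    D.zetaMatrix v w = (if v = w then 1 else 0) +
      (C (D.weight v) - 1) * (if IsCyclicPred D.underTime (D.overTime v) w then
        T (D.height (D.overTime v) - D.height (D.underTime w)) else 0) -
      C (D.weight v) * (if IsCyclicPred D.underTime (D.underTime v) w then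
        T (D.height (D.underTime v) - D.height (D.underTime w)) else 0) := by
  obtain ⟨a1, h1⟩ := exists_emanating v
  obtain ⟨a2, h2⟩ := IsArcBefore.exists (D := D) (D.overTime v)
  obtain ⟨a3, h3⟩ := IsArcBefore.exists (D := D) (D.underTime v)
  have e1 : ∀ a : D.Arc, a.EmanatesFrom v ↔ a = a1 :=
    fun a => ⟨fun h => emanating_unique h h1, fun h => h ▸ h1⟩
  have e2 : ∀ a : D.Arc, a.PassesOver v ↔ a = a2 := fun a => by
    rw [passesOver_iff]; exact ⟨fun h => h.unique h2, fun h => h ▸ h2⟩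
  have e3 : ∀ a : D.Arc, a.ComesInto v ↔ a = a3 := fun a => by
    rw [comesInto_iff]; exact ⟨fun h => h.unique h3, fun h => h ▸ h3⟩
  have hz : D.zetaMatrix v w = ∑ a : D.Arc with a.OnLongArc w,
      C (D.incidence v a) * T (a.deg w) := rfl
  have hsum : ∀ (a0 : D.Arc) (r : ZetaRing), ∑ a : D.Arc,
      (if a.OnLongArc w then C (if a = a0 then r else 0) * T (a.deg w) else 0) =
        if a0.OnLongArc w then C r * T (a0.deg w) else 0 := by
    intro a0 r
    rw [Finset.sum_eq_single a0]
    · simp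
    · intro b _ hb; simp [hb]
    · simp
  have hsplit : ∀ a : D.Arc, (if a.OnLongArc w then C (D.incidence v a) * T (a.deg w) else 0) =
      (if a.OnLongArc w then C (if a = a1 then (1 : ZetaRing) else 0) * T (a.deg w) else 0) +
      (if a.OnLongArc w then C (if a = a2 then D.weight v - 1 else 0) * T (a.deg w) else 0) +
      (if a.OnLongArc w then C (if a = a3 then - D.weight v else 0) * T (a.deg w) else 0) := by
    intro a
    unfold incidence
    simp only [e1, e2, e3, map_add, add_mul]
    by_cases h : a.OnLongArc w
    · simp only [if_pos h]
    · simp only [if_neg h, add_zero]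
  rw [hz, Finset.sum_filter, Finset.sum_congr rfl fun a _ => hsplit a, Finset.sum_add_distrib,
    Finset.sum_add_distrib, hsum, hsum, hsum, h2.deg_eq, h3.deg_eq]
  simp only [emanating_onLongArc_iff v w h1, h2.onLongArc_iff, h3.onLongArc_iff, map_sub, map_one,
    map_neg, one_mul]
  have hd : (if v = w then (T (a1.deg w) : ZetaRing[T;T⁻¹]) else 0) = if v = w then 1 else 0 := by
    by_cases h : v = w
    · subst h; simp [emanating_deg v h1]
    · simp [h]
  rw [hd]
  split_ifs <;> ring

/-- The determinant of the crossings of a diagram with respect to the basis formed by the value at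
infinity and the jumps at underpasses. -/
noncomputable def crossingDet : LaurentPolynomial ZetaRing :=
  (pairMatrix D.underTime D.overTime (fun v => LaurentPolynomial.C (D.weight v))
    (fun v => LaurentPolynomial.T (D.height (D.overTime v) - D.height (D.underTime v)))).det

lemma zeta_eq_crossingDet [Nonempty D.ClassicalCrossing] : D.zeta = D.crossingDet :=
  det_eq_det_pairMatrix D.underTime_injective D.overTime
    (fun v => LaurentPolynomial.C (D.weight v)) LaurentPolynomial.T LaurentPolynomial.T_zero
    LaurentPolynomial.T_add D.height D.zetaMatrix D.zetaMatrix_apply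

/-- Here `crossingDet` and `zeta` disagree. Adding a classical curl to such a diagram makes its zeta
polynomial 0, so it is `crossingDet` that behaves well under all moves. -/
lemma crossingDet_of_isEmpty [IsEmpty D.ClassicalCrossing] : D.crossingDet = 0 :=
  det_pairMatrix_of_isEmpty _ _ _ _

lemma zeta_of_isEmpty [IsEmpty D.ClassicalCrossing] : D.zeta = 1 := Matrix.det_isEmpty

/-! ## The degree of the zeta polynomial -/

open Classical in
/-- The time of the passage through a virtual crossing at which the degree increases. -/
noncomputable def positiveTime (c : D.VirtualCrossing) : ℝ :=
  if 0 < D.jump c.1.1.1 c.1.1.2 then c.1.1.1 else c.1.1.2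

lemma jump_le_one (t t' : ℝ) : D.jump t t' ≤ 1 := by
  unfold jump
  generalize SignType.sign (Plane.cross (deriv D.curve t) (deriv D.curve t')) = s
  cases s <;> decide

lemma isCut_positiveTime (c : D.VirtualCrossing) : D.IsCut (D.positiveTime c) := by
  unfold positiveTime
  split_ifs
  · exact Or.inl ⟨c, Or.inl rfl⟩
  · exact Or.inl ⟨c, Or.inr rfl⟩

-- A virtual crossing contributes more than 0 only if its positive passage comes before `a` on the
-- long arc of `w`. That passage then lies on this long arc, and the contribution is at most 1.
open Classical in
lemma IsArcBefore.deg_le {D : LongVirtualDiagram} {a : D.Arc} {t : ℝ} (h : D.IsArcBefore a t)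
    {w : D.ClassicalCrossing} (hw : IsCyclicPred D.underTime t w) :
    a.deg w ≤ ∑ c : D.VirtualCrossing,
      if IsCyclicPred D.underTime (D.positiveTime c) w then 1 else 0 := by
  unfold Arc.deg
  refine Finset.sum_le_sum fun c _ => ?_
  have h1 := h.isCyclicPred_of_before hw (D.isCut_positiveTime c)
  have h2 := D.jump_swap c.1.1.1 c.1.1.2
  have h3 := D.jump_le_one c.1.1.1 c.1.1.2
  have h4 := D.jump_le_one c.1.1.2 c.1.1.1
  unfold positiveTime at h1 ⊢
  by_cases hpos : 0 < D.jump c.1.1.1 c.1.1.2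
  · simp only [if_pos hpos] at h1 ⊢
    by_cases hb : a.Before w c.1.1.1
    · simp only [if_pos hb, if_pos (h1 hb)]
      split_ifs <;> omega
    · simp only [if_neg hb]
      split_ifs <;> omega
  · simp only [if_neg hpos] at h1 ⊢
    by_cases hb : a.Before w c.1.1.2
    · simp only [if_pos hb, if_pos (h1 hb)]
      split_ifs <;> omega
    · simp only [if_neg hb]
      split_ifs <;> omega

-- Column `w` is bounded by the number of positive passages on the long arc of `w`. Exchanging the
-- sums, each virtual crossing is counted once, since its positive passage has exactly one cyclic
-- predecessor.
open LaurentPolynomial in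
theorem degree_zeta_le [Nonempty D.ClassicalCrossing] :
    D.zeta.degree ≤ ((D.numVirtual : ℤ) : WithBot ℤ) := by
  classical
  have hsum : (∑ w : D.ClassicalCrossing, ∑ c : D.VirtualCrossing,
      if IsCyclicPred D.underTime (D.positiveTime c) w then (1 : ℤ) else 0) = D.numVirtual := by
    rw [Finset.sum_comm, Finset.sum_congr rfl
      fun c _ => sum_isCyclicPred D.underTime_injective (D.positiveTime c)]
    simp [numVirtual]
  rw [← hsum]
  refine degree_det_le _ _ fun v w => ?_
  have hnn : (0 : ℤ) ≤ ∑ c : D.VirtualCrossing,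
      if IsCyclicPred D.underTime (D.positiveTime c) w then (1 : ℤ) else 0 :=
    Finset.sum_nonneg fun c _ => by split_ifs <;> simp
  have hterm : ∀ (r : ZetaRing) (t : ℝ),
      (C r * (if IsCyclicPred D.underTime t w then T (D.height t - D.height (D.underTime w))
        else 0)).degree ≤ ((∑ c : D.VirtualCrossing,
      if IsCyclicPred D.underTime (D.positiveTime c) w then (1 : ℤ) else 0 : ℤ) : WithBot ℤ) := by
    intro r t
    by_cases h : IsCyclicPred D.underTime t w
    · rw [if_pos h]
      obtain ⟨a, ha⟩ := IsArcBefore.exists (D := D) t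
      refine (degree_C_mul_T_le _ _).trans (WithBot.coe_le_coe.2 ?_)
      rw [← ha.deg_eq]
      exact ha.deg_le h
    · rw [if_neg h]; simp
  rw [zetaMatrix_apply, sub_eq_add_neg, ← neg_mul, ← map_neg, ← map_one (C : ZetaRing →+* _),
    ← map_sub]
  refine degree_add_le_of_le (degree_add_le_of_le ?_ (hterm _ _)) (hterm _ _)
  by_cases h : v = w
  · rw [if_pos h]
    exact (degree_C_le _).trans (WithBot.coe_le_coe.2 hnn)
  · rw [if_neg h]; simp

end LongVirtualDiagram

/-! ## The weights -/

namespace ZetaRing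

open Classical in
/-- The powers of `p` (for an early overcrossing) and of `q` (for an early undercrossing). -/
noncomputable def power (early : Prop) (n : ℤ) : ZetaRing :=
  ZetaRing.mk (if early then LaurentPQ.p n else LaurentPQ.q n)

lemma power_zero (e : Prop) : power e 0 = 1 := by
  unfold power
  split_ifs <;> simp [LaurentPQ.p, LaurentPQ.q]

lemma power_add (e : Prop) (m n : ℤ) : power e (m + n) = power e m * power e n := by
  unfold power
  rw [← map_mul]
  split_ifs
  · rw [LaurentPQ.p, LaurentPQ.p, LaurentPQ.p, LaurentPolynomial.T_add, map_mul]
  · rw [LaurentPQ.q, LaurentPQ.q, LaurentPQ.q, LaurentPolynomial.T_add]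

lemma power_neg_mul (e : Prop) (n : ℤ) : power e (-n) * power e n = 1 := by
  rw [← power_add, neg_add_cancel, power_zero]

lemma isUnit_power (e : Prop) (n : ℤ) : IsUnit (power e n) :=
  IsUnit.of_mul_eq_one (power e (-n)) (by rw [mul_comm, power_neg_mul])

lemma power_one_relation (e : Prop) :
    (power e 1 - 1) * (power True 1 - power False 1) = 0 := by
  have hp : power True 1 = mk (LaurentPQ.p 1) := by simp [power]
  have hq : power False 1 = mk (LaurentPQ.q 1) := by simp [power]
  have key : ∀ x ∈ ({(LaurentPQ.p 1 - 1) * (LaurentPQ.p 1 - LaurentPQ.q 1),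
      (LaurentPQ.q 1 - 1) * (LaurentPQ.p 1 - LaurentPQ.q 1)} : Set LaurentPQ), mk x = 0 :=
    fun x hx => Ideal.Quotient.eq_zero_iff_mem.2 (Ideal.subset_span hx)
  rw [hp, hq]
  by_cases h : e
  · have : power e 1 = mk (LaurentPQ.p 1) := by simp [power, h]
    rw [this, ← map_sub, ← map_one mk, ← map_sub, ← map_mul]
    exact key _ (by simp)
  · have : power e 1 = mk (LaurentPQ.q 1) := by simp [power, h]
    rw [this, ← map_sub, ← map_one mk, ← map_sub, ← map_mul]
    exact key _ (by simp)

/-- The generators of the ideal are the case of exponents 1. Since `p` and `q` are units, the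
relations pass to the inverses. -/
lemma power_sub_one_mul_power_sub_power {m n : ℤ} (hm : m = 1 ∨ m = -1) (hn : n = 1 ∨ n = -1)
    (e e₁ e₂ : Prop) : (power e m - 1) * (power e₁ n - power e₂ n) = 0 := by
  have h1 : (power e m - 1) * (power True 1 - power False 1) = 0 := by
    rcases hm with rfl | rfl
    · exact power_one_relation e
    · linear_combination (- power e (-1)) * power_one_relation e +
        (power True 1 - power False 1) * power_neg_mul e 1
  have h2 : (power e m - 1) * (power True n - power False n) = 0 := by
    rcases hn with rfl | rfl
    · exact h1
    · linear_combination (- power True (-1) * power False (-1)) * h1 +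
        (power e m - 1) * power False (-1) * power_neg_mul True 1 -
        (power e m - 1) * power True (-1) * power_neg_mul False 1
  have h3 : ∀ e : Prop, power e n = power True n ∨ power e n = power False n := by
    intro e
    by_cases h : e
    · exact Or.inl (by simp [power, h])
    · exact Or.inr (by simp [power, h])
  rcases h3 e₁ with h | h <;> rcases h3 e₂ with h' | h' <;> rw [h, h']
  · ring
  · exact h2
  · linear_combination -h2
  · ring

/-- The same relation multiplied by a unit, for a triangle in which the two crossings of the upper
strand have opposite signs. -/
lemma power_sub_one_mul_power_mul_power_sub_one {m n : ℤ} (hm : m = 1 ∨ m = -1)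
    (hn : n = 1 ∨ n = -1) (e e₁ e₂ : Prop) :
    (power e m - 1) * (power e₁ n * power e₂ (-n) - 1) = 0 := by
  have := power_sub_one_mul_power_sub_power hm hn e e₁ e₂
  linear_combination power e₂ (-n) * this + (power e m - 1) * power_neg_mul e₂ n

end ZetaRing

namespace LongVirtualDiagram

variable (D D' : LongVirtualDiagram)

/-! ## Crossings as ordered pairs of times -/

/-- The times `x < y` form a crossing of kind `k`. -/
def HasKind (x y : ℝ) (k : CrossingKind) : Prop :=
  ∃ h : x < y ∧ D.curve x = D.curve y, D.kind ⟨(x, y), h⟩ = k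

/-- The passage at the time `x` is over the passage at the time `y`. -/
def Over (x y : ℝ) : Prop :=
  D.HasKind x y CrossingKind.earlyOver ∨ D.HasKind y x CrossingKind.earlyUnder

/-- The passages at the times `x` and `y` form a virtual crossing. -/
def Virt (x y : ℝ) : Prop :=
  D.HasKind x y CrossingKind.virtual ∨ D.HasKind y x CrossingKind.virtual

variable {D}

lemma HasKind.lt {x y : ℝ} {k : CrossingKind} (h : D.HasKind x y k) : x < y := h.1.1

lemma HasKind.curve_eq {x y : ℝ} {k : CrossingKind} (h : D.HasKind x y k) :
    D.curve x = D.curve y := h.1.2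

lemma HasKind.unique {x y : ℝ} {k k' : CrossingKind} (h : D.HasKind x y k)
    (h' : D.HasKind x y k') : k = k' := by
  obtain ⟨_, rfl⟩ := h
  obtain ⟨_, rfl⟩ := h'
  rfl

lemma exists_hasKind {x y : ℝ} (hxy : x < y) (h : D.curve x = D.curve y) :
    ∃ k, D.HasKind x y k := ⟨_, ⟨hxy, h⟩, rfl⟩

lemma Over.curve_eq {x y : ℝ} (h : D.Over x y) : D.curve x = D.curve y := by
  rcases h with h | h
  · exact h.curve_eq
  · exact h.curve_eq.symm

lemma Over.ne {x y : ℝ} (h : D.Over x y) : x ≠ y := by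
  rcases h with h | h
  · exact h.lt.ne
  · exact h.lt.ne'

lemma Virt.curve_eq {x y : ℝ} (h : D.Virt x y) : D.curve x = D.curve y := by
  rcases h with h | h
  · exact h.curve_eq
  · exact h.curve_eq.symm

lemma Virt.ne {x y : ℝ} (h : D.Virt x y) : x ≠ y := by
  rcases h with h | h
  · exact h.lt.ne
  · exact h.lt.ne'

lemma Virt.symm {x y : ℝ} (h : D.Virt x y) : D.Virt y x := Or.symm h

lemma over_or_over_or_virt {x y : ℝ} (hxy : x ≠ y) (h : D.curve x = D.curve y) :
    D.Over x y ∨ D.Over y x ∨ D.Virt x y := by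
  rcases lt_or_gt_of_ne hxy with hlt | hlt
  · obtain ⟨k, hk⟩ := exists_hasKind hlt h
    cases k
    · exact Or.inl (Or.inl hk)
    · exact Or.inr (Or.inl (Or.inr hk))
    · exact Or.inr (Or.inr (Or.inl hk))
  · obtain ⟨k, hk⟩ := exists_hasKind hlt h.symm
    cases k
    · exact Or.inr (Or.inl (Or.inl hk))
    · exact Or.inl (Or.inr hk)
    · exact Or.inr (Or.inr (Or.inr hk))

lemma Over.not_virt {x y : ℝ} (h : D.Over x y) : ¬ D.Virt x y := by
  rintro h'
  rcases h with h | h <;> rcases h' with h' | h'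
  · exact absurd (h.unique h') (by simp)
  · exact h.lt.not_gt h'.lt
  · exact h.lt.not_gt h'.lt
  · exact absurd (h.unique h') (by simp)

lemma Over.not_over {x y : ℝ} (h : D.Over x y) : ¬ D.Over y x := by
  rintro h'
  rcases h with h | h <;> rcases h' with h' | h'
  · exact h.lt.not_gt h'.lt
  · exact absurd (h.unique h') (by simp)
  · exact absurd (h.unique h') (by simp)
  · exact h.lt.not_gt h'.lt

lemma eq_of_curve_eq {x y y' : ℝ} (h : D.curve x = D.curve y) (h' : D.curve x = D.curve y')
    (hy : x ≠ y) (hy' : x ≠ y') : y = y' := by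
  rcases D.double y x y' h.symm h' with h | h | h
  · exact absurd h.symm hy
  · exact absurd h hy'
  · exact h

variable (D)

lemma over_overTime_underTime (v : D.ClassicalCrossing) :
    D.Over (D.overTime v) (D.underTime v) := by
  unfold overTime underTime
  by_cases h : D.kind v.1 = CrossingKind.earlyOver
  · rw [if_pos h, if_pos h]
    exact Or.inl ⟨v.1.2, h⟩
  · rw [if_neg h, if_neg h]
    refine Or.inr ⟨v.1.2, ?_⟩
    have h' := v.2
    change D.kind v.1 = _
    cases hk : D.kind v.1
    · exact absurd hk h
    · rfl
    · exact absurd hk h'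

/-- The classical crossings, as pairs formed by the time of the overpass and the time of the
underpass. -/
abbrev OverPair : Type := {z : ℝ × ℝ // D.Over z.1 z.2}

/-- The virtual crossings, each of them represented by two ordered pairs of times. -/
abbrev VirtPair : Type := {z : ℝ × ℝ // D.Virt z.1 z.2}

/-- The classical crossings correspond to the pairs of times of overpasses and underpasses. -/
noncomputable def overPairEquiv : D.ClassicalCrossing ≃ D.OverPair :=
  Equiv.ofBijective (fun v => ⟨(D.overTime v, D.underTime v), D.over_overTime_underTime v⟩) <| by
    constructor
    · intro v w h
      exact D.underTime_injective (congrArg (fun z : D.OverPair => z.1.2) h)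
    · rintro ⟨⟨x, y⟩, (⟨h, hk⟩ | ⟨h, hk⟩)⟩
      · refine ⟨⟨⟨(x, y), h⟩, by rw [hk]; simp⟩, ?_⟩
        simp [overTime, underTime, hk]
      · refine ⟨⟨⟨(y, x), h⟩, by rw [hk]; simp⟩, ?_⟩
        simp [overTime, underTime, hk]

noncomputable instance : Fintype D.OverPair := Fintype.ofEquiv _ D.overPairEquiv

/-- The virtual crossings correspond to pairs of ordered pairs of times. -/
noncomputable def virtPairEquiv : D.VirtualCrossing ⊕ D.VirtualCrossing ≃ D.VirtPair :=
  Equiv.ofBijective (Sum.elim (fun c => ⟨(c.1.1.1, c.1.1.2), Or.inl ⟨c.1.2, c.2⟩⟩)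
    (fun c => ⟨(c.1.1.2, c.1.1.1), Or.inr ⟨c.1.2, c.2⟩⟩)) <| by
    constructor
    · rintro (v | v) (w | w) h
      · have := congrArg (fun z : D.VirtPair => z.1.1) h
        exact congrArg _ (Subtype.ext (Crossing.eq_of_fst_eq this))
      · have := congrArg (fun z : D.VirtPair => z.1.1) h
        exact absurd this (Crossing.fst_ne_snd _ _)
      · have := congrArg (fun z : D.VirtPair => z.1.1) h
        exact absurd this.symm (Crossing.fst_ne_snd _ _)
      · have := congrArg (fun z : D.VirtPair => z.1.2) h
        exact congrArg _ (Subtype.ext (Crossing.eq_of_fst_eq this))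
    · rintro ⟨⟨x, y⟩, (⟨h, hk⟩ | ⟨h, hk⟩)⟩
      · exact ⟨Sum.inl ⟨⟨(x, y), h⟩, hk⟩, rfl⟩
      · exact ⟨Sum.inr ⟨⟨(y, x), h⟩, hk⟩, rfl⟩

noncomputable instance : Fintype D.VirtPair := Fintype.ofEquiv _ D.virtPairEquiv

lemma height_eq_sum_virtPair (t : ℝ) :
    D.height t = ∑ z : D.VirtPair, if z.1.1 < t then D.jump z.1.1 z.1.2 else 0 := by
  rw [← Equiv.sum_comp D.virtPairEquiv, Fintype.sum_sum_type, ← Finset.sum_add_distrib]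
  rfl

/-- The set of virtual crossings, each of them represented by two ordered pairs of times. -/
noncomputable def virtPairs : Finset (ℝ × ℝ) :=
  (Finset.univ : Finset D.VirtPair).map (Function.Embedding.subtype _)

@[simp] lemma mem_virtPairs {z : ℝ × ℝ} : z ∈ D.virtPairs ↔ D.Virt z.1 z.2 := by
  simp [virtPairs]

/-- The contribution of an ordered pair of passages to the height at the time `t`. -/
noncomputable def heightTerm (t : ℝ) (z : ℝ × ℝ) : ℤ := if z.1 < t then D.jump z.1 z.2 else 0

lemma height_eq_sum (t : ℝ) : D.height t = ∑ z ∈ D.virtPairs, D.heightTerm t z := by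
  rw [height_eq_sum_virtPair]
  exact (Finset.sum_subtype D.virtPairs (fun z => D.mem_virtPairs) (D.heightTerm t)).symm

/-- The weight of a classical crossing in terms of its passages. -/
noncomputable def pairWeight (x y : ℝ) : ZetaRing := ZetaRing.power (x < y) (D.jump x y)

lemma weight_eq (v : D.ClassicalCrossing) :
    D.weight v = D.pairWeight (D.overTime v) (D.underTime v) := by
  unfold weight pairWeight ZetaRing.power
  have h : D.kind v.1 = CrossingKind.earlyOver ↔ D.overTime v < D.underTime v := by
    unfold overTime underTime
    by_cases h : D.kind v.1 = CrossingKind.earlyOver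
    · simp [h, v.1.2.1]
    · simp [h, v.1.2.1.le]
  simp only [h]
  rfl

/-- The determinant of a diagram in terms of pairs of times. -/
noncomputable def overMatrix : Matrix (Option D.OverPair) (Option D.OverPair)
    (LaurentPolynomial ZetaRing) :=
  pairMatrix (fun z => z.1.2) (fun z => z.1.1)
    (fun z => LaurentPolynomial.C (D.pairWeight z.1.1 z.1.2))
    (fun z => LaurentPolynomial.T (D.height z.1.1 - D.height z.1.2))

lemma overPairEquiv_apply (v : D.ClassicalCrossing) :
    (D.overPairEquiv v).1 = (D.overTime v, D.underTime v) := rfl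

lemma crossingDet_eq : D.crossingDet = D.overMatrix.det := by
  unfold crossingDet overMatrix
  symm
  apply det_pairMatrix_congr D.overPairEquiv
  · intro v w; rw [overPairEquiv_apply, overPairEquiv_apply]
  · intro v w; rw [overPairEquiv_apply, overPairEquiv_apply]
  · intro v; rw [overPairEquiv_apply, weight_eq]
  · intro v; rw [overPairEquiv_apply]

lemma jump_eq_one_or {x y : ℝ} (hxy : x ≠ y) (h : D.curve x = D.curve y) :
    D.jump x y = 1 ∨ D.jump x y = -1 := by
  have := D.transverse x y hxy h
  unfold jump
  rcases lt_or_gt_of_ne this with h | h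
  · right; rw [sign_neg h]; rfl
  · left; rw [sign_pos h]; rfl

/-! ## Diagrams which agree outside a set of times -/

/-- Outside the set `I` of times the two diagrams have the same passages, and no passage in `I`
meets a passage outside `I`. -/
structure AgreeOutside (I : Set ℝ) : Prop where
  mem_iff : ∀ x y, D.curve x = D.curve y → (x ∈ I ↔ y ∈ I)
  mem_iff' : ∀ x y, D'.curve x = D'.curve y → (x ∈ I ↔ y ∈ I)
  hasKind_iff : ∀ x y k, x ∉ I → (D.HasKind x y k ↔ D'.HasKind x y k)
  jump_eq : ∀ x y, x ∉ I → y ∉ I → D.jump x y = D'.jump x y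

variable {D D'}

namespace AgreeOutside

variable {I : Set ℝ}

lemma symm (H : D.AgreeOutside D' I) : D'.AgreeOutside D I :=
  ⟨H.mem_iff', H.mem_iff, fun x y k hx => (H.hasKind_iff x y k hx).symm,
    fun x y hx hy => (H.jump_eq x y hx hy).symm⟩

lemma hasKind_iff_right (H : D.AgreeOutside D' I) (x y : ℝ) (k : CrossingKind) (hy : y ∉ I) :
    D.HasKind x y k ↔ D'.HasKind x y k := by
  by_cases hx : x ∈ I
  · exact ⟨fun h => absurd ((H.mem_iff x y h.curve_eq).1 hx) hy,
      fun h => absurd ((H.mem_iff' x y h.curve_eq).1 hx) hy⟩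
  · exact H.hasKind_iff x y k hx

lemma over_iff (H : D.AgreeOutside D' I) {x y : ℝ} (hx : x ∉ I) : D.Over x y ↔ D'.Over x y := by
  unfold Over
  rw [H.hasKind_iff x y _ hx, H.hasKind_iff_right y x _ hx]

lemma virt_iff (H : D.AgreeOutside D' I) {x y : ℝ} (hx : x ∉ I) : D.Virt x y ↔ D'.Virt x y := by
  unfold Virt
  rw [H.hasKind_iff x y _ hx, H.hasKind_iff_right y x _ hx]

/-- The difference of the heights is caused by the virtual passages in the region of change. -/
lemma height_sub (H : D.AgreeOutside D' I) {P P' : Finset (ℝ × ℝ)}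
    (hP : ∀ z, z ∈ P ↔ D.Virt z.1 z.2 ∧ z.1 ∈ I) (hP' : ∀ z, z ∈ P' ↔ D'.Virt z.1 z.2 ∧ z.1 ∈ I)
    {t t' : ℝ} (ht : ∀ x, x ∉ I → (x < t ↔ x < t')) :
    D.height t - ∑ z ∈ P, D.heightTerm t z = D'.height t' - ∑ z ∈ P', D'.heightTerm t' z := by
  classical
  have e : P = D.virtPairs.filter (fun z => z.1 ∈ I) := by ext z; simp [hP]
  have e' : P' = D'.virtPairs.filter (fun z => z.1 ∈ I) := by ext z; simp [hP']
  rw [e, e', height_eq_sum, height_eq_sum,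
    ← Finset.sum_filter_add_sum_filter_not D.virtPairs (fun z => z.1 ∈ I),
    ← Finset.sum_filter_add_sum_filter_not D'.virtPairs (fun z => z.1 ∈ I), add_sub_cancel_left,
    add_sub_cancel_left]
  refine Finset.sum_congr ?_ ?_
  · ext ⟨x, y⟩
    simp only [Finset.mem_filter, mem_virtPairs]
    exact and_congr_left fun hx => H.virt_iff hx
  · rintro ⟨x, y⟩ hz
    simp only [Finset.mem_filter, mem_virtPairs] at hz
    unfold heightTerm
    rw [H.jump_eq x y hz.2 (fun hy => hz.2 ((H.mem_iff' x y hz.1.curve_eq).2 hy))]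
    simp only [ht x hz.2]

lemma pairWeight_eq (H : D.AgreeOutside D' I) {x y : ℝ} (hx : x ∉ I) (h : D.Over x y) :
    D.pairWeight x y = D'.pairWeight x y := by
  unfold pairWeight
  rw [H.jump_eq x y hx fun hy => hx ((H.mem_iff x y h.curve_eq).2 hy)]

end AgreeOutside

end LongVirtualDiagram

/-! ## Orientations -/

lemma Plane.cross_map (A : Plane →L[ℝ] Plane) (v w : Plane) :
    Plane.cross (A v) (A w) = A.det * Plane.cross v w := by
  have hdet : A.det = (LinearMap.toMatrix (EuclideanSpace.basisFun (Fin 2) ℝ).toBasis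
      (EuclideanSpace.basisFun (Fin 2) ℝ).toBasis (A : Plane →ₗ[ℝ] Plane)).det := by
    rw [LinearMap.det_toMatrix]
  have hexp : ∀ v : Plane, ∀ i, A v i =
      v 0 * A (EuclideanSpace.single 0 1) i + v 1 * A (EuclideanSpace.single 1 1) i := by
    intro v i
    have hv : v = v 0 • EuclideanSpace.single (0 : Fin 2) (1 : ℝ) +
        v 1 • EuclideanSpace.single (1 : Fin 2) (1 : ℝ) := by
      ext j
      fin_cases j <;> simp
    conv_lhs => rw [hv]
    simp
  rw [hdet, Matrix.det_fin_two]
  simp only [LinearMap.toMatrix_apply, OrthonormalBasis.coe_toBasis, EuclideanSpace.basisFun_apply,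
    OrthonormalBasis.coe_toBasis_repr_apply, EuclideanSpace.basisFun_repr,
    ContinuousLinearMap.coe_coe]
  unfold Plane.cross
  rw [hexp v 0, hexp v 1, hexp w 0, hexp w 1]
  ring

lemma Plane.cross_smul_smul (a b : ℝ) (v w : Plane) :
    Plane.cross (a • v) (b • w) = a * b * Plane.cross v w := by
  unfold Plane.cross
  simp only [PiLp.smul_apply, smul_eq_mul]
  ring

lemma Plane.sign_cross_smul_smul {a b : ℝ} (ha : 0 < a) (hb : 0 < b) (v w : Plane) :
    SignType.sign (Plane.cross (a • v) (b • w)) = SignType.sign (Plane.cross v w) := by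
  rw [cross_smul_smul, sign_mul, sign_pos (mul_pos ha hb), one_mul]

lemma Plane.sign_cross_map {A : Plane →L[ℝ] Plane} (hA : 0 < A.det) (v w : Plane) :
    SignType.sign (Plane.cross (A v) (A w)) = SignType.sign (Plane.cross v w) := by
  rw [cross_map, sign_mul, sign_pos hA, one_mul]

lemma hasFDerivAt_of_diffeomorph (h : Plane ≃ₘ[ℝ] Plane) (x : Plane) :
    HasFDerivAt (fun y : Plane => h y) (fderiv ℝ (fun y : Plane => h y) x) x := by
  have h1 : ContDiff ℝ ∞ (fun y : Plane => h y) := h.contMDiff.contDiff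
  exact (h1.differentiable (by simp) x).hasFDerivAt

lemma IsReparam.hasDerivAt {θ : ℝ → ℝ} (h : IsReparam θ) (t : ℝ) :
    HasDerivAt θ (deriv θ t) t := (h.1.differentiable (by simp) t).hasDerivAt

lemma IsReparam.strictMono {θ : ℝ → ℝ} (h : IsReparam θ) : StrictMono θ :=
  strictMono_of_deriv_pos h.2

namespace LongVirtualDiagram

variable {D D' : LongVirtualDiagram}

lemma hasDerivAt_curve (D : LongVirtualDiagram) (t : ℝ) :
    HasDerivAt D.curve (deriv D.curve t) t :=
  (D.smooth.differentiable (by simp) t).hasDerivAt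

/-! ## Planar isotopies -/

/-- An increasing change of parameter keeps the order of the passages, and an orientation preserving
diffeomorphism keeps the signs, so all data of `overMatrix` are transported. -/
theorem Isotopic.crossingDet_eq (H : Isotopic D D') : D'.crossingDet = D.crossingDet := by
  obtain ⟨h, φ, hO, -, hφ, hbij, hcurve, hkind⟩ := H
  have hmono := hφ.strictMono
  have heq : ∀ x y, D'.curve x = D'.curve y ↔ D.curve (φ x) = D.curve (φ y) := by
    intro x y
    rw [hcurve, hcurve]
    exact h.injective.eq_iff
  have hjump : ∀ x y, D'.curve x = D'.curve y → D'.jump x y = D.jump (φ x) (φ y) := by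
    intro x y hxy
    have hd : ∀ t, deriv D'.curve t = fderiv ℝ (fun y : Plane => h y) (D.curve (φ t))
        (deriv φ t • deriv D.curve (φ t)) := by
      intro t
      have h1 : HasDerivAt (fun t => D.curve (φ t)) (deriv φ t • deriv D.curve (φ t)) t :=
        (D.hasDerivAt_curve (φ t)).scomp t (hφ.hasDerivAt t)
      have h2 := (hasFDerivAt_of_diffeomorph h (D.curve (φ t))).comp_hasDerivAt t h1
      have h3 : D'.curve = (fun y : Plane => h y) ∘ fun t => D.curve (φ t) := funext hcurve
      rw [h3]
      exact h2.deriv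
    unfold jump
    rw [hd x, hd y, ← (heq x y).1 hxy, Plane.sign_cross_map (hO _),
      Plane.sign_cross_smul_smul (hφ.2 x) (hφ.2 y)]
  have hk : ∀ x y k, D'.HasKind x y k ↔ D.HasKind (φ x) (φ y) k := by
    intro x y k
    constructor
    · rintro ⟨h1, h2⟩
      have h3 : φ x < φ y ∧ D.curve (φ x) = D.curve (φ y) := ⟨hmono h1.1, (heq x y).1 h1.2⟩
      exact ⟨h3, by rw [← h2]; exact (hkind ⟨(φ x, φ y), h3⟩ ⟨(x, y), h1⟩ rfl rfl).symm⟩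
    · rintro ⟨h1, h2⟩
      have h3 : x < y ∧ D'.curve x = D'.curve y := ⟨hmono.lt_iff_lt.1 h1.1, (heq x y).2 h1.2⟩
      exact ⟨h3, by rw [← h2]; exact hkind ⟨(φ x, φ y), h1⟩ ⟨(x, y), h3⟩ rfl rfl⟩
  have hover : ∀ x y, D'.Over x y ↔ D.Over (φ x) (φ y) := fun x y => by
    unfold Over; rw [hk, hk]
  have hvirt : ∀ x y, D'.Virt x y ↔ D.Virt (φ x) (φ y) := fun x y => by
    unfold Virt; rw [hk, hk]
  let e : ℝ × ℝ ≃ ℝ × ℝ := Equiv.prodCongr (Equiv.ofBijective φ hbij) (Equiv.ofBijective φ hbij)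
  have he : ∀ z, e z = (φ z.1, φ z.2) := fun _ => rfl
  let eO : D'.OverPair ≃ D.OverPair := e.subtypeEquiv fun z => hover z.1 z.2
  let eV : D'.VirtPair ≃ D.VirtPair := e.subtypeEquiv fun z => hvirt z.1 z.2
  have hO1 : ∀ z, (eO z).1 = (φ z.1.1, φ z.1.2) := fun _ => rfl
  have hV1 : ∀ z, (eV z).1 = (φ z.1.1, φ z.1.2) := fun _ => rfl
  have hheight : ∀ t, D.height (φ t) = D'.height t := by
    intro t
    rw [height_eq_sum_virtPair, height_eq_sum_virtPair, ← Equiv.sum_comp eV]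
    refine Finset.sum_congr rfl fun z _ => ?_
    rw [hV1, hjump _ _ z.2.curve_eq]
    simp only [hmono.lt_iff_lt]
  rw [LongVirtualDiagram.crossingDet_eq, LongVirtualDiagram.crossingDet_eq]
  unfold overMatrix
  symm
  apply det_pairMatrix_congr eO
  · intro v w; rw [hO1, hO1]; exact hmono.lt_iff_lt
  · intro v w; rw [hO1, hO1]; exact hmono.lt_iff_lt
  · intro v
    rw [hO1]
    unfold pairWeight
    rw [hjump _ _ v.2.curve_eq]
    simp only [hmono.lt_iff_lt]
  · intro v; rw [hO1, hheight, hheight]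

/-! ## Local pictures -/

section Pictures

variable {m : ℕ} {r : ℝ} {a b : Fin m → ℝ} {M M' : Fin m → ℝ → Plane}

/-- The part of a diagram inside a disc, in terms of a picture `M` of oriented strands with
velocities `v`. -/
structure HasPicture (D : LongVirtualDiagram) (r : ℝ) (a b : Fin m → ℝ)
    (M v : Fin m → ℝ → Plane) (θ : Fin m → ℝ → ℝ) : Prop where
  strictMono : ∀ i, StrictMono (θ i)
  curve_eq_iff : ∀ i j, ∀ t ∈ Set.Icc (a i) (b i), ∀ t' ∈ Set.Icc (a j) (b j),
    (D.curve t = D.curve t' ↔ M i (θ i t) = M j (θ j t'))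
  jump_eq : ∀ i j, ∀ t ∈ Set.Icc (a i) (b i), ∀ t' ∈ Set.Icc (a j) (b j),
    D.curve t = D.curve t' →
      D.jump t t' = (SignType.sign (Plane.cross (v i (θ i t)) (v j (θ j t'))) : ℤ)
  exists_time : ∀ i u, ‖M i u‖ ≤ r → ∃ t ∈ Set.Icc (a i) (b i), θ i t = u

/-- The chart multiplies `Plane.cross` by a positive determinant and the change of parameter
rescales velocities by positive factors, so signs can be read off from the model strands. -/
lemma LooksLike.exists_hasPicture {h : Plane ≃ₘ[ℝ] Plane} (H : LooksLike D.curve h r a b M)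
    (hO : OrientationPreserving h) (hab : ∀ i, a i < b i) {v : Fin m → ℝ → Plane}
    (hv : ∀ i u, HasDerivAt (M i) (v i u) u) : ∃ θ, HasPicture D r a b M v θ := by
  obtain ⟨-, H⟩ := H
  choose θ hθ hM hsurj using H
  have heq : ∀ i j, ∀ t ∈ Set.Icc (a i) (b i), ∀ t' ∈ Set.Icc (a j) (b j),
      (D.curve t = D.curve t' ↔ M i (θ i t) = M j (θ j t')) := by
    intro i j t ht t' ht'
    rw [← hM i t ht, ← hM j t' ht']
    exact h.injective.eq_iff.symm
  refine ⟨θ, fun i => (hθ i).strictMono, heq, ?_, hsurj⟩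
  intro i j t ht t' ht' htt'
  have hd : ∀ i, ∀ t ∈ Set.Icc (a i) (b i),
      fderiv ℝ (fun y : Plane => h y) (D.curve t) (deriv D.curve t) =
        deriv (θ i) t • v i (θ i t) := by
    intro i t ht
    have h1 := (hasFDerivAt_of_diffeomorph h (D.curve t)).comp_hasDerivAt t (D.hasDerivAt_curve t)
    have h2 : HasDerivAt (fun t => M i (θ i t)) (deriv (θ i) t • v i (θ i t)) t :=
      (hv i (θ i t)).scomp t ((hθ i).hasDerivAt t)
    -- The model describes the curve only on the closed interval; derivatives within it are still
    -- unique, also at its ends.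
    have h3 : HasDerivWithinAt (fun t => M i (θ i t))
        (fderiv ℝ (fun y : Plane => h y) (D.curve t) (deriv D.curve t))
        (Set.Icc (a i) (b i)) t :=
      h1.hasDerivWithinAt.congr (fun s hs => (hM i s hs).symm) (hM i t ht).symm
    have hu := (uniqueDiffOn_Icc (hab i)) t ht
    exact hu.eq_deriv _ h3 h2.hasDerivWithinAt
  unfold jump
  rw [← Plane.sign_cross_map (hO (D.curve t)), hd i t ht, htt', hd j t' ht',
    Plane.sign_cross_smul_smul ((hθ i).2 t) ((hθ j).2 t')]

/-- The times at which the curve is in the disc. -/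
def strandTimes (a b : Fin m → ℝ) : Set ℝ := {t | ∃ i, t ∈ Set.Icc (a i) (b i)}

lemma Replaces.agreeOutside (H : Replaces D D' r a b M M') :
    D.AgreeOutside D' (strandTimes a b) := by
  obtain ⟨-, -, -, ⟨h, h', -, -, -, hL, hL'⟩, hcurve, hkind⟩ := H
  have hcurve' : ∀ t, t ∉ strandTimes a b → D.curve t = D'.curve t := fun t ht =>
    hcurve t fun i hi => ht ⟨i, hi⟩
  have hderiv : ∀ t, t ∉ strandTimes a b → deriv D.curve t = deriv D'.curve t := by
    intro t ht
    -- The strand times form a closed set, so the two curves coincide in a neighbourhood of `t`.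
    have hclosed : IsClosed (strandTimes a b) := by
      have : strandTimes a b = ⋃ i, Set.Icc (a i) (b i) := by
        ext t; simp [strandTimes]
      rw [this]
      exact isClosed_iUnion_of_finite fun i => isClosed_Icc
    refine Filter.EventuallyEq.deriv_eq ?_
    filter_upwards [hclosed.isOpen_compl.mem_nhds ht] with s hs
    exact hcurve' s hs
  have hmem : ∀ x y, D.curve x = D.curve y → (x ∈ strandTimes a b ↔ y ∈ strandTimes a b) := by
    intro x y hxy
    exact (hL.1 x).symm.trans ((by rw [hxy]) : _ ↔ _) |>.trans (hL.1 y)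
  have hmem' : ∀ x y, D'.curve x = D'.curve y →
      (x ∈ strandTimes a b ↔ y ∈ strandTimes a b) := by
    intro x y hxy
    exact (hL'.1 x).symm.trans ((by rw [hxy]) : _ ↔ _) |>.trans (hL'.1 y)
  refine ⟨hmem, hmem', ?_, ?_⟩
  · intro x y k hx
    constructor
    · rintro ⟨h1, h2⟩
      have hy : y ∉ strandTimes a b := fun hy => hx ((hmem x y h1.2).2 hy)
      have h3 : x < y ∧ D'.curve x = D'.curve y :=
        ⟨h1.1, by rw [← hcurve' x hx, ← hcurve' y hy, h1.2]⟩
      exact ⟨h3, by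
        rw [← h2]
        exact (hkind ⟨(x, y), h1⟩ ⟨(x, y), h3⟩ rfl fun i hi => hx ⟨i, hi⟩).symm⟩
    · rintro ⟨h1, h2⟩
      have hy : y ∉ strandTimes a b := fun hy => hx ((hmem' x y h1.2).2 hy)
      have h3 : x < y ∧ D.curve x = D.curve y :=
        ⟨h1.1, by rw [hcurve' x hx, hcurve' y hy, h1.2]⟩
      exact ⟨h3, by
        rw [← h2]
        exact hkind ⟨(x, y), h3⟩ ⟨(x, y), h1⟩ rfl fun i hi => hx ⟨i, hi⟩⟩
  · intro x y hx hy
    unfold jump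
    rw [hderiv x hx, hderiv y hy]

lemma Replaces.exists_hasPicture (H : Replaces D D' r a b M M') {v v' : Fin m → ℝ → Plane}
    (hv : ∀ i u, HasDerivAt (M i) (v i u) u) (hv' : ∀ i u, HasDerivAt (M' i) (v' i u) u) :
    (∃ θ, HasPicture D r a b M v θ) ∧ ∃ θ', HasPicture D' r a b M' v' θ' := by
  obtain ⟨-, hab, -, ⟨h, h', hO, hO', -, hL, hL'⟩, -, -⟩ := H
  exact ⟨hL.exists_hasPicture hO hab hv, hL'.exists_hasPicture hO' hab hv'⟩

end Pictures

end LongVirtualDiagram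

lemma hasDerivAt_vec {f g : ℝ → ℝ} {f' g' u : ℝ} (hf : HasDerivAt f f' u)
    (hg : HasDerivAt g g' u) : HasDerivAt (fun t => (!₂[f t, g t] : Plane)) !₂[f', g'] u := by
  have h1 : ∀ x y : ℝ, (!₂[x, y] : Plane) = x • EuclideanSpace.single (0 : Fin 2) (1 : ℝ) +
      y • EuclideanSpace.single (1 : Fin 2) (1 : ℝ) := by
    intro x y
    ext i
    fin_cases i <;> simp
  simp only [h1]
  exact (hf.smul_const _).add (hg.smul_const _)

lemma vec_eq_iff {x y x' y' : ℝ} : (!₂[x, y] : Plane) = !₂[x', y'] ↔ x = x' ∧ y = y' := by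
  refine ⟨fun h => ⟨?_, ?_⟩, fun ⟨h, h'⟩ => by rw [h, h']⟩
  · simpa using congrArg (fun v : Plane => v 0) h
  · simpa using congrArg (fun v : Plane => v 1) h

lemma norm_vec_le {x y r : ℝ} (hr : 0 ≤ r) (h : x ^ 2 + y ^ 2 ≤ r ^ 2) :
    ‖(!₂[x, y] : Plane)‖ ≤ r := by
  rw [EuclideanSpace.norm_eq, Real.sqrt_le_iff]
  refine ⟨hr, ?_⟩
  simpa using h

lemma lt_iff_lt_of_notMem_Icc {a b s s' t : ℝ} (hs : s ∈ Set.Icc a b) (hs' : s' ∈ Set.Icc a b)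
    (ht : t ∉ Set.Icc a b) : t < s ↔ t < s' := by
  have key : ∀ {s s'}, s ∈ Set.Icc a b → s' ∈ Set.Icc a b → t < s → t < s' := by
    intro s s' hs hs' h
    by_contra hc
    exact ht ⟨hs'.1.trans (not_lt.1 hc), h.le.trans hs.2⟩
  exact ⟨key hs hs', key hs' hs⟩

lemma lt_iff_lt_of_notMem_Icc' {a b s s' t : ℝ} (hs : s ∈ Set.Icc a b) (hs' : s' ∈ Set.Icc a b)
    (ht : t ∉ Set.Icc a b) : s < t ↔ s' < t := by
  have key : ∀ {s s'}, s ∈ Set.Icc a b → s' ∈ Set.Icc a b → s < t → s' < t := by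
    intro s s' hs hs' h
    by_contra hc
    exact ht ⟨hs.1.trans h.le, (not_lt.1 hc).trans hs'.2⟩
  exact ⟨key hs hs', key hs' hs⟩

/-! ### The effect of local changes on the determinant, and the first Reidemeister move. -/

namespace LongVirtualDiagram

variable {D D' : LongVirtualDiagram}

lemma height_eq_of_forall_virt {s s' : ℝ} (h : ∀ x y, D.Virt x y → (x < s ↔ x < s')) :
    D.height s = D.height s' := by
  rw [height_eq_sum, height_eq_sum]
  refine Finset.sum_congr rfl fun z hz => ?_
  unfold heightTerm
  simp only [h z.1 z.2 (D.mem_virtPairs.1 hz)]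

namespace AgreeOutside

variable {I : Set ℝ}

lemma height_eq (H : D.AgreeOutside D' I) (h : ∀ x y, x ∈ I → ¬ D.Virt x y)
    (h' : ∀ x y, x ∈ I → ¬ D'.Virt x y) (t : ℝ) : D'.height t = D.height t := by
  have := H.height_sub (P := ∅) (P' := ∅)
    (fun z => iff_of_false (by simp) fun hz => h _ _ hz.2 hz.1)
    (fun z => iff_of_false (by simp) fun hz => h' _ _ hz.2 hz.1)
    (fun x _ => (Iff.rfl : x < t ↔ x < t))
  simpa using this.symm

/-- If all crossings in the region of change are virtual, the determinant only depends on the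
heights outside this region. -/
lemma det_overMatrix_eq (H : D.AgreeOutside D' I) (h : ∀ x y, x ∈ I → ¬ D.Over x y)
    (h' : ∀ x y, x ∈ I → ¬ D'.Over x y) (hh : ∀ t, t ∉ I → D'.height t = D.height t) :
    D'.overMatrix.det = D.overMatrix.det := by
  have hiff : ∀ z : ℝ × ℝ, D.Over z.1 z.2 ↔ D'.Over z.1 z.2 := by
    intro z
    by_cases hz : z.1 ∈ I
    · exact iff_of_false (h _ _ hz) (h' _ _ hz)
    · exact H.over_iff hz
  let e : D.OverPair ≃ D'.OverPair := (Equiv.refl _).subtypeEquiv hiff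
  have he : ∀ z, (e z).1 = z.1 := fun _ => rfl
  have h1 : ∀ z : D.OverPair, z.1.1 ∉ I := fun z hz => h _ _ hz z.2
  have h2 : ∀ z : D.OverPair, z.1.2 ∉ I := fun z hz => h1 z ((H.mem_iff _ _ z.2.curve_eq).2 hz)
  unfold overMatrix
  apply det_pairMatrix_congr e
  · intro v w; rw [he, he]
  · intro v w; rw [he, he]
  · intro v; rw [he, H.pairWeight_eq (h1 v) v.2]
  · intro v; rw [he, hh _ (h1 v), hh _ (h2 v)]

/-- The crossings of the diagram without crossings in the region of change are crossings of the
other diagram. -/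
def inclusion (H : D.AgreeOutside D' I) (h : ∀ x y, x ∈ I → ¬ D.Over x y) :
    D.OverPair → D'.OverPair :=
  fun z => ⟨z.1, (H.over_iff fun hz => h _ _ hz z.2).1 z.2⟩

lemma inclusion_injective (H : D.AgreeOutside D' I) (h : ∀ x y, x ∈ I → ¬ D.Over x y) :
    Function.Injective (H.inclusion h) :=
  fun _ _ hvw => Subtype.ext (congrArg (fun z : D'.OverPair => z.1) hvw)

lemma notMem_range_inclusion_iff (H : D.AgreeOutside D' I) (h : ∀ x y, x ∈ I → ¬ D.Over x y)
    (z : D'.OverPair) : z ∉ Set.range (H.inclusion h) ↔ z.1.1 ∈ I := by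
  constructor
  · intro hz
    by_contra hI
    exact hz ⟨⟨z.1, (H.over_iff hI).2 z.2⟩, rfl⟩
  · rintro hz ⟨w, rfl⟩
    exact h _ _ hz w.2

/-- The determinant after the insertion of a classical curl. -/
lemma det_overMatrix_of_curl {a b : ℝ} (H : D.AgreeOutside D' (Set.Icc a b))
    (h : ∀ x y, x ∈ Set.Icc a b → x ≠ y → D.curve x ≠ D.curve y) {x y : ℝ}
    (hx : x ∈ Set.Icc a b) (hy : y ∈ Set.Icc a b)
    (hxy : ∀ x' y', x' ∈ Set.Icc a b → x' ≠ y' → D'.curve x' = D'.curve y' →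
      x' = x ∧ y' = y ∨ x' = y ∧ y' = x) (hover : D'.Over x y) :
    ∃ w : ZetaRing, IsUnit w ∧
      D'.overMatrix.det = D.overMatrix.det * LaurentPolynomial.C w := by
  have hD : ∀ x y, x ∈ Set.Icc a b → ¬ D.Over x y := fun x y hx ho => h x y hx ho.ne ho.curve_eq
  have hDv : ∀ x y, x ∈ Set.Icc a b → ¬ D.Virt x y := fun x y hx ho => h x y hx ho.ne ho.curve_eq
  have hDv' : ∀ x y, x ∈ Set.Icc a b → ¬ D'.Virt x y := by
    intro x' y' hx' hv
    rcases hxy x' y' hx' hv.ne hv.curve_eq with ⟨rfl, rfl⟩ | ⟨rfl, rfl⟩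
    · exact hover.not_virt hv
    · exact hover.not_virt hv.symm
  have hheight := H.height_eq hDv hDv'
  -- The only crossing on the interval is classical, so the height is constant there and the new
  -- crossing has exponent 0.
  have hconst : D'.height x = D'.height y :=
    height_eq_of_forall_virt fun x' y' hv =>
      lt_iff_lt_of_notMem_Icc hx hy fun hI => hDv' x' y' hI hv
  have h1 : ∀ z : D.OverPair, z.1.1 ∉ Set.Icc a b := fun z hz => hD _ _ hz z.2
  have h2 : ∀ z : D.OverPair, z.1.2 ∉ Set.Icc a b :=
    fun z hz => h1 z ((H.mem_iff _ _ z.2.curve_eq).2 hz)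
  have key := det_pairMatrix_of_curl (R := LaurentPolynomial ZetaRing) (H.inclusion hD)
    (H.inclusion_injective hD) ⟨(x, y), hover⟩
    (by
      intro z
      rw [H.notMem_range_inclusion_iff hD]
      constructor
      · intro hz
        rcases hxy _ _ hz z.2.ne z.2.curve_eq with ⟨e1, e2⟩ | ⟨e1, e2⟩
        · exact Subtype.ext (Prod.ext e1 e2)
        · have := z.2
          rw [e1, e2] at this
          exact absurd this hover.not_over
      · rintro rfl
        exact hx)
    (fun z => z.1.2) (fun z => z.1.1) (fun z => z.1.2) (fun z => z.1.1)
    (fun z => LaurentPolynomial.C (D.pairWeight z.1.1 z.1.2))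
    (fun z => LaurentPolynomial.T (D.height z.1.1 - D.height z.1.2))
    (fun z => LaurentPolynomial.C (D'.pairWeight z.1.1 z.1.2))
    (fun z => LaurentPolynomial.T (D'.height z.1.1 - D'.height z.1.2))
    (fun _ => rfl) (fun _ => rfl)
    (fun v => by simp only [inclusion]; rw [H.pairWeight_eq (h1 v) v.2])
    (fun v => by simp only [inclusion]; rw [hheight, hheight])
    (by rw [hconst]; simp)
    (fun w => lt_iff_lt_of_notMem_Icc hx hy (h2 w))
  by_cases hlt : y < x
  · refine ⟨D'.pairWeight x y, ZetaRing.isUnit_power _ _, ?_⟩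
    rw [if_pos hlt] at key
    exact key
  · refine ⟨1, isUnit_one, ?_⟩
    rw [if_neg hlt] at key
    rw [map_one]
    exact key

end AgreeOutside

/-- A classical curl multiplies the determinant by a unit; a virtual curl adds two neighbouring
opposite jumps, invisible from outside. Only the degree is an invariant, not the determinant itself.
-/
theorem Move1.degree_eq (H : Move1 D D') : D'.crossingDet.degree = D.crossingDet.degree := by
  obtain ⟨a, b, τ, hτ, H⟩ := H
  have hτ0 : τ ≠ 0 := by rcases hτ with rfl | rfl <;> norm_num
  have hτ2 : τ ^ 2 = 1 := by rcases hτ with rfl | rfl <;> norm_num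
  obtain ⟨⟨θ, hθ⟩, θ', hθ'⟩ := H.exists_hasPicture
    (v := fun _ _ => !₂[1, 0]) (v' := fun _ u => !₂[3 * u ^ 2 - 1, τ * (2 * u)])
    (fun i u => hasDerivAt_vec (hasDerivAt_id u) (hasDerivAt_const u 0))
    (fun i u => hasDerivAt_vec (by simpa using (hasDerivAt_pow 3 u).fun_sub (hasDerivAt_id' u))
      (by simpa using (hasDerivAt_pow 2 u).const_mul τ))
  have hI : strandTimes a b = Set.Icc (a 0) (b 0) := by
    ext t
    simp [strandTimes]
  have HA := H.agreeOutside
  rw [hI] at HA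
  have hD : ∀ x y, x ∈ Set.Icc (a 0) (b 0) → x ≠ y → D.curve x ≠ D.curve y := by
    intro x y hx hxy heq
    have hy := (HA.mem_iff x y heq).1 hx
    rw [hθ.curve_eq_iff 0 0 x hx y hy, vec_eq_iff] at heq
    exact hxy ((hθ.strictMono 0).injective heq.1)
  -- The parameters `1` and `-1` are those of the double point `(0, τ)` of the model curl.
  have hn : ∀ u : ℝ, u ^ 2 = 1 → ‖(!₂[u ^ 3 - u, τ * u ^ 2] : Plane)‖ ≤ 2 := by
    intro u hu
    refine norm_vec_le (by norm_num) ?_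
    have : u ^ 3 - u = 0 := by linear_combination u * hu
    rw [this, hu]
    norm_num [hτ2]
  obtain ⟨x, hx, hx1⟩ := hθ'.exists_time 0 1 (hn 1 (by norm_num))
  obtain ⟨y, hy, hy1⟩ := hθ'.exists_time 0 (-1) (hn (-1) (by norm_num))
  have hxy : x ≠ y := by
    rintro rfl
    rw [hx1] at hy1
    norm_num at hy1
  have hcurve : D'.curve x = D'.curve y := by
    rw [hθ'.curve_eq_iff 0 0 x hx y hy, hx1, hy1, vec_eq_iff]
    norm_num
  have hD' : ∀ x' y', x' ∈ Set.Icc (a 0) (b 0) → x' ≠ y' → D'.curve x' = D'.curve y' →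
      x' = x ∧ y' = y ∨ x' = y ∧ y' = x := by
    intro x' y' hx' hne heq
    have hy' := (HA.mem_iff' x' y' heq).1 hx'
    rw [hθ'.curve_eq_iff 0 0 x' hx' y' hy', vec_eq_iff] at heq
    obtain ⟨e1, e2⟩ := heq
    have inj := (hθ'.strictMono 0).injective
    have hne' : θ' 0 x' ≠ θ' 0 y' := fun h => hne (inj h)
    -- Equal second coordinates force opposite parameters; the first coordinates then leave only
    -- `0`, `1` and `-1`.
    have e3 : θ' 0 y' = - θ' 0 x' := by
      have : (θ' 0 x' - θ' 0 y') * (θ' 0 x' + θ' 0 y') = 0 := by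
        have := mul_left_cancel₀ hτ0 e2
        linear_combination this
      have := (mul_eq_zero.1 this).resolve_left (sub_ne_zero.2 hne')
      linarith
    rw [e3] at e1 hne'
    have e4 : θ' 0 x' * ((θ' 0 x' - 1) * (θ' 0 x' + 1)) = 0 := by linear_combination e1 / 2
    rcases mul_eq_zero.1 e4 with h | h
    · rw [h] at hne'; simp at hne'
    · rcases mul_eq_zero.1 h with h | h
      · left
        exact ⟨inj (by rw [hx1]; linarith), inj (by rw [hy1]; linarith)⟩
      · right
        exact ⟨inj (by rw [hy1]; linarith), inj (by rw [hx1]; linarith)⟩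
  rw [crossingDet_eq, crossingDet_eq]
  have hunit : ∀ {f g : LaurentPolynomial ZetaRing}, (∃ w : ZetaRing, IsUnit w ∧
      f = g * LaurentPolynomial.C w) → f.degree = g.degree := by
    rintro f g ⟨w, hw, rfl⟩
    rw [mul_comm, LaurentPolynomial.degree_C_mul_of_isUnit hw]
  rcases over_or_over_or_virt hxy hcurve with ho | ho | hv
  · exact hunit (HA.det_overMatrix_of_curl hD hx hy hD' ho)
  · exact hunit (HA.det_overMatrix_of_curl hD hy hx
      (fun x' y' h1 h2 h3 => (hD' x' y' h1 h2 h3).symm) ho)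
  · congr 1
    refine HA.det_overMatrix_eq (fun x y hx ho => hD x y hx ho.ne ho.curve_eq) ?_ ?_
    · intro x' y' hx' ho
      rcases hD' x' y' hx' ho.ne ho.curve_eq with ⟨rfl, rfl⟩ | ⟨rfl, rfl⟩
      · exact ho.not_virt hv
      · exact ho.not_virt hv.symm
    · intro t ht
      -- A time outside the interval comes after both passages or before both, so their opposite
      -- jumps cancel.
      have h1 := HA.height_sub (P := ∅) (P' := {(x, y), (y, x)})
        (fun z => iff_of_false (by simp) fun hz => hD _ _ hz.2 hz.1.ne hz.1.curve_eq) (by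
          rintro ⟨x', y'⟩
          simp only [Finset.mem_insert, Finset.mem_singleton, Prod.mk.injEq]
          constructor
          · rintro (⟨rfl, rfl⟩ | ⟨rfl, rfl⟩)
            · exact ⟨hv, hx⟩
            · exact ⟨hv.symm, hy⟩
          · rintro ⟨h1, h2⟩
            exact hD' x' y' h2 h1.ne h1.curve_eq) (fun x _ => (Iff.rfl : x < t ↔ x < t))
      rw [Finset.sum_pair (by simp [hxy])] at h1
      unfold heightTerm at h1
      simp only [D'.jump_swap x y, lt_iff_lt_of_notMem_Icc' hx hy ht] at h1
      rw [Finset.sum_empty] at h1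
      split_ifs at h1 <;> linarith

end LongVirtualDiagram

/-! ### The second Reidemeister move. -/

namespace LongVirtualDiagram

variable {D D' : LongVirtualDiagram}

section Patterns

variable {m : ℕ} {a b : Fin m → ℝ}

lemma HasPattern.eq_of_hasKind {P : Fin m → Fin m → CrossingKind} (hP : D.HasPattern a b P)
    {x y : ℝ} {k : CrossingKind} (h : D.HasKind x y k) {i j : Fin m}
    (hx : x ∈ Set.Icc (a i) (b i)) (hy : y ∈ Set.Icc (a j) (b j)) : k = P i j := by
  obtain ⟨h1, rfl⟩ := h
  exact hP ⟨(x, y), h1⟩ i j hx hy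

lemma HasPattern.over_of_layered {height : Fin m → ℕ} (hP : D.HasPattern a b (layered height))
    {x y : ℝ} (hxy : x ≠ y) (h : D.curve x = D.curve y) {i j : Fin m}
    (hx : x ∈ Set.Icc (a i) (b i)) (hy : y ∈ Set.Icc (a j) (b j)) (hij : height j < height i) :
    D.Over x y := by
  rcases lt_or_gt_of_ne hxy with hlt | hlt
  · obtain ⟨k, hk⟩ := exists_hasKind hlt h
    have := hP.eq_of_hasKind hk hx hy
    rw [layered, if_pos hij] at this
    exact Or.inl (this ▸ hk)
  · obtain ⟨k, hk⟩ := exists_hasKind hlt h.symm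
    have := hP.eq_of_hasKind hk hy hx
    rw [layered, if_neg hij.not_gt] at this
    exact Or.inr (this ▸ hk)

lemma HasPattern.virt_of_virtual {P : Fin m → Fin m → CrossingKind} (hP : D.HasPattern a b P)
    {x y : ℝ} (hxy : x ≠ y) (h : D.curve x = D.curve y) {i j : Fin m}
    (hx : x ∈ Set.Icc (a i) (b i)) (hy : y ∈ Set.Icc (a j) (b j))
    (hij : P i j = CrossingKind.virtual) (hji : P j i = CrossingKind.virtual) : D.Virt x y := by
  rcases lt_or_gt_of_ne hxy with hlt | hlt
  · obtain ⟨k, hk⟩ := exists_hasKind hlt h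
    exact Or.inl ((hP.eq_of_hasKind hk hx hy).trans hij ▸ hk)
  · obtain ⟨k, hk⟩ := exists_hasKind hlt h.symm
    exact Or.inr ((hP.eq_of_hasKind hk hy hx).trans hji ▸ hk)

end Patterns

namespace AgreeOutside

/-- The determinant after the insertion of a classical bigon. -/
lemma det_overMatrix_of_bigon {I A B : Set ℝ} (H : D.AgreeOutside D' I)
    (hAB : ∀ t, t ∈ I ↔ t ∈ A ∨ t ∈ B) (hdisj : Disjoint A B)
    (hA : ∀ s ∈ A, ∀ s' ∈ A, ∀ t, t ∉ A → (t < s ↔ t < s'))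
    (hB : ∀ s ∈ B, ∀ s' ∈ B, ∀ t, t ∉ B → ((t < s ↔ t < s') ∧ (s < t ↔ s' < t)))
    (h : ∀ x y, x ∈ I → x ≠ y → D.curve x ≠ D.curve y) {x₁ y₁ x₂ y₂ : ℝ}
    (hx₁ : x₁ ∈ A) (hx₂ : x₂ ∈ A) (hy₁ : y₁ ∈ B) (hy₂ : y₂ ∈ B) (hlt : y₁ < y₂)
    (ho₁ : D'.Over x₁ y₁) (ho₂ : D'.Over x₂ y₂)
    (hover : ∀ x y, x ∈ I → D'.Over x y → x = x₁ ∧ y = y₁ ∨ x = x₂ ∧ y = y₂)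
    (hvirt : ∀ x y, x ∈ I → ¬ D'.Virt x y) (hjump : D'.jump x₁ y₁ = - D'.jump x₂ y₂) :
    D'.overMatrix.det = D.overMatrix.det := by
  have hD : ∀ x y, x ∈ I → ¬ D.Over x y := fun x y hx ho => h x y hx ho.ne ho.curve_eq
  have hDv : ∀ x y, x ∈ I → ¬ D.Virt x y := fun x y hx ho => h x y hx ho.ne ho.curve_eq
  have hheight := H.height_eq hDv hvirt
  have hnA : ∀ t, t ∉ I → t ∉ A := fun t ht hA => ht ((hAB t).2 (Or.inl hA))
  have hnB : ∀ t, t ∉ I → t ∉ B := fun t ht hB => ht ((hAB t).2 (Or.inr hB))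
  have hBA : ∀ t ∈ B, t ∉ A := fun t ht hA => Set.disjoint_left.1 hdisj hA ht
  have hABn : ∀ t ∈ A, t ∉ B := fun t ht => Set.disjoint_left.1 hdisj ht
  have hVI : ∀ x y, D'.Virt x y → x ∉ I := fun x y hv hI => hvirt x y hI hv
  have hc1 : D'.height x₁ = D'.height x₂ := height_eq_of_forall_virt fun x' y' hv =>
    hA _ hx₁ _ hx₂ _ (hnA _ (hVI _ _ hv))
  have hc2 : D'.height y₁ = D'.height y₂ := height_eq_of_forall_virt fun x' y' hv =>
    (hB _ hy₁ _ hy₂ _ (hnB _ (hVI _ _ hv))).1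
  have h1 : ∀ z : D.OverPair, z.1.1 ∉ I := fun z hz => hD _ _ hz z.2
  have h2 : ∀ z : D.OverPair, z.1.2 ∉ I := fun z hz => h1 z ((H.mem_iff _ _ z.2.curve_eq).2 hz)
  refine det_pairMatrix_of_bigon (R := LaurentPolynomial ZetaRing) (H.inclusion hD)
    (H.inclusion_injective hD) ⟨(x₁, y₁), ho₁⟩ ⟨(x₂, y₂), ho₂⟩ ?_ ?_
    (fun z => z.1.2) (fun z => z.1.1) (fun z => z.1.2) (fun z => z.1.1)
    (fun z => LaurentPolynomial.C (D.pairWeight z.1.1 z.1.2))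
    (fun z => LaurentPolynomial.T (D.height z.1.1 - D.height z.1.2))
    (fun z => LaurentPolynomial.C (D'.pairWeight z.1.1 z.1.2))
    (fun z => LaurentPolynomial.T (D'.height z.1.1 - D'.height z.1.2))
    (fun _ => rfl) (fun _ => rfl)
    (fun v => by simp only [inclusion]; rw [H.pairWeight_eq (h1 v) v.2])
    (fun v => by simp only [inclusion]; rw [hheight, hheight])
    (by rw [hc1, hc2]) ?_ hlt
    (fun w => hA _ hx₁ _ hx₂ _ (hnA _ (h2 w)))
    (fun w => (hB _ hy₁ _ hy₂ _ (hnB _ (h2 w))).1)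
    (fun w => (hB _ hy₁ _ hy₂ _ (hnB _ (h2 w))).2)
    (fun w => (hB _ hy₁ _ hy₂ _ (hnB _ (h1 w))).2)
    (hB _ hy₁ _ hy₂ _ (hABn _ hx₁)).2 (hA _ hx₁ _ hx₂ _ (hBA _ hy₁))
    (hA _ hx₁ _ hx₂ _ (hBA _ hy₂))
  · intro hh
    exact hlt.ne (congrArg (fun z : D'.OverPair => z.1.2) hh)
  · intro z
    rw [H.notMem_range_inclusion_iff hD]
    constructor
    · intro hz
      rcases hover _ _ hz z.2 with ⟨e1, e2⟩ | ⟨e1, e2⟩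
      · exact Or.inl (Subtype.ext (Prod.ext e1 e2))
      · exact Or.inr (Subtype.ext (Prod.ext e1 e2))
    · rintro (rfl | rfl)
      · exact (hAB _).2 (Or.inl hx₁)
      · exact (hAB _).2 (Or.inl hx₂)
  -- The two strands occupy disjoint time intervals, so both crossings are early overcrossings or
  -- both are early undercrossings.
  · have e : (x₁ < y₁) = (x₂ < y₂) := propext
      ((hB _ hy₁ _ hy₂ _ (hABn _ hx₁)).1.trans
        (by
          have n1 : x₁ ≠ y₂ := fun hh => hABn _ hx₁ (hh ▸ hy₂)
          have n2 : x₂ ≠ y₂ := ho₂.ne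
          rw [← not_le, ← not_le, le_iff_lt_or_eq, le_iff_lt_or_eq,
            hA _ hx₁ _ hx₂ _ (hBA _ hy₂)]
          simp [n1.symm, n2.symm]))
    dsimp only
    -- Same variable and opposite signs: the two weights are inverse to each other.
    rw [← map_mul, pairWeight, pairWeight, e, hjump, ZetaRing.power_neg_mul, map_one]

end AgreeOutside

lemma lt_iff_of_mem_Icc {a b : ℝ} : ∀ s ∈ Set.Icc a b, ∀ s' ∈ Set.Icc a b, ∀ t, t ∉ Set.Icc a b →
    ((t < s ↔ t < s') ∧ (s < t ↔ s' < t)) := fun _ hs _ hs' _ ht =>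
  ⟨lt_iff_lt_of_notMem_Icc hs hs' ht, lt_iff_lt_of_notMem_Icc' hs hs' ht⟩

theorem Move2.crossingDet_eq (H : Move2 D D') : D'.crossingDet = D.crossingDet := by
  obtain ⟨a, b, σ, τ, hσ, hτ, H, hpat⟩ := H
  have hτ0 : τ ≠ 0 := by rcases hτ with rfl | rfl <;> norm_num
  have hσ0 : σ ≠ 0 := by rcases hσ with rfl | rfl <;> norm_num
  have hσ2 : σ * σ = 1 := by rcases hσ with rfl | rfl <;> norm_num
  have hτ2 : τ ^ 2 = 1 := by rcases hτ with rfl | rfl <;> norm_num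
  obtain ⟨⟨θ, hθ⟩, θ', hθ'⟩ := H.exists_hasPicture
    (v := ![fun _ => !₂[1, 0], fun _ => !₂[σ, 0]])
    (v' := ![fun _ => !₂[1, 0], fun u => !₂[σ, τ * (2 * u)]])
    (by
      intro i u
      fin_cases i
      · exact hasDerivAt_vec (hasDerivAt_id u) (hasDerivAt_const u 0)
      · exact hasDerivAt_vec (by simpa using (hasDerivAt_id' u).const_mul σ)
          (hasDerivAt_const u τ))
    (by
      intro i u
      fin_cases i
      · exact hasDerivAt_vec (hasDerivAt_id u) (hasDerivAt_const u 0)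
      · exact hasDerivAt_vec (by simpa using (hasDerivAt_id' u).const_mul σ)
          (by simpa using ((hasDerivAt_pow 2 u).sub_const 1).const_mul τ))
  have HA := H.agreeOutside
  have hdisj : ∀ i j, i ≠ j → Disjoint (Set.Icc (a i) (b i)) (Set.Icc (a j) (b j)) := H.2.2.1
  have hI : ∀ t, t ∈ strandTimes a b ↔ t ∈ Set.Icc (a 0) (b 0) ∨ t ∈ Set.Icc (a 1) (b 1) := by
    intro t
    simp only [strandTimes, Set.mem_ofPred_eq, Fin.exists_fin_two]
  have inj := fun i => (hθ.strictMono i).injective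
  have inj' := fun i => (hθ'.strictMono i).injective
  have hD : ∀ x y, x ∈ strandTimes a b → x ≠ y → D.curve x ≠ D.curve y := by
    intro x y hx hxy heq
    have hy := (HA.mem_iff x y heq).1 hx
    rw [hI] at hx hy
    rcases hx with hx | hx <;> rcases hy with hy | hy
    · have := (hθ.curve_eq_iff 0 0 x hx y hy).1 heq
      exact hxy (inj 0 (vec_eq_iff.1 this).1)
    · have := (hθ.curve_eq_iff 0 1 x hx y hy).1 heq
      exact hτ0 (vec_eq_iff.1 this).2.symm
    · have := (hθ.curve_eq_iff 1 0 x hx y hy).1 heq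
      exact hτ0 (vec_eq_iff.1 this).2
    · have := (hθ.curve_eq_iff 1 1 x hx y hy).1 heq
      exact hxy (inj 1 (mul_left_cancel₀ hσ0 (vec_eq_iff.1 this).1))
  -- The model strands meet at the points `(ε, 0)` with `ε = ±1`. The second strand is there at the
  -- parameter `σ * ε`, because `σ * σ = 1`, and the sign of the crossing changes with `ε`.
  have hex : ∀ ε : ℝ, ε ^ 2 = 1 → ∃ x ∈ Set.Icc (a 0) (b 0), ∃ y ∈ Set.Icc (a 1) (b 1),
      θ' 0 x = ε ∧ θ' 1 y = σ * ε ∧ D'.curve x = D'.curve y ∧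
        D'.jump x y = (SignType.sign (τ * (2 * (σ * ε))) : ℤ) := by
    intro ε hε
    have hσε : (σ * ε) ^ 2 = 1 := by rw [mul_pow, hε, mul_one, sq, hσ2]
    obtain ⟨x, hx, hx1⟩ := hθ'.exists_time 0 ε
      (norm_vec_le (x := ε) (y := 0) (by norm_num) (by rw [hε]; norm_num))
    obtain ⟨y, hy, hy1⟩ := hθ'.exists_time 1 (σ * ε)
      (norm_vec_le (x := σ * (σ * ε)) (y := τ * ((σ * ε) ^ 2 - 1)) (by norm_num) (by
        rw [hσε, ← mul_assoc, hσ2, one_mul, hε]; norm_num))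
    have hc : D'.curve x = D'.curve y := by
      refine (hθ'.curve_eq_iff 0 1 x hx y hy).2 (vec_eq_iff.2 ?_)
      rw [hx1, hy1, ← mul_assoc, hσ2, hσε]
      simp
    refine ⟨x, hx, y, hy, hx1, hy1, hc, ?_⟩
    rw [hθ'.jump_eq 0 1 x hx y hy hc, hx1, hy1]
    congr 2
    simp [Plane.cross]
  obtain ⟨x₁, hx₁, y₁, hy₁, hx₁θ, hy₁θ, hc₁, hj₁⟩ := hex 1 (by norm_num)
  obtain ⟨x₂, hx₂, y₂, hy₂, hx₂θ, hy₂θ, hc₂, hj₂⟩ := hex (-1) (by norm_num)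
  have hjump : D'.jump x₁ y₁ = - D'.jump x₂ y₂ := by
    have e : τ * (2 * (σ * -1)) = - (τ * (2 * (σ * 1))) := by ring
    rw [hj₁, hj₂, e, Left.sign_neg]
    simp
  have h01 : Disjoint (Set.Icc (a 0) (b 0)) (Set.Icc (a 1) (b 1)) := hdisj 0 1 (by simp)
  have n₁ : x₁ ≠ y₁ := fun h => Set.disjoint_left.1 h01 hx₁ (h ▸ hy₁)
  have n₂ : x₂ ≠ y₂ := fun h => Set.disjoint_left.1 h01 hx₂ (h ▸ hy₂)
  have ny : y₁ ≠ y₂ := by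
    rintro rfl
    rw [hy₁θ] at hy₂θ
    have := mul_left_cancel₀ hσ0 hy₂θ
    norm_num at this
  have nx : x₁ ≠ x₂ := by
    rintro rfl
    rw [hx₁θ] at hx₂θ
    norm_num at hx₂θ
  have hin01 : ∀ x ∈ Set.Icc (a 0) (b 0), ∀ y ∈ Set.Icc (a 1) (b 1), D'.curve x = D'.curve y →
      x = x₁ ∧ y = y₁ ∨ x = x₂ ∧ y = y₂ := by
    intro x hx y hy h
    obtain ⟨e1, e2⟩ := vec_eq_iff.1 ((hθ'.curve_eq_iff 0 1 x hx y hy).1 h)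
    have e3 : (θ' 1 y) ^ 2 - 1 = 0 := (mul_eq_zero.1 e2.symm).resolve_left hτ0
    have e4 : (θ' 1 y - σ) * (θ' 1 y + σ) = 0 := by linear_combination e3 - hσ2
    rcases mul_eq_zero.1 e4 with h | h
    · left
      have h' : θ' 1 y = σ * 1 := by linarith
      exact ⟨inj' 0 (by rw [hx₁θ, e1, h', mul_one, hσ2]), inj' 1 (by rw [hy₁θ, h'])⟩
    · right
      have h' : θ' 1 y = σ * -1 := by linarith
      exact ⟨inj' 0 (by rw [hx₂θ, e1, h', ← mul_assoc, hσ2, one_mul]),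
        inj' 1 (by rw [hy₂θ, h'])⟩
  have hin : ∀ x y, x ∈ strandTimes a b → x ≠ y → D'.curve x = D'.curve y →
      (x = x₁ ∧ y = y₁ ∨ x = x₂ ∧ y = y₂) ∨ (x = y₁ ∧ y = x₁ ∨ x = y₂ ∧ y = x₂) := by
    intro x y hx hne heq
    have hy := (HA.mem_iff' x y heq).1 hx
    rw [hI] at hx hy
    rcases hx with hx | hx <;> rcases hy with hy | hy
    · have := (hθ'.curve_eq_iff 0 0 x hx y hy).1 heq
      exact absurd (inj' 0 (vec_eq_iff.1 this).1) hne
    · exact Or.inl (hin01 x hx y hy heq)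
    · refine Or.inr ?_
      rcases hin01 y hy x hx heq.symm with ⟨h1, h2⟩ | ⟨h1, h2⟩
      · exact Or.inl ⟨h2, h1⟩
      · exact Or.inr ⟨h2, h1⟩
    · have := (hθ'.curve_eq_iff 1 1 x hx y hy).1 heq
      exact absurd (inj' 1 (mul_left_cancel₀ hσ0 (vec_eq_iff.1 this).1)) hne
  rw [LongVirtualDiagram.crossingDet_eq, LongVirtualDiagram.crossingDet_eq]
  rcases hpat with hpat | ⟨height, hinj, hpat⟩
  · have hv₁ : D'.Virt x₁ y₁ := hpat.virt_of_virtual n₁ hc₁ hx₁ hy₁ rfl rfl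
    have hv₂ : D'.Virt x₂ y₂ := hpat.virt_of_virtual n₂ hc₂ hx₂ hy₂ rfl rfl
    have hvin : ∀ x y, x ∈ strandTimes a b → x ≠ y → D'.curve x = D'.curve y → D'.Virt x y := by
      intro x y hx hne heq
      rcases hin x y hx hne heq with (⟨rfl, rfl⟩ | ⟨rfl, rfl⟩) | (⟨rfl, rfl⟩ | ⟨rfl, rfl⟩)
      exacts [hv₁, hv₂, hv₁.symm, hv₂.symm]
    refine HA.det_overMatrix_eq (fun x y hx ho => hD x y hx ho.ne ho.curve_eq)
      (fun x y hx ho => ho.not_virt (hvin x y hx ho.ne ho.curve_eq)) ?_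
    intro t ht
    have ht0 : t ∉ Set.Icc (a 0) (b 0) := fun h => ht ((hI t).2 (Or.inl h))
    have ht1 : t ∉ Set.Icc (a 1) (b 1) := fun h => ht ((hI t).2 (Or.inr h))
    have nxy : ∀ x ∈ Set.Icc (a 0) (b 0), ∀ y ∈ Set.Icc (a 1) (b 1), x ≠ y :=
      fun x hx y hy h => Set.disjoint_left.1 h01 hx (h ▸ hy)
    -- Two virtual passages lie on each strand, with opposite jumps, and an outside time does not
    -- separate them.
    have h1 := HA.height_sub (P := ∅) (P' := {(x₁, y₁), (x₂, y₂), (y₁, x₁), (y₂, x₂)})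
      (fun z => iff_of_false (by simp) fun hz => hD _ _ hz.2 hz.1.ne hz.1.curve_eq) (by
        rintro ⟨x', y'⟩
        simp only [Finset.mem_insert, Finset.mem_singleton, Prod.mk.injEq]
        constructor
        · rintro (⟨rfl, rfl⟩ | ⟨rfl, rfl⟩ | ⟨rfl, rfl⟩ | ⟨rfl, rfl⟩)
          · exact ⟨hv₁, (hI _).2 (Or.inl hx₁)⟩
          · exact ⟨hv₂, (hI _).2 (Or.inl hx₂)⟩
          · exact ⟨hv₁.symm, (hI _).2 (Or.inr hy₁)⟩
          · exact ⟨hv₂.symm, (hI _).2 (Or.inr hy₂)⟩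
        · rintro ⟨h1, h2⟩
          rcases hin x' y' h2 h1.ne h1.curve_eq with (h | h) | (h | h)
          exacts [Or.inl h, Or.inr (Or.inl h), Or.inr (Or.inr (Or.inl h)),
            Or.inr (Or.inr (Or.inr h))]) (fun x _ => (Iff.rfl : x < t ↔ x < t))
    have m1 := nxy x₁ hx₁ y₂ hy₂
    have m2 := nxy x₂ hx₂ y₁ hy₁
    rw [Finset.sum_insert (by simp [nx, n₁, m1]), Finset.sum_insert (by simp [n₂, m2]),
      Finset.sum_pair (by simp [ny])] at h1
    unfold heightTerm at h1
    simp only [D'.jump_swap x₁ y₁, D'.jump_swap x₂ y₂, hjump,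
      lt_iff_lt_of_notMem_Icc' hx₁ hx₂ ht0, lt_iff_lt_of_notMem_Icc' hy₁ hy₂ ht1] at h1
    rw [Finset.sum_empty] at h1
    split_ifs at h1 <;> linarith
  · have h01' : Disjoint (Set.Icc (a 1) (b 1)) (Set.Icc (a 0) (b 0)) := h01.symm
    have hA : ∀ i, ∀ s ∈ Set.Icc (a i) (b i), ∀ s' ∈ Set.Icc (a i) (b i), ∀ t,
        t ∉ Set.Icc (a i) (b i) → (t < s ↔ t < s') :=
      fun i s hs s' hs' t ht => (lt_iff_of_mem_Icc s hs s' hs' t ht).1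
    rcases lt_or_gt_of_ne (hinj.ne (show (0 : Fin 2) ≠ 1 by simp)) with hlt | hlt
    · have ho₁ : D'.Over y₁ x₁ := hpat.over_of_layered n₁.symm hc₁.symm hy₁ hx₁ hlt
      have ho₂ : D'.Over y₂ x₂ := hpat.over_of_layered n₂.symm hc₂.symm hy₂ hx₂ hlt
      have hover : ∀ x y, x ∈ strandTimes a b → D'.Over x y →
          x = y₁ ∧ y = x₁ ∨ x = y₂ ∧ y = x₂ := by
        intro x y hx ho
        rcases hin x y hx ho.ne ho.curve_eq with (⟨rfl, rfl⟩ | ⟨rfl, rfl⟩) | h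
        · exact absurd ho ho₁.not_over
        · exact absurd ho ho₂.not_over
        · exact h
      have hvirt : ∀ x y, x ∈ strandTimes a b → ¬ D'.Virt x y := by
        intro x y hx hv
        rcases hin x y hx hv.ne hv.curve_eq with (⟨rfl, rfl⟩ | ⟨rfl, rfl⟩) | (⟨rfl, rfl⟩ | ⟨rfl, rfl⟩)
        exacts [ho₁.not_virt hv.symm, ho₂.not_virt hv.symm, ho₁.not_virt hv, ho₂.not_virt hv]
      have hj : D'.jump y₁ x₁ = - D'.jump y₂ x₂ := by
        rw [D'.jump_swap x₁ y₁, D'.jump_swap x₂ y₂, hjump]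
      -- The linear algebra wants the crossing that comes first on the lower strand to be named
      -- first.
      rcases lt_or_gt_of_ne nx with hxlt | hxlt
      · exact HA.det_overMatrix_of_bigon (fun t => (hI t).trans or_comm) h01' (hA 1)
          lt_iff_of_mem_Icc hD hy₁ hy₂ hx₁ hx₂ hxlt ho₁ ho₂ hover hvirt hj
      · exact HA.det_overMatrix_of_bigon (fun t => (hI t).trans or_comm) h01' (hA 1)
          lt_iff_of_mem_Icc hD hy₂ hy₁ hx₂ hx₁ hxlt ho₂ ho₁
          (fun x y hx ho => (hover x y hx ho).symm) hvirt (by rw [hj, neg_neg])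
    · have ho₁ : D'.Over x₁ y₁ := hpat.over_of_layered n₁ hc₁ hx₁ hy₁ hlt
      have ho₂ : D'.Over x₂ y₂ := hpat.over_of_layered n₂ hc₂ hx₂ hy₂ hlt
      have hover : ∀ x y, x ∈ strandTimes a b → D'.Over x y →
          x = x₁ ∧ y = y₁ ∨ x = x₂ ∧ y = y₂ := by
        intro x y hx ho
        rcases hin x y hx ho.ne ho.curve_eq with h | (⟨rfl, rfl⟩ | ⟨rfl, rfl⟩)
        · exact h
        · exact absurd ho ho₁.not_over
        · exact absurd ho ho₂.not_over
      have hvirt : ∀ x y, x ∈ strandTimes a b → ¬ D'.Virt x y := by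
        intro x y hx hv
        rcases hin x y hx hv.ne hv.curve_eq with (⟨rfl, rfl⟩ | ⟨rfl, rfl⟩) | (⟨rfl, rfl⟩ | ⟨rfl, rfl⟩)
        exacts [ho₁.not_virt hv, ho₂.not_virt hv, ho₁.not_virt hv.symm, ho₂.not_virt hv.symm]
      rcases lt_or_gt_of_ne ny with hylt | hylt
      · exact HA.det_overMatrix_of_bigon hI h01 (hA 0) lt_iff_of_mem_Icc hD hx₁ hx₂ hy₁ hy₂ hylt
          ho₁ ho₂ hover hvirt hjump
      · exact HA.det_overMatrix_of_bigon hI h01 (hA 0) lt_iff_of_mem_Icc hD hx₂ hx₁ hy₂ hy₁ hylt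
          ho₂ ho₁ (fun x y hx ho => (hover x y hx ho).symm) hvirt (by rw [hjump, neg_neg])

end LongVirtualDiagram

/-! ### The third Reidemeister move: combinatorics of the triangle, and its virtual and mixed
versions. -/

lemma Fin.three_eq_or_eq_or_eq : ∀ {i j k : Fin 3}, i ≠ j → i ≠ k → j ≠ k → ∀ l : Fin 3,
    l = i ∨ l = j ∨ l = k := by
  decide

namespace LongVirtualDiagram

/-- Two diagrams which agree outside three strands, each two of which cross exactly once, such that
the order of the two crossings on each of the three strands differs in the two diagrams. The strand
`i` meets the strand `j` at the time `X i j` in the first diagram, at the time `X' i j` in the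
second. -/
structure TriangleMove (D D' : LongVirtualDiagram) (a b : Fin 3 → ℝ) (X X' : Fin 3 → Fin 3 → ℝ) :
    Prop where
  agree : D.AgreeOutside D' (strandTimes a b)
  disj : ∀ i j, i ≠ j → Disjoint (Set.Icc (a i) (b i)) (Set.Icc (a j) (b j))
  mem : ∀ i j, i ≠ j → X i j ∈ Set.Icc (a i) (b i)
  mem' : ∀ i j, i ≠ j → X' i j ∈ Set.Icc (a i) (b i)
  curve_eq : ∀ i j, i ≠ j → D.curve (X i j) = D.curve (X j i)
  curve_eq' : ∀ i j, i ≠ j → D'.curve (X' i j) = D'.curve (X' j i)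
  inner : ∀ x y, x ∈ strandTimes a b → x ≠ y → D.curve x = D.curve y →
    ∃ i j, i ≠ j ∧ x = X i j ∧ y = X j i
  inner' : ∀ x y, x ∈ strandTimes a b → x ≠ y → D'.curve x = D'.curve y →
    ∃ i j, i ≠ j ∧ x = X' i j ∧ y = X' j i
  flip : ∀ i j k, i ≠ j → i ≠ k → (X' i j < X' i k ↔ X i k < X i j)
  jump_eq : ∀ i j, i ≠ j → D'.jump (X' i j) (X' j i) = D.jump (X i j) (X j i)
  -- The common point of the strands `i` and `j` lies on one side of the strand `k`. Hence both
  -- reach it before meeting `k` or both after, exactly if they cross `k` in the same direction.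
  side : ∀ i j k, i ≠ j → i ≠ k → j ≠ k →
    ((X i j < X i k ↔ X j i < X j k) ↔ D.jump (X i k) (X k i) = D.jump (X j k) (X k j))
  over_iff : ∀ i j, i ≠ j → (D'.Over (X' i j) (X' j i) ↔ D.Over (X i j) (X j i))
  virt_iff : ∀ i j, i ≠ j → (D'.Virt (X' i j) (X' j i) ↔ D.Virt (X i j) (X j i))

namespace TriangleMove

variable {D D' : LongVirtualDiagram} {a b : Fin 3 → ℝ} {X X' : Fin 3 → Fin 3 → ℝ}

lemma mem_strandTimes (H : TriangleMove D D' a b X X') {i j : Fin 3} (h : i ≠ j) :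
    X i j ∈ strandTimes a b := ⟨i, H.mem i j h⟩

lemma eq_of_mem (H : TriangleMove D D' a b X X') {t : ℝ} {i j : Fin 3}
    (hi : t ∈ Set.Icc (a i) (b i)) (hj : t ∈ Set.Icc (a j) (b j)) : i = j := by
  by_contra h
  exact Set.disjoint_left.1 (H.disj i j h) hi hj

lemma notMem (H : TriangleMove D D' a b X X') {t : ℝ} {i j : Fin 3} (hij : i ≠ j)
    (hi : t ∈ Set.Icc (a i) (b i)) : t ∉ Set.Icc (a j) (b j) := fun h => hij (H.eq_of_mem hi h)

lemma ne (H : TriangleMove D D' a b X X') {i j k : Fin 3} (hij : i ≠ j) (hik : i ≠ k)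
    (hjk : j ≠ k) : X i j ≠ X i k := by
  intro h
  have h1 := H.curve_eq i j hij
  have h2 := H.curve_eq i k hik
  rw [← h] at h2
  have n1 : X i j ≠ X j i := fun h => H.notMem hij (H.mem i j hij) (h ▸ H.mem j i hij.symm)
  have n2 : X i j ≠ X k i := fun h => H.notMem hik (H.mem i j hij) (h ▸ H.mem k i hik.symm)
  have h3 := eq_of_curve_eq h1 h2 n1 n2
  exact H.notMem hjk (H.mem j i hij.symm) (h3 ▸ H.mem k i hik.symm)

lemma symm (H : TriangleMove D D' a b X X') : TriangleMove D' D a b X' X where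
  agree := H.agree.symm
  disj := H.disj
  mem := H.mem'
  mem' := H.mem
  curve_eq := H.curve_eq'
  curve_eq' := H.curve_eq
  inner := H.inner'
  inner' := H.inner
  flip i j k hij hik := (H.flip i k j hik hij).symm
  jump_eq i j hij := (H.jump_eq i j hij).symm
  side i j k hij hik hjk := by
    -- Both orders are reversed, so whether they agree is not affected.
    rw [H.flip i j k hij hik, H.flip j i k hij.symm hjk, H.jump_eq i k hik, H.jump_eq j k hjk,
      ← H.side i j k hij hik hjk]
    have n1 := H.ne hij hik hjk
    have n2 := H.ne hij.symm hjk hik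
    rcases lt_or_gt_of_ne n1 with h1 | h1 <;> rcases lt_or_gt_of_ne n2 with h2 | h2 <;>
      simp [h1, h2, h1.not_gt, h2.not_gt]
  over_iff i j hij := (H.over_iff i j hij).symm
  virt_iff i j hij := (H.virt_iff i j hij).symm

lemma injective (H : TriangleMove D D' a b X X') {i j k l : Fin 3} (hij : i ≠ j) (hkl : k ≠ l)
    (h : X i j = X k l) : i = k ∧ j = l := by
  have h1 : i = k := H.eq_of_mem (H.mem i j hij) (h ▸ H.mem k l hkl)
  subst h1
  refine ⟨rfl, ?_⟩
  by_contra hjl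
  exact H.ne hij hkl hjl h

open Classical in
/-- The correspondence between the passages of the two diagrams. -/
noncomputable def transfer (X X' : Fin 3 → Fin 3 → ℝ) (t : ℝ) : ℝ :=
  if h : ∃ p : Fin 3 × Fin 3, p.1 ≠ p.2 ∧ t = X p.1 p.2 then X' h.choose.1 h.choose.2 else t

lemma transfer_apply (H : TriangleMove D D' a b X X') {i j : Fin 3} (h : i ≠ j) :
    transfer X X' (X i j) = X' i j := by
  have hex : ∃ p : Fin 3 × Fin 3, p.1 ≠ p.2 ∧ X i j = X p.1 p.2 := ⟨(i, j), h, rfl⟩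
  rw [transfer, dif_pos hex]
  obtain ⟨h1, h2⟩ := H.injective h hex.choose_spec.1 hex.choose_spec.2
  rw [← h1, ← h2]

lemma transfer_of_notMem (H : TriangleMove D D' a b X X') {t : ℝ} (ht : t ∉ strandTimes a b) :
    transfer X X' t = t := by
  rw [transfer, dif_neg]
  rintro ⟨p, hp, rfl⟩
  exact ht (H.mem_strandTimes hp)

/-- The times of the passages which may occur in the diagram. -/
def IsPassage (a b : Fin 3 → ℝ) (X : Fin 3 → Fin 3 → ℝ) (t : ℝ) : Prop :=
  t ∉ strandTimes a b ∨ ∃ i j, i ≠ j ∧ t = X i j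

lemma isPassage (H : TriangleMove D D' a b X X') {x y : ℝ} (hne : x ≠ y)
    (h : D.curve x = D.curve y) : IsPassage a b X x := by
  by_cases hx : x ∈ strandTimes a b
  · obtain ⟨i, j, hij, hi, -⟩ := H.inner x y hx hne h
    exact Or.inr ⟨i, j, hij, hi⟩
  · exact Or.inl hx

lemma transfer_transfer (H : TriangleMove D D' a b X X') {t : ℝ} (ht : IsPassage a b X t) :
    transfer X' X (transfer X X' t) = t := by
  rcases ht with ht | ⟨i, j, hij, rfl⟩
  · rw [H.transfer_of_notMem ht, H.symm.transfer_of_notMem ht]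
  · rw [H.transfer_apply hij, H.symm.transfer_apply hij]

lemma transfer_mem_iff (H : TriangleMove D D' a b X X') {t : ℝ} (ht : IsPassage a b X t)
    (i : Fin 3) : transfer X X' t ∈ Set.Icc (a i) (b i) ↔ t ∈ Set.Icc (a i) (b i) := by
  rcases ht with ht | ⟨k, j, hkj, rfl⟩
  · rw [H.transfer_of_notMem ht]
  · rw [H.transfer_apply hkj]
    constructor
    · intro h
      rw [← H.eq_of_mem (H.mem' k j hkj) h]
      exact H.mem k j hkj
    · intro h
      rw [← H.eq_of_mem (H.mem k j hkj) h]
      exact H.mem' k j hkj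

lemma transfer_over (H : TriangleMove D D' a b X X') {x y : ℝ} (h : D.Over x y) :
    D'.Over (transfer X X' x) (transfer X X' y) := by
  by_cases hx : x ∈ strandTimes a b
  · obtain ⟨i, j, hij, rfl, rfl⟩ := H.inner x y hx h.ne h.curve_eq
    rw [H.transfer_apply hij, H.transfer_apply hij.symm, H.over_iff i j hij]
    exact h
  · have hy : y ∉ strandTimes a b := fun hy => hx ((H.agree.mem_iff x y h.curve_eq).2 hy)
    rw [H.transfer_of_notMem hx, H.transfer_of_notMem hy]
    exact (H.agree.over_iff hx).1 h

lemma lt_iff_of_mem_of_notMem (H : TriangleMove D D' a b X X') {t s : ℝ}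
    (ht : IsPassage a b X t) (hs : IsPassage a b X s) {i : Fin 3} (hti : t ∈ Set.Icc (a i) (b i))
    (hsi : s ∉ Set.Icc (a i) (b i)) :
    (transfer X X' t < transfer X X' s ↔ t < s) ∧ (transfer X X' s < transfer X X' t ↔ s < t) := by
  have h1 : transfer X X' t ∈ Set.Icc (a i) (b i) := (H.transfer_mem_iff ht i).2 hti
  have h2 : transfer X X' s ∉ Set.Icc (a i) (b i) := fun h => hsi ((H.transfer_mem_iff hs i).1 h)
  have e1 := lt_iff_of_mem_Icc _ h1 _ hti _ h2
  rw [e1.1, e1.2]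
  rcases hs with hs | ⟨j, k, hjk, rfl⟩
  · rw [H.transfer_of_notMem hs]
    exact ⟨Iff.rfl, Iff.rfl⟩
  · rw [H.transfer_apply hjk]
    have hji : j ≠ i := fun h => hsi (h ▸ H.mem j k hjk)
    have e2 := lt_iff_of_mem_Icc _ (H.mem' j k hjk) _ (H.mem j k hjk) t (H.notMem hji.symm hti)
    exact ⟨e2.1, e2.2⟩

/-- The strands occupy disjoint time intervals, so the move can exchange only two passages on the
same strand. -/
lemma lt_iff (H : TriangleMove D D' a b X X') {t s : ℝ}
    (ht : IsPassage a b X t) (hs : IsPassage a b X s)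
    (h : ∀ i, t ∈ Set.Icc (a i) (b i) → s ∈ Set.Icc (a i) (b i) → t = s) :
    transfer X X' t < transfer X X' s ↔ t < s := by
  by_cases hts : ∃ i, t ∈ Set.Icc (a i) (b i) ∧ s ∈ Set.Icc (a i) (b i)
  · obtain ⟨i, h1, h2⟩ := hts
    rw [h i h1 h2]
    simp
  · push Not at hts
    by_cases ht' : t ∈ strandTimes a b
    · obtain ⟨i, hi⟩ := ht'
      exact (H.lt_iff_of_mem_of_notMem ht hs hi (hts i hi)).1
    · by_cases hs' : s ∈ strandTimes a b
      · obtain ⟨i, hi⟩ := hs'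
        exact (H.lt_iff_of_mem_of_notMem hs ht hi fun h => hts i h hi).2
      · rw [H.transfer_of_notMem ht', H.transfer_of_notMem hs']

/-- The correspondence between the classical crossings of the two diagrams. -/
noncomputable def overEquiv (H : TriangleMove D D' a b X X') : D.OverPair ≃ D'.OverPair where
  toFun z := ⟨(transfer X X' z.1.1, transfer X X' z.1.2), H.transfer_over z.2⟩
  invFun z := ⟨(transfer X' X z.1.1, transfer X' X z.1.2), H.symm.transfer_over z.2⟩
  left_inv z := Subtype.ext (Prod.ext (H.transfer_transfer (H.isPassage z.2.ne z.2.curve_eq))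
    (H.transfer_transfer (H.isPassage z.2.ne.symm z.2.curve_eq.symm)))
  right_inv z := Subtype.ext (Prod.ext
    (H.symm.transfer_transfer (H.symm.isPassage z.2.ne z.2.curve_eq))
    (H.symm.transfer_transfer (H.symm.isPassage z.2.ne.symm z.2.curve_eq.symm)))

lemma overEquiv_apply (H : TriangleMove D D' a b X X') (z : D.OverPair) :
    (H.overEquiv z).1 = (transfer X X' z.1.1, transfer X X' z.1.2) := rfl

lemma pairWeight_eq (H : TriangleMove D D' a b X X') (z : D.OverPair) :
    D'.pairWeight (transfer X X' z.1.1) (transfer X X' z.1.2) = D.pairWeight z.1.1 z.1.2 := by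
  obtain ⟨⟨x, y⟩, h⟩ := z
  dsimp only at h ⊢
  by_cases hx : x ∈ strandTimes a b
  · obtain ⟨i, j, hij, rfl, rfl⟩ := H.inner x y hx h.ne h.curve_eq
    have e : transfer X X' (X i j) < transfer X X' (X j i) ↔ X i j < X j i :=
      H.lt_iff (Or.inr ⟨i, j, hij, rfl⟩) (Or.inr ⟨j, i, hij.symm, rfl⟩) fun k h1 h2 => by
        rw [← H.eq_of_mem (H.mem i j hij) h1] at h2
        exact absurd h2 (H.notMem hij.symm (H.mem j i hij.symm))
    unfold pairWeight
    rw [e, H.transfer_apply hij, H.transfer_apply hij.symm, H.jump_eq i j hij]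
  · have hy : y ∉ strandTimes a b := fun hy => hx ((H.agree.mem_iff x y h.curve_eq).2 hy)
    rw [H.transfer_of_notMem hx, H.transfer_of_notMem hy]
    exact (H.agree.pairWeight_eq hx h).symm

open Classical in
/-- The difference of the heights in terms of the three strands. -/
lemma height_sub (H : TriangleMove D D' a b X X') {t t' : ℝ}
    (ht : ∀ x, x ∉ strandTimes a b → (x < t ↔ x < t')) : D'.height t' - D.height t = ∑ p : Fin 3 × Fin 3,
      if p.1 ≠ p.2 ∧ D.Virt (X p.1 p.2) (X p.2 p.1) then
        ((if X' p.1 p.2 < t' then 1 else 0) - (if X p.1 p.2 < t then 1 else 0)) *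
          D.jump (X p.1 p.2) (X p.2 p.1) else 0 := by
  have key : ∀ {D D' : LongVirtualDiagram} {X X' : Fin 3 → Fin 3 → ℝ}
      (H : TriangleMove D D' a b X X'),
      ∀ z, z ∈ (Finset.univ.filter fun p : Fin 3 × Fin 3 =>
        p.1 ≠ p.2 ∧ D.Virt (X p.1 p.2) (X p.2 p.1)).image
          (fun p => (X p.1 p.2, X p.2 p.1)) ↔ D.Virt z.1 z.2 ∧ z.1 ∈ strandTimes a b := by
    rintro D D' X X' H ⟨x, y⟩
    simp only [Finset.mem_image, Finset.mem_filter, Finset.mem_univ, true_and, Prod.exists,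
      Prod.mk.injEq]
    constructor
    · rintro ⟨i, j, ⟨hij, hv⟩, rfl, rfl⟩
      exact ⟨hv, H.mem_strandTimes hij⟩
    · rintro ⟨hv, hx⟩
      obtain ⟨i, j, hij, rfl, rfl⟩ := H.inner x y hx hv.ne hv.curve_eq
      exact ⟨i, j, ⟨hij, hv⟩, rfl, rfl⟩
  have inj : ∀ {D D' : LongVirtualDiagram} {X X' : Fin 3 → Fin 3 → ℝ}
      (H : TriangleMove D D' a b X X') (f : ℝ × ℝ → ℤ),
      ∑ z ∈ (Finset.univ.filter fun p : Fin 3 × Fin 3 =>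
        p.1 ≠ p.2 ∧ D.Virt (X p.1 p.2) (X p.2 p.1)).image
          (fun p => (X p.1 p.2, X p.2 p.1)), f z =
      ∑ p : Fin 3 × Fin 3, if p.1 ≠ p.2 ∧ D.Virt (X p.1 p.2) (X p.2 p.1) then
        f (X p.1 p.2, X p.2 p.1) else 0 := by
    intro D D' X X' H f
    rw [Finset.sum_image, Finset.sum_filter]
    rintro ⟨i, j⟩ hp ⟨k, l⟩ hq h
    simp only [Finset.coe_filter, Finset.mem_univ, true_and, Set.mem_ofPred_eq] at hp hq
    obtain ⟨h1, h2⟩ := H.injective hp.1 hq.1 (congrArg Prod.fst h)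
    exact Prod.ext h1 h2
  have h := H.agree.height_sub (key H) (key H.symm) ht
  rw [inj H, inj H.symm] at h
  have h' : D'.height t' - D.height t =
      (∑ p : Fin 3 × Fin 3, if p.1 ≠ p.2 ∧ D'.Virt (X' p.1 p.2) (X' p.2 p.1) then
        D'.heightTerm t' (X' p.1 p.2, X' p.2 p.1) else 0) -
      ∑ p : Fin 3 × Fin 3, if p.1 ≠ p.2 ∧ D.Virt (X p.1 p.2) (X p.2 p.1) then
        D.heightTerm t (X p.1 p.2, X p.2 p.1) else 0 := by
    linarith
  rw [h', ← Finset.sum_sub_distrib]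
  refine Finset.sum_congr rfl fun p _ => ?_
  by_cases hp : p.1 ≠ p.2
  · rw [H.virt_iff p.1 p.2 hp]
    unfold heightTerm
    rw [H.jump_eq p.1 p.2 hp]
    split_ifs <;> simp
  · simp [hp]

lemma height_eq_of_notMem (H : TriangleMove D D' a b X X') {t : ℝ} (ht : t ∉ strandTimes a b) :
    D'.height t = D.height t := by
  classical
  have h := H.height_sub (t := t) fun x _ => Iff.rfl
  rw [Finset.sum_eq_zero] at h
  · linarith
  · rintro ⟨i, j⟩ -
    by_cases hij : i = j
    · simp [hij]
    · have := (lt_iff_of_mem_Icc _ (H.mem i j hij) _ (H.mem' i j hij) t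
        (fun h => ht ⟨i, h⟩)).2
      simp [this]

/-- Seen from the passage of `i` through `j`, the only other moving passage that changes sides is
the one of `i` through `k`. Passages on the other strands stay in disjoint intervals, and the
crossing with `j` itself is not virtual. -/
lemma height_sub_of_mem (H : TriangleMove D D' a b X X') {i j k : Fin 3} (hij : i ≠ j)
    (hik : i ≠ k) (hjk : j ≠ k) (hv : ¬ D.Virt (X i j) (X j i)) [Decidable (D.Virt (X i k) (X k i))] :
    D'.height (X' i j) - D.height (X i j) = if D.Virt (X i k) (X k i) then
      ((if X i j < X i k then 1 else 0) - (if X i k < X i j then 1 else 0)) *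
        D.jump (X i k) (X k i) else 0 := by
  classical
  rw [H.height_sub fun x hx => (lt_iff_of_mem_Icc _ (H.mem i j hij) _ (H.mem' i j hij) x
    fun h => hx ⟨i, h⟩).1, Finset.sum_eq_single (i, k)]
  · simp only [H.flip i k j hik hij, hik, ne_eq, not_false_eq_true, true_and]
  · rintro ⟨p, q⟩ - hpq
    by_cases hpi : p = i
    · subst hpi
      have hq : q = p ∨ q = j := by
        have hqk : q ≠ k := fun h => hpq (by rw [h])
        rcases Fin.three_eq_or_eq_or_eq hij hik hjk q with h | h | h
        exacts [Or.inl h, Or.inr h, absurd h hqk]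
      rcases hq with rfl | rfl
      · simp
      · simp [hv]
    · by_cases hpq' : p = q
      · simp [hpq']
      · have e1 := (lt_iff_of_mem_Icc _ (H.mem p q hpq') _ (H.mem' p q hpq') (X' i j)
          (H.notMem (Ne.symm hpi) (H.mem' i j hij))).2
        have e2 := (lt_iff_of_mem_Icc _ (H.mem i j hij) _ (H.mem' i j hij) (X p q)
          (H.notMem hpi (H.mem p q hpq'))).1
        simp [← e1, ← e2]
  · simp

/-- The exponents of the crossings are invariant, if both or none of the strands of each classical
crossing cross the third strand virtually. -/
lemma index_eq (H : TriangleMove D D' a b X X')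
    (hV : ∀ i j k, i ≠ j → i ≠ k → j ≠ k → D.Over (X i j) (X j i) →
      (D.Virt (X i k) (X k i) ↔ D.Virt (X j k) (X k j))) (z : D.OverPair) :
    D'.height (transfer X X' z.1.1) - D'.height (transfer X X' z.1.2) =
      D.height z.1.1 - D.height z.1.2 := by
  classical
  obtain ⟨⟨x, y⟩, h⟩ := z
  dsimp only at h ⊢
  by_cases hx : x ∈ strandTimes a b
  · obtain ⟨i, j, hij, rfl, rfl⟩ := H.inner x y hx h.ne h.curve_eq
    rw [H.transfer_apply hij, H.transfer_apply hij.symm]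
    obtain ⟨k, hik, hjk⟩ : ∃ k, i ≠ k ∧ j ≠ k := by
      clear hV h hx
      revert i j
      decide
    have h1 := H.height_sub_of_mem hij hik hjk h.not_virt
    have h2 := H.height_sub_of_mem hij.symm hjk hik (fun hv => h.not_virt hv.symm)
    have h3 := hV i j k hij hik hjk h
    have h4 := H.side i j k hij hik hjk
    have n1 := H.ne hij hik hjk
    have n2 := H.ne hij.symm hjk hik
    -- Both heights shift by the same amount: by `side`, the orders on the two strands agree exactly
    -- if the jumps at the strand `k` agree.
    suffices hs : D'.height (X' i j) - D.height (X i j) =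
        D'.height (X' j i) - D.height (X j i) by linarith
    rw [h1, h2]
    by_cases hv : D.Virt (X i k) (X k i)
    · have hv' := h3.1 hv
      rw [if_pos hv, if_pos hv']
      have j1 := D.jump_eq_one_or hv.ne hv.curve_eq
      have j2 := D.jump_eq_one_or hv'.ne hv'.curve_eq
      rcases lt_or_gt_of_ne n1 with l1 | l1 <;> rcases lt_or_gt_of_ne n2 with l2 | l2 <;>
        simp only [l1, l2, l1.not_gt, l2.not_gt, if_true, if_false, true_iff, iff_true, iff_false,
          false_iff, not_true, not_false_iff] at h4 ⊢ <;>
        rcases j1 with j1 | j1 <;> rcases j2 with j2 | j2 <;> rw [j1, j2] at h4 ⊢ <;>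
        simp at h4 ⊢
    · rw [if_neg hv, if_neg fun hv' => hv (h3.2 hv')]
  · have hy : y ∉ strandTimes a b := fun hy => hx ((H.agree.mem_iff x y h.curve_eq).2 hy)
    rw [H.transfer_of_notMem hx, H.transfer_of_notMem hy, H.height_eq_of_notMem hx,
      H.height_eq_of_notMem hy]

/-- A strand with only virtual crossings passes a classical or virtual crossing. -/
theorem det_eq_of_virtual (H : TriangleMove D D' a b X X') (k : Fin 3)
    (hk : ∀ i, i ≠ k → D.Virt (X i k) (X k i)) : D'.overMatrix.det = D.overMatrix.det := by
  have hV : ∀ i j l, i ≠ j → i ≠ l → j ≠ l → D.Over (X i j) (X j i) →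
      (D.Virt (X i l) (X l i) ↔ D.Virt (X j l) (X l j)) := by
    intro i j l hij hil hjl ho
    have hik : i ≠ k := by rintro rfl; exact ho.not_virt (hk j hij.symm).symm
    have hjk : j ≠ k := by rintro rfl; exact ho.not_virt (hk i hij)
    have hl : l = k := by
      rcases Fin.three_eq_or_eq_or_eq hij hil hjl k with h | h | h
      exacts [absurd h.symm hik, absurd h.symm hjk, h.symm]
    subst hl
    exact iff_of_true (hk i hik) (hk j hjk)
  -- Each strand has at most one classical passage in the disc, since at least one of its two
  -- crossings there involves `k`. So no two classical passages are exchanged.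
  have hsame : ∀ {i j l : Fin 3}, i ≠ j → i ≠ l → (D.Over (X i j) (X j i) ∨ D.Over (X j i) (X i j)) →
      (D.Over (X i l) (X l i) ∨ D.Over (X l i) (X i l)) → X i j = X i l := by
    intro i j l hij hil h1 h2
    by_cases hjl : j = l
    · rw [hjl]
    exfalso
    have h3 : ∀ {p q}, (D.Over (X p q) (X q p) ∨ D.Over (X q p) (X p q)) →
        ¬ D.Virt (X p q) (X q p) := by
      rintro p q (h | h) hv
      · exact h.not_virt hv
      · exact h.not_virt hv.symm
    have hk' : i = k ∨ j = k ∨ l = k := by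
      simpa only [eq_comm] using Fin.three_eq_or_eq_or_eq hij hil hjl k
    rcases hk' with rfl | rfl | rfl
    · exact h3 h1 (hk j hij.symm).symm
    · exact h3 h1 (hk i hij)
    · exact h3 h2 (hk i hil)
  have hin : ∀ {x y : ℝ}, D.Over x y ∨ D.Over y x → ∀ {i}, x ∈ Set.Icc (a i) (b i) →
      ∃ j, i ≠ j ∧ x = X i j ∧ y = X j i ∧ (D.Over (X i j) (X j i) ∨ D.Over (X j i) (X i j)) := by
    intro x y ho i hi
    have hne : x ≠ y := by
      rcases ho with h | h
      · exact h.ne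
      · exact h.ne.symm
    have hc : D.curve x = D.curve y := by
      rcases ho with h | h
      · exact h.curve_eq
      · exact h.curve_eq.symm
    obtain ⟨p, q, hpq, rfl, rfl⟩ := H.inner x y ⟨i, hi⟩ hne hc
    obtain rfl := H.eq_of_mem (H.mem p q hpq) hi
    exact ⟨q, hpq, rfl, rfl, ho⟩
  have hsame' : ∀ {x y x' y' : ℝ}, D.Over x y ∨ D.Over y x → D.Over x' y' ∨ D.Over y' x' →
      ∀ i, x ∈ Set.Icc (a i) (b i) → x' ∈ Set.Icc (a i) (b i) → x = x' := by
    intro x y x' y' h h' i hi hi'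
    obtain ⟨j, hij, rfl, rfl, h1⟩ := hin h hi
    obtain ⟨l, hil, rfl, rfl, h2⟩ := hin h' hi'
    exact hsame hij hil h1 h2
  unfold overMatrix
  refine det_pairMatrix_congr H.overEquiv _ _ _ _ _ _ _ _ ?_ ?_ ?_ ?_
  · intro v w
    simp only [H.overEquiv_apply]
    exact H.lt_iff (H.isPassage w.2.ne.symm w.2.curve_eq.symm)
      (H.isPassage v.2.ne.symm v.2.curve_eq.symm) (hsame' (Or.inr w.2) (Or.inr v.2))
  · intro v w
    simp only [H.overEquiv_apply]
    exact H.lt_iff (H.isPassage w.2.ne.symm w.2.curve_eq.symm)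
      (H.isPassage v.2.ne v.2.curve_eq) (hsame' (Or.inr w.2) (Or.inl v.2))
  · intro v
    simp only [H.overEquiv_apply]
    rw [H.pairWeight_eq]
  · intro v
    simp only [H.overEquiv_apply]
    rw [H.index_eq hV]

end TriangleMove

end LongVirtualDiagram

/-! ### The classical third Reidemeister move. -/

namespace LongVirtualDiagram

namespace TriangleMove

variable {D D' : LongVirtualDiagram} {a b : Fin 3 → ℝ} {X X' : Fin 3 → Fin 3 → ℝ}

/-- Here `i`, `j`, `k` are the upper, middle and lower strand, and `hlt` fixes the order on the
lower one. The other order is the same move read backwards. -/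
lemma det_eq_of_over_of_lt (H : TriangleMove D D' a b X X') {i j k : Fin 3} (hij : i ≠ j)
    (hik : i ≠ k) (hjk : j ≠ k) (oij : D.Over (X i j) (X j i)) (oik : D.Over (X i k) (X k i))
    (ojk : D.Over (X j k) (X k j)) (hlt : X k j < X k i) :
    D'.overMatrix.det = D.overMatrix.det := by
  have hnv : ∀ p q, p ≠ q → ¬ D.Virt (X p q) (X q p) := by
    intro p q hpq hv
    rcases Fin.three_eq_or_eq_or_eq hij hik hjk p with rfl | rfl | rfl <;>
      rcases Fin.three_eq_or_eq_or_eq hij hik hjk q with rfl | rfl | rfl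
    exacts [hpq rfl, oij.not_virt hv, oik.not_virt hv, oij.not_virt hv.symm, hpq rfl,
      ojk.not_virt hv, oik.not_virt hv.symm, ojk.not_virt hv.symm, hpq rfl]
  have hVI : ∀ x y, D.Virt x y → x ∉ strandTimes a b := by
    intro x y hv hx
    obtain ⟨p, q, hpq, rfl, rfl⟩ := H.inner x y hx hv.ne hv.curve_eq
    exact hnv p q hpq hv
  have hin : ∀ x y, D.Over x y → x ∈ strandTimes a b →
      x = X i j ∧ y = X j i ∨ x = X i k ∧ y = X k i ∨ x = X j k ∧ y = X k j := by
    intro x y ho hx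
    obtain ⟨p, q, hpq, rfl, rfl⟩ := H.inner x y hx ho.ne ho.curve_eq
    rcases Fin.three_eq_or_eq_or_eq hij hik hjk p with rfl | rfl | rfl <;>
      rcases Fin.three_eq_or_eq_or_eq hij hik hjk q with rfl | rfl | rfl
    · exact absurd rfl hpq
    · exact Or.inl ⟨rfl, rfl⟩
    · exact Or.inr (Or.inl ⟨rfl, rfl⟩)
    · exact absurd ho oij.not_over
    · exact absurd rfl hpq
    · exact Or.inr (Or.inr ⟨rfl, rfl⟩)
    · exact absurd ho oik.not_over
    · exact absurd ho ojk.not_over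
    · exact absurd rfl hpq
  -- There are no virtual passages on the three strands, so the height is constant along each; this
  -- makes the exponents at the three crossings additive.
  have hheight : ∀ p {x y}, x ∈ Set.Icc (a p) (b p) → y ∈ Set.Icc (a p) (b p) →
      D.height x = D.height y := by
    intro p x y hx hy
    exact height_eq_of_forall_virt fun s _ hv =>
      (lt_iff_of_mem_Icc _ hx _ hy s fun h => hVI _ _ hv ⟨p, h⟩).1
  let vij : D.OverPair := ⟨(X i j, X j i), oij⟩
  let vik : D.OverPair := ⟨(X i k, X k i), oik⟩
  let vjk : D.OverPair := ⟨(X j k, X k j), ojk⟩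
  have mij := H.mem i j hij
  have mik := H.mem i k hik
  have mji := H.mem j i hij.symm
  have mjk := H.mem j k hjk
  have mki := H.mem k i hik.symm
  have mkj := H.mem k j hjk.symm
  have hmem : ∀ (v : D.OverPair) (p : Fin 3), v.1.1 ∈ Set.Icc (a p) (b p) ∨
      v.1.2 ∈ Set.Icc (a p) (b p) → v = vij ∨ v = vik ∨ v = vjk := by
    intro v p hp
    have hv : v.1.1 ∈ strandTimes a b := by
      rcases hp with hp | hp
      · exact ⟨p, hp⟩
      · exact (H.agree.mem_iff _ _ v.2.curve_eq).2 ⟨p, hp⟩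
    rcases hin _ _ v.2 hv with ⟨e1, e2⟩ | ⟨e1, e2⟩ | ⟨e1, e2⟩
    · exact Or.inl (Subtype.ext (Prod.ext e1 e2))
    · exact Or.inr (Or.inl (Subtype.ext (Prod.ext e1 e2)))
    · exact Or.inr (Or.inr (Subtype.ext (Prod.ext e1 e2)))
  have hui : ∀ v : D.OverPair, v.1.2 ∉ Set.Icc (a i) (b i) := by
    intro v hv
    rcases hmem v i (Or.inr hv) with rfl | rfl | rfl
    exacts [hij.symm (H.eq_of_mem mji hv), hik.symm (H.eq_of_mem mki hv),
      hik.symm (H.eq_of_mem mkj hv)]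
  have huj : ∀ v : D.OverPair, v ≠ vij → v.1.2 ∉ Set.Icc (a j) (b j) := by
    intro v hne hv
    rcases hmem v j (Or.inr hv) with rfl | rfl | rfl
    exacts [hne rfl, hjk.symm (H.eq_of_mem mki hv), hjk.symm (H.eq_of_mem mkj hv)]
  have huk : ∀ v : D.OverPair, v ≠ vik → v ≠ vjk → v.1.2 ∉ Set.Icc (a k) (b k) := by
    intro v hne hne' hv
    rcases hmem v k (Or.inr hv) with rfl | rfl | rfl
    exacts [hjk (H.eq_of_mem mji hv), hne rfl, hne' rfl]
  have hok : ∀ v : D.OverPair, v.1.1 ∉ Set.Icc (a k) (b k) := by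
    intro v hv
    rcases hmem v k (Or.inl hv) with rfl | rfl | rfl
    exacts [hik (H.eq_of_mem mij hv), hik (H.eq_of_mem mik hv), hjk (H.eq_of_mem mjk hv)]
  have hoj : ∀ v : D.OverPair, v ≠ vjk → v.1.1 ∉ Set.Icc (a j) (b j) := by
    intro v hne hv
    rcases hmem v j (Or.inl hv) with rfl | rfl | rfl
    exacts [hij (H.eq_of_mem mij hv), hij (H.eq_of_mem mik hv), hne rfl]
  have hab : vij ≠ vik := fun h => H.ne hij hik hjk (congrArg (fun v : D.OverPair => v.1.1) h)
  have hac : vij ≠ vjk := fun h => by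
    have e : X i j = X j k := congrArg (fun v : D.OverPair => v.1.1) h
    exact H.notMem hij mij (e ▸ mjk)
  have hbc : vik ≠ vjk := fun h => by
    have e : X i k = X j k := congrArg (fun v : D.OverPair => v.1.1) h
    exact H.notMem hij mik (e ▸ mjk)
  have hPu : ∀ v : D.OverPair, IsPassage a b X v.1.2 :=
    fun v => H.isPassage v.2.ne.symm v.2.curve_eq.symm
  have hPo : ∀ v : D.OverPair, IsPassage a b X v.1.1 := fun v => H.isPassage v.2.ne v.2.curve_eq
  have hnji := H.ne hij.symm hjk hik
  have hside := H.side k j i hjk.symm hik.symm hij.symm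
  have jne : ∀ p q, p ≠ q → D.jump (X p q) (X q p) = 1 ∨ D.jump (X p q) (X q p) = -1 := by
    intro p q hpq
    have : X p q ≠ X q p := fun h => H.notMem hpq (H.mem p q hpq) (h ▸ H.mem q p hpq.symm)
    exact D.jump_eq_one_or this (H.curve_eq p q hpq)
  have hW : ∀ z : D.OverPair, D'.pairWeight (H.overEquiv z).1.1 (H.overEquiv z).1.2 =
      D.pairWeight z.1.1 z.1.2 := fun z => H.pairWeight_eq z
  have hS : ∀ z : D.OverPair, D'.height (H.overEquiv z).1.1 - D'.height (H.overEquiv z).1.2 =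
      D.height z.1.1 - D.height z.1.2 := fun z => H.index_eq (fun p q l hpq hpl hql _ =>
        iff_of_false (hnv p l hpl) (hnv q l hql)) z
  have h1 : D'.overMatrix.det = (pairMatrix (fun z : D.OverPair => transfer X X' z.1.2)
      (fun z => transfer X X' z.1.1) (fun z => LaurentPolynomial.C (D.pairWeight z.1.1 z.1.2))
      (fun z => LaurentPolynomial.T (D.height z.1.1 - D.height z.1.2))).det :=
    det_pairMatrix_congr (R := LaurentPolynomial ZetaRing) H.overEquiv _ _ _ _ _ _ _ _
      (fun _ _ => Iff.rfl) (fun _ _ => Iff.rfl)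
      (fun z => by rw [hW]) (fun z => by rw [hS])
  rw [h1]
  symm
  unfold overMatrix
  refine det_pairMatrix_of_triangle _ _ _ _ _ _ hab hac hbc ?_ ?_ ?_ hlt ?_ ?_ ?_ ?_ ?_ ?_ ?_ ?_ ?_
  · rw [← LaurentPolynomial.T_add]
    congr 1
    change D.height (X i k) - D.height (X k i) = D.height (X i j) - D.height (X j i) +
      (D.height (X j k) - D.height (X k j))
    rw [hheight i mik mij, hheight k mki mkj, hheight j mji mjk]
    ring
  · intro w v hw hv
    refine H.lt_iff (hPu w) (hPu v) fun p h h' => ?_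
    rcases hmem w p (Or.inr h) with rfl | rfl | rfl
    · obtain rfl := H.eq_of_mem mji h
      by_contra hc
      exact huj v (fun e => hc (by rw [e])) h'
    · obtain rfl := H.eq_of_mem mki h
      by_contra hc
      exact huk v (fun e => hc (by rw [e])) (fun e => hw ⟨rfl, e⟩) h'
    · obtain rfl := H.eq_of_mem mkj h
      by_contra hc
      exact huk v (fun e => hv ⟨rfl, e⟩) (fun e => hc (by rw [e])) h'
  · intro w v hw
    refine H.lt_iff (hPu w) (hPo v) fun p h h' => ?_
    rcases hmem w p (Or.inr h) with rfl | rfl | rfl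
    · obtain rfl := H.eq_of_mem mji h
      exact absurd h' (hoj v fun e => hw ⟨rfl, e⟩)
    · obtain rfl := H.eq_of_mem mki h
      exact absurd h' (hok v)
    · obtain rfl := H.eq_of_mem mkj h
      exact absurd h' (hok v)
  · change transfer X X' (X k i) < transfer X X' (X k j)
    rw [H.transfer_apply hik.symm, H.transfer_apply hjk.symm, H.flip k i j hik.symm hjk.symm]
    exact hlt
  · change transfer X X' (X j i) < transfer X X' (X j k) ↔ ¬ X j i < X j k
    rw [H.transfer_apply hij.symm, H.transfer_apply hjk, H.flip j i k hij.symm hjk, not_lt,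
      le_iff_lt_or_eq]
    simp [hnji.symm]
  · exact fun v h h' => (lt_iff_of_mem_Icc _ mki _ mkj _ (huk v h h')).2
  · exact fun v => (lt_iff_of_mem_Icc _ mki _ mkj _ (hok v)).2
  · exact fun v h h' => (lt_iff_of_mem_Icc _ mki _ mkj _ (huk v h h')).1
  · exact fun v => (lt_iff_of_mem_Icc _ mij _ mik _ (hui v)).1
  · exact fun v h => (lt_iff_of_mem_Icc _ mjk _ mji _ (huj v h)).1
  -- The middle and lower strands cross the upper one in the same direction, so the two weights have
  -- the same exponent and differ at most by `p` against `q`. The defining relations of `ZetaRing`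
  -- remove this difference.
  · intro hn
    have hn' : X j k < X j i := lt_of_le_of_ne (not_lt.1 hn) hnji.symm
    have hj : D.jump (X k i) (X i k) = D.jump (X j i) (X i j) :=
      hside.1 (iff_of_true hlt hn')
    have hj' : D.jump (X i k) (X k i) = D.jump (X i j) (X j i) := by
      rw [D.jump_swap (X k i), D.jump_swap (X j i), hj]
    change (LaurentPolynomial.C (D.pairWeight (X j k) (X k j)) - 1) *
      (LaurentPolynomial.C (D.pairWeight (X i k) (X k i)) -
        LaurentPolynomial.C (D.pairWeight (X i j) (X j i))) = 0
    rw [← map_one (LaurentPolynomial.C : ZetaRing →+* _), ← map_sub, ← map_sub, ← map_mul]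
    unfold pairWeight
    rw [hj', ZetaRing.power_sub_one_mul_power_sub_power (jne j k hjk) (jne i j hij), map_zero]
  -- Now the directions are opposite, and the product of the two weights takes the place of their
  -- difference.
  · intro hn
    change X j i < X j k at hn
    have hj : D.jump (X k i) (X i k) ≠ D.jump (X j i) (X i j) :=
      fun h => hn.not_gt ((hside.2 h).1 hlt)
    have hj' : D.jump (X i k) (X k i) = - D.jump (X i j) (X j i) := by
      have e1 := D.jump_swap (X k i) (X i k)
      have e2 := D.jump_swap (X j i) (X i j)
      rcases jne i k hik with h | h <;> rcases jne i j hij with h' | h' <;> omega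
    change (LaurentPolynomial.C (D.pairWeight (X j k) (X k j)) - 1) *
      (LaurentPolynomial.C (D.pairWeight (X i j) (X j i)) *
        LaurentPolynomial.C (D.pairWeight (X i k) (X k i)) - 1) = 0
    rw [← map_one (LaurentPolynomial.C : ZetaRing →+* _), ← map_sub, ← map_mul, ← map_sub,
      ← map_mul]
    unfold pairWeight
    rw [hj', ZetaRing.power_sub_one_mul_power_mul_power_sub_one (jne j k hjk) (jne i j hij),
      map_zero]

/-- Three strands at three different heights. -/
theorem det_eq_of_over (H : TriangleMove D D' a b X X') {i j k : Fin 3} (hij : i ≠ j)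
    (hik : i ≠ k) (hjk : j ≠ k) (oij : D.Over (X i j) (X j i)) (oik : D.Over (X i k) (X k i))
    (ojk : D.Over (X j k) (X k j)) : D'.overMatrix.det = D.overMatrix.det := by
  rcases lt_or_gt_of_ne (H.ne hjk.symm hik.symm hij.symm) with h | h
  · exact H.det_eq_of_over_of_lt hij hik hjk oij oik ojk h
  · exact (H.symm.det_eq_of_over_of_lt hij hik hjk ((H.over_iff i j hij).2 oij)
      ((H.over_iff i k hik).2 oik) ((H.over_iff j k hjk).2 ojk)
      ((H.flip k j i hjk.symm hik.symm).2 h)).symm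

end TriangleMove

/-! ## Three straight strands -/

/-- The parameter at which the line `t ↦ p i + t • d i` meets the line `t ↦ p j + t • d j`. -/
noncomputable def meetingParam (p d : Fin 3 → Plane) (i j : Fin 3) : ℝ :=
  Plane.cross (p j - p i) (d j) / Plane.cross (d i) (d j)

variable {p d : Fin 3 → Plane}

lemma eq_meetingParam {i j : Fin 3} (h : Plane.cross (d i) (d j) ≠ 0) {s t : ℝ}
    (hst : p i + s • d i = p j + t • d j) : s = meetingParam p d i j := by
  have e0 := congrArg (fun v : Plane => v 0) hst
  have e1 := congrArg (fun v : Plane => v 1) hst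
  simp only [PiLp.add_apply, PiLp.smul_apply, smul_eq_mul] at e0 e1
  rw [meetingParam, eq_div_iff h]
  simp only [Plane.cross, PiLp.sub_apply]
  linear_combination d j 1 * e0 - d j 0 * e1

/-- The point of intersection of two lines lies on a definite side of a third line. -/
lemma meetingParam_sub_mul {i j k : Fin 3} (hik : Plane.cross (d i) (d k) ≠ 0)
    (hjk : Plane.cross (d j) (d k) ≠ 0) {s t : ℝ} (hst : p i + s • d i = p j + t • d j) :
    (s - meetingParam p d i k) * Plane.cross (d i) (d k) =
      (t - meetingParam p d j k) * Plane.cross (d j) (d k) := by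
  have e0 := congrArg (fun v : Plane => v 0) hst
  have e1 := congrArg (fun v : Plane => v 1) hst
  simp only [PiLp.add_apply, PiLp.smul_apply, smul_eq_mul] at e0 e1
  rw [meetingParam, meetingParam, sub_mul, sub_mul, div_mul_cancel₀ _ hik, div_mul_cancel₀ _ hjk]
  simp only [Plane.cross, PiLp.sub_apply]
  linear_combination d k 1 * e0 - d k 0 * e1

/-- The second triangle consists of the same directions through the reflected points, so meeting
parameters change sign. This reverses the order on every strand while keeping all signs. -/
lemma meetingParam_neg (i j : Fin 3) :
    meetingParam (fun i => -p i) d i j = - meetingParam p d i j := by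
  unfold meetingParam
  rw [← neg_div]
  congr 1
  simp only [Plane.cross, PiLp.sub_apply, PiLp.neg_apply]
  ring

variable {D D' : LongVirtualDiagram} {r : ℝ} {a b : Fin 3 → ℝ}

lemma HasPicture.exists_meeting {v : Fin 3 → ℝ → Plane} {θ : Fin 3 → ℝ → ℝ}
    (H : HasPicture D r a b (fun i t => p i + t • d i) v θ)
    (hI : ∀ x y, D.curve x = D.curve y → (x ∈ strandTimes a b ↔ y ∈ strandTimes a b))
    (hd : ∀ i j, i ≠ j → Plane.cross (d i) (d j) ≠ 0)
    (hmeet : ∀ i j, i ≠ j →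
      p i + meetingParam p d i j • d i = p j + meetingParam p d j i • d j ∧
        ‖p i + meetingParam p d i j • d i‖ ≤ r) :
    ∃ X : Fin 3 → Fin 3 → ℝ, (∀ i j, i ≠ j → X i j ∈ Set.Icc (a i) (b i)) ∧
      (∀ i j, i ≠ j → θ i (X i j) = meetingParam p d i j) ∧
      (∀ i j, i ≠ j → D.curve (X i j) = D.curve (X j i)) ∧
      (∀ x y, x ∈ strandTimes a b → x ≠ y → D.curve x = D.curve y →
        ∃ i j, i ≠ j ∧ x = X i j ∧ y = X j i) := by
  have hex : ∀ i j, ∃ x, i ≠ j → x ∈ Set.Icc (a i) (b i) ∧ θ i x = meetingParam p d i j := by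
    intro i j
    by_cases hij : i = j
    · exact ⟨0, fun h => absurd hij h⟩
    · obtain ⟨x, hx, hx'⟩ := H.exists_time i (meetingParam p d i j) (hmeet i j hij).2
      exact ⟨x, fun _ => ⟨hx, hx'⟩⟩
  choose X hX using hex
  refine ⟨X, fun i j h => (hX i j h).1, fun i j h => (hX i j h).2, ?_, ?_⟩
  · intro i j h
    rw [H.curve_eq_iff i j _ (hX i j h).1 _ (hX j i h.symm).1, (hX i j h).2, (hX j i h.symm).2]
    exact (hmeet i j h).1
  · intro x y hx hne heq
    obtain ⟨j, hy⟩ := (hI x y heq).1 hx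
    obtain ⟨i, hx⟩ := hx
    have e := (H.curve_eq_iff i j x hx y hy).1 heq
    have hij : i ≠ j := by
      rintro rfl
      have hdi : d i ≠ 0 := by
        intro h0
        obtain ⟨j, hj⟩ := exists_ne i
        exact hd i j hj.symm (by simp [h0, Plane.cross])
      have e' := smul_left_injective ℝ hdi (add_left_cancel e)
      exact hne ((H.strictMono i).injective e')
    refine ⟨i, j, hij, (H.strictMono i).injective ?_, (H.strictMono j).injective ?_⟩
    · rw [(hX i j hij).2]
      exact eq_meetingParam (hd i j hij) e
    · rw [(hX j i hij.symm).2]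
      exact eq_meetingParam (hd j i hij.symm) e.symm

theorem Move3.crossingDet_eq (H : Move3 D D') : D'.crossingDet = D.crossingDet := by
  obtain ⟨a, b, r, p, d, P, hd, hmeet, H, hP, hP', hpat⟩ := H
  have hlin : ∀ (q e : Plane) (u : ℝ), HasDerivAt (fun t : ℝ => q + t • e) e u := by
    intro q e u
    simpa using ((hasDerivAt_id' u).smul_const e).const_add q
  obtain ⟨⟨θ, hθ⟩, θ', hθ'⟩ := H.exists_hasPicture (v := fun i _ => d i) (v' := fun i _ => d i)
    (fun i u => hlin (p i) (d i) u) (fun i u => hlin (-p i) (d i) u)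
  have HA := H.agreeOutside
  have hdisj : ∀ i j, i ≠ j → Disjoint (Set.Icc (a i) (b i)) (Set.Icc (a j) (b j)) := H.2.2.1
  have hm : ∀ i j, i ≠ j →
      p i + meetingParam p d i j • d i = p j + meetingParam p d j i • d j ∧
        ‖p i + meetingParam p d i j • d i‖ ≤ r := by
    intro i j hij
    obtain ⟨s, t, hst, hn⟩ := hmeet i j hij
    rw [← eq_meetingParam (hd i j hij) hst, ← eq_meetingParam (hd j i hij.symm) hst.symm]
    exact ⟨hst, hn.le⟩
  have hm' : ∀ i j, i ≠ j →
      (fun i => -p i) i + meetingParam (fun i => -p i) d i j • d i =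
        (fun i => -p i) j + meetingParam (fun i => -p i) d j i • d j ∧
        ‖(fun i => -p i) i + meetingParam (fun i => -p i) d i j • d i‖ ≤ r := by
    intro i j hij
    obtain ⟨h1, h2⟩ := hm i j hij
    dsimp only
    rw [meetingParam_neg, meetingParam_neg, neg_smul, neg_smul, ← neg_add, ← neg_add, norm_neg, h1]
    exact ⟨rfl, by rw [← h1]; exact h2⟩
  obtain ⟨X, hX, hXθ, hXc, hXin⟩ := hθ.exists_meeting HA.mem_iff hd hm
  obtain ⟨X', hX', hXθ', hXc', hXin'⟩ := hθ'.exists_meeting (p := fun i => -p i) HA.mem_iff' hd hm'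
  have hnot : ∀ {i j t}, i ≠ j → t ∈ Set.Icc (a i) (b i) → t ∉ Set.Icc (a j) (b j) :=
    fun hij h h' => Set.disjoint_left.1 (hdisj _ _ hij) h h'
  have hlt : ∀ i j, i ≠ j → (X' i j < X' j i ↔ X i j < X j i) := by
    intro i j hij
    rw [(lt_iff_of_mem_Icc _ (hX' i j hij) _ (hX i j hij) _ (hnot hij.symm (hX' j i hij.symm))).2,
      (lt_iff_of_mem_Icc _ (hX' j i hij.symm) _ (hX j i hij.symm) _ (hnot hij (hX i j hij))).1]
  have hkind : ∀ i j k, i ≠ j → (D'.HasKind (X' i j) (X' j i) k ↔ D.HasKind (X i j) (X j i) k) := by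
    intro i j k hij
    constructor
    · intro h
      obtain ⟨k', hk'⟩ := exists_hasKind ((hlt i j hij).1 h.lt) (hXc i j hij)
      rw [hP'.eq_of_hasKind h (hX' i j hij) (hX' j i hij.symm),
        ← hP.eq_of_hasKind hk' (hX i j hij) (hX j i hij.symm)]
      exact hk'
    · intro h
      obtain ⟨k', hk'⟩ := exists_hasKind ((hlt i j hij).2 h.lt) (hXc' i j hij)
      rw [hP.eq_of_hasKind h (hX i j hij) (hX j i hij.symm),
        ← hP'.eq_of_hasKind hk' (hX' i j hij) (hX' j i hij.symm)]
      exact hk'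
  have hjump : ∀ i j, i ≠ j →
      D.jump (X i j) (X j i) = (SignType.sign (Plane.cross (d i) (d j)) : ℤ) := fun i j hij =>
    hθ.jump_eq i j _ (hX i j hij) _ (hX j i hij.symm) (hXc i j hij)
  have hjump' : ∀ i j, i ≠ j →
      D'.jump (X' i j) (X' j i) = (SignType.sign (Plane.cross (d i) (d j)) : ℤ) := fun i j hij =>
    hθ'.jump_eq i j _ (hX' i j hij) _ (hX' j i hij.symm) (hXc' i j hij)
  have hXlt : ∀ i j k, i ≠ j → i ≠ k →
      (X i j < X i k ↔ meetingParam p d i j < meetingParam p d i k) := by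
    intro i j k hij hik
    rw [← hXθ i j hij, ← hXθ i k hik, (hθ.strictMono i).lt_iff_lt]
  have hne : ∀ i j k, i ≠ j → i ≠ k → j ≠ k →
      meetingParam p d i j ≠ meetingParam p d i k := by
    intro i j k hij hik hjk h
    rw [← hXθ i j hij, ← hXθ i k hik] at h
    have h := (hθ.strictMono i).injective h
    have h1 := hXc i j hij
    have h2 := hXc i k hik
    rw [← h] at h2
    have n1 : X i j ≠ X j i := fun h => hnot hij (hX i j hij) (h ▸ hX j i hij.symm)
    have n2 : X i j ≠ X k i := fun h => hnot hik (hX i j hij) (h ▸ hX k i hik.symm)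
    exact hnot hjk (hX j i hij.symm) (eq_of_curve_eq h1 h2 n1 n2 ▸ hX k i hik.symm)
  have HT : TriangleMove D D' a b X X' :=
    { agree := HA
      disj := hdisj
      mem := hX
      mem' := hX'
      curve_eq := hXc
      curve_eq' := hXc'
      inner := hXin
      inner' := hXin'
      flip := by
        intro i j k hij hik
        rw [hXlt i k j hik hij, ← (hθ'.strictMono i).lt_iff_lt, hXθ' i j hij, hXθ' i k hik,
          meetingParam_neg, meetingParam_neg, neg_lt_neg_iff]
      jump_eq := fun i j hij => (hjump' i j hij).trans (hjump i j hij).symm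
      side := by
        intro i j k hij hik hjk
        rw [hXlt i j k hij hik, hXlt j i k hij.symm hjk, hjump i k hik, hjump j k hjk]
        -- Only signs matter: of the sixteen sign patterns of the two parameter differences and the
        -- two cross products, those contradicting `key` are excluded, and the rest satisfy the
        -- claim.
        have key := meetingParam_sub_mul (hd i k hik) (hd j k hjk) (hm i j hij).1
        have n1 := hne i j k hij hik hjk
        have n2 := hne j i k hij.symm hjk hik
        have c1 := hd i k hik
        have c2 := hd j k hjk
        generalize Plane.cross (d i) (d k) = e1 at *
        generalize Plane.cross (d j) (d k) = e2 at *
        rw [← sub_neg, ← sub_neg (a := meetingParam p d j i)]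
        have n1' := sub_ne_zero.2 n1
        have n2' := sub_ne_zero.2 n2
        generalize meetingParam p d i j - meetingParam p d i k = s at *
        generalize meetingParam p d j i - meetingParam p d j k = t at *
        have hs : ∀ e : ℝ, e ≠ 0 →
            (e < 0 ∧ SignType.sign e = -1) ∨ (0 < e ∧ SignType.sign e = 1) := fun e he =>
          (lt_or_gt_of_ne he).imp (fun h => ⟨h, sign_neg h⟩) fun h => ⟨h, sign_pos h⟩
        have nn : ∀ x y : ℝ, x < 0 → y < 0 → 0 < x * y := fun x y => mul_pos_of_neg_of_neg
        have np : ∀ x y : ℝ, x < 0 → 0 < y → x * y < 0 := fun x y => mul_neg_of_neg_of_pos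
        have pn : ∀ x y : ℝ, 0 < x → y < 0 → x * y < 0 := fun x y => mul_neg_of_pos_of_neg
        have pp : ∀ x y : ℝ, 0 < x → 0 < y → 0 < x * y := fun x y => mul_pos
        rcases hs s n1' with ⟨h1, -⟩ | ⟨h1, -⟩ <;> rcases hs t n2' with ⟨h2, -⟩ | ⟨h2, -⟩ <;>
          rcases hs e1 c1 with ⟨h3, s3⟩ | ⟨h3, s3⟩ <;>
          rcases hs e2 c2 with ⟨h4, s4⟩ | ⟨h4, s4⟩ <;>
          simp only [h1, h2, h1.not_gt, h2.not_gt, s3, s4] <;>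
          first
            | decide
            | (exfalso
               first
                 | linarith [nn s e1 h1 h3, np t e2 h2 h4]
                 | linarith [nn s e1 h1 h3, pn t e2 h2 h4]
                 | linarith [pp s e1 h1 h3, np t e2 h2 h4]
                 | linarith [pp s e1 h1 h3, pn t e2 h2 h4]
                 | linarith [np s e1 h1 h3, nn t e2 h2 h4]
                 | linarith [np s e1 h1 h3, pp t e2 h2 h4]
                 | linarith [pn s e1 h1 h3, nn t e2 h2 h4]
                 | linarith [pn s e1 h1 h3, pp t e2 h2 h4])
      over_iff := by
        intro i j hij
        unfold Over
        rw [hkind i j _ hij, hkind j i _ hij.symm]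
      virt_iff := by
        intro i j hij
        unfold Virt
        rw [hkind i j _ hij, hkind j i _ hij.symm] }
  have hXne : ∀ i j, i ≠ j → X i j ≠ X j i := fun i j hij h =>
    hnot hij (hX i j hij) (h ▸ hX j i hij.symm)
  rw [LongVirtualDiagram.crossingDet_eq, LongVirtualDiagram.crossingDet_eq]
  rcases hpat with ⟨height, hinj, rfl⟩ | ⟨k, hk⟩
  · have hover : ∀ i j, height j < height i → D.Over (X i j) (X j i) := by
      intro i j h
      have hij : i ≠ j := by rintro rfl; exact lt_irrefl _ h
      exact hP.over_of_layered (hXne i j hij) (hXc i j hij) (hX i j hij) (hX j i hij.symm) h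
    obtain ⟨i, j, k, h1, h2⟩ : ∃ i j k, height k < height j ∧ height j < height i := by
      have e1 := hinj.ne (show (0 : Fin 3) ≠ 1 by simp)
      have e2 := hinj.ne (show (0 : Fin 3) ≠ 2 by simp)
      have e3 := hinj.ne (show (1 : Fin 3) ≠ 2 by simp)
      rcases lt_or_gt_of_ne e1 with h1 | h1 <;> rcases lt_or_gt_of_ne e2 with h2 | h2 <;>
        rcases lt_or_gt_of_ne e3 with h3 | h3
      · exact ⟨2, 1, 0, h1, h3⟩
      · exact ⟨1, 2, 0, h2, h3⟩
      · omega
      · exact ⟨1, 0, 2, h2, h1⟩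
      · exact ⟨2, 0, 1, h1, h2⟩
      · omega
      · exact ⟨0, 2, 1, h3, h2⟩
      · exact ⟨0, 1, 2, h3, h1⟩
    have hij : i ≠ j := by rintro rfl; exact lt_irrefl _ h2
    have hjk : j ≠ k := by rintro rfl; exact lt_irrefl _ h1
    have hik : i ≠ k := by rintro rfl; exact lt_asymm h1 h2
    exact HT.det_eq_of_over hij hik hjk (hover i j h2) (hover i k (h1.trans h2)) (hover j k h1)
  · refine HT.det_eq_of_virtual k fun i hik => ?_
    exact hP.virt_of_virtual (hXne i k hik) (hXc i k hik) (hX i k hik) (hX k i hik.symm)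
      (hk i hik).1 (hk i hik).2

/-! ## The lower bound for the number of virtual crossings -/

lemma Step.degree_eq (H : Step D D') : D'.crossingDet.degree = D.crossingDet.degree := by
  rcases H with H | H | H | H
  · rw [H.crossingDet_eq]
  · exact H.degree_eq
  · rw [H.crossingDet_eq]
  · rw [H.crossingDet_eq]

lemma degree_crossingDet_eq_of_knot_eq (h : D'.knot = D.knot) :
    D'.crossingDet.degree = D.crossingDet.degree := by
  have := Quot.eqvGen_exact h
  clear h
  induction this with
  | rel x y h => exact h.degree_eq.symm
  | refl x => rfl
  | symm x y _ ih => exact ih.symm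
  | trans x y z _ _ h1 h2 => exact h1.trans h2

lemma degree_crossingDet_le (D : LongVirtualDiagram) :
    D.crossingDet.degree ≤ ((D.numVirtual : ℤ) : WithBot ℤ) := by
  rcases isEmpty_or_nonempty D.ClassicalCrossing with h | h
  · rw [D.crossingDet_of_isEmpty]; simp
  · rw [← D.zeta_eq_crossingDet]
    exact D.degree_zeta_le

end LongVirtualDiagram

theorem corollary1 (D : LongVirtualDiagram)
    (hdeg : D.zeta.degree = ((D.numVirtual : ℤ) : WithBot ℤ)) :
    ∀ D' : LongVirtualDiagram, D'.knot = D.knot → D.numVirtual ≤ D'.numVirtual := by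
  intro D' hD'
  rcases isEmpty_or_nonempty D.ClassicalCrossing with h | h
  -- Without classical crossings zeta is 1, of degree at most 0, so the hypothesis already forces
  -- `D` to have no virtual crossings.
  · rw [D.zeta_of_isEmpty] at hdeg
    have h1 : (1 : LaurentPolynomial ZetaRing).degree ≤ ((0 : ℤ) : WithBot ℤ) := by
      simpa using LaurentPolynomial.degree_C_le (1 : ZetaRing)
    rw [hdeg, WithBot.coe_le_coe] at h1
    omega
  · rw [D.zeta_eq_crossingDet, ← LongVirtualDiagram.degree_crossingDet_eq_of_knot_eq hD'] at hdeg
    have h1 := D'.degree_crossingDet_le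
    rw [hdeg, WithBot.coe_le_coe] at h1
    exact_mod_cast h1
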